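/- Let $K$ be a number field with ring of integers $\mathcal O_K$, $s_1$ real and $s_2$ complex places, regulator $R_K$, discriminant $\Delta_K$, class number $h_K$ and $\omega_K$ roots of unity, and put $\rho_K := 2^{s_1}(2\pi)^{s_2}R_K/(\omega_K\sqrt{|\Delta_K|})$. Let $\mathcal I_K$ be the monoid of nonzero ideals of $\mathcal O_K$, $\mathfrak N$ the absolute norm and $\mu_K$ the Möbius function on $\mathcal I_K$; $\mathfrak p$ always runs over the nonzero prime ideals. For $n\ge 0$ and real $C\ge 1$ let $\Theta_n'(C)$ be the set of all functions $\theta:\mathcal I_K^n\to\mathbb R_{\ge 0}$ of the form $\theta(\mathfrak a_1,\dots,\mathfrak a_n)=\prod_{\mathfrak p}\theta_{\mathfrak p}(\{i:\mathfrak p\mid\mathfrak a_i\})$, where each $\theta_{\mathfrak p}$ is a function from the subsets of $\{1,\dots,n\}$ to $[0,1]$ with $\theta_{\mathfrak p}(\emptyset)\ge 1-C\,\mathfrak N\mathfrak p^{-2}$ and $\theta_{\mathfrak p}(J)\ge 1-C\,\mathfrak N\mathfrak p^{-1}$ whenever $|J|=1$. The average of a function $\vartheta:\mathcal I_K\to\mathbb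 R$ is $\mathcal A(\vartheta(\mathfrak a),\mathfrak a):=\sum_{\mathfrak a\in\mathcal I_K}(\vartheta*\mu_K)(\mathfrak a)/\mathfrak N\mathfrak a$, where $*$ is Dirichlet convolution. For $\theta\in\Theta'_{n}(C)$ let $\theta_0$ be its full iterated average: average over $\mathfrak a_n$, then over $\mathfrak a_{n-1}$, and so on down to $\mathfrak a_1$. Let $r\ge 1$ be an integer and let $V:\mathbb R_{\ge 1}^{r+1}\times\mathbb R_{\ge 3}\to\mathbb R_{\ge 0}$ be a function, measurable in its first $r+1$ variables, which satisfies (b) or (c): (b) there are $k_1,\dots,k_{r+1}\in\mathbb R$ with $k_1\ne0$, $k_{r+1}\neq 0$, and $a>0$ such that $$V(t_1,\dots,t_{r+1};B)\ll \frac{B}{t_1\cdots t_{r+1}}\left(\frac{B}{t_1^{k_1}\cdots t_{r+1}^{k_{r+1}}}\right)^{-a},$$ and $V(t_1,\dots,t_{r+1};B)=0$ unless $t_1^{k_1}\cdots t_{r+1}^{k_{r+1}}\le B$; (c) there are $k_1,\dots,k_{r+1}\in\mathbb R$ with $k_1\ne0$, $k_{r+1}\neq 0$, and $a,b>0$ such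 that $$V(t_1,\dots,t_{r+1};B)\ll \frac{B}{t_1\cdots t_{r+1}}\min\left\{\left(\frac{B}{t_1^{k_1}\cdots t_{r+1}^{k_{r+1}}}\right)^{-a},\left(\frac{B}{t_1^{k_1}\cdots t_{r+1}^{k_{r+1}}}\right)^{b}\right\}.$$ The implied constants are uniform in $t_1,\dots,t_{r+1}\ge 1$ and $B\ge 3$. Assume also that $V(t_1,\dots,t_{r+1};B)=0$ unless $t_1,\dots,t_{r+1}\le B$. For $0\le l\le r+1$ let $$V_l(t_1,\dots,t_l;B):=\int_{t_{l+1},\dots,t_{r+1}\ge 1}V(t_1,\dots,t_{r+1};B)\,dt_{l+1}\cdots dt_{r+1}$$ (so $V_{r+1}=V$), and assume that there is a constant $R$ such that for all $1\le l\le r+1$ and all fixed $t_1,\dots,t_{l-1}\ge 1$ and $B\ge 3$ there is a partition of $[1,B]$ into at most $R$ intervals on whose interiors $V_l(t_1,\dots,t_l;B)$, as a function of $t_l$, is continuously differentiable and monotonic. Then for every real $C\ge 1$, all $\theta\in\Theta_{r+1}'(C)$ and all $B\ge 3$, $$\sum_{\mathfrak a_1,\dots,\mathfrak a_{r+1}\in\mathcal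 I_K}\theta(\mathfrak a_1,\dots,\mathfrak a_{r+1})\,V(\mathfrak N\mathfrak a_1,\dots,\mathfrak N\mathfrak a_{r+1};B)=(\rho_Kh_K)^{r+1}\,\theta_0\,V_0(B)+O\bigl(B(\log B)^{r-1}\log\log B\bigr),$$ where the implied constant depends only on $K$, $V$ and $C$. -/

import Mathlib

open scoped nonZeroDivisors
open MeasureTheory Set NumberField IsDedekindDomain

noncomputable section

namespace IdealSums

/-- The monoid `I_K` of nonzero ideals of the ring of integers of `K`. -/
abbrev NzIdeal (K : Type*) [Field K] [NumberField K] : Type _ := (Ideal (𝓞 K))⁰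

/-- The absolute norm `N𝔞` of a nonzero ideal, as a real number. -/
def idealNorm {K : Type*} [Field K] [NumberField K] (a : NzIdeal K) : ℝ :=
  (Ideal.absNorm (a : Ideal (𝓞 K)) : ℝ)

/-- `ρ_K = 2^{s₁} (2π)^{s₂} R_K / (ω_K √|Δ_K|)`. -/
def rho (K : Type*) [Field K] [NumberField K] : ℝ :=
  2 ^ InfinitePlace.nrRealPlaces K * (2 * Real.pi) ^ InfinitePlace.nrComplexPlaces K *
      Units.regulator K /
    (Units.torsionOrder K * Real.sqrt |(discr K : ℝ)|)

open Classical in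
/-- The Möbius function `μ_K` on nonzero ideals. -/
def moebius {K : Type*} [Field K] [NumberField K] (a : NzIdeal K) : ℝ :=
  if Squarefree (a : Ideal (𝓞 K)) then
    (-1) ^ (UniqueFactorizationMonoid.normalizedFactors (a : Ideal (𝓞 K))).card
  else 0

/-- Dirichlet convolution `(f * g)(𝔞) = ∑_{𝔟𝔠 = 𝔞} f(𝔟) g(𝔠)` (a finite sum). -/
def conv {K : Type*} [Field K] [NumberField K] (f g : NzIdeal K → ℝ) (a : NzIdeal K) : ℝ :=
  ∑ᶠ p ∈ {p : NzIdeal K × NzIdeal K | p.1 * p.2 = a}, f p.1 * g p.2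

/-- The average `A(ϑ(𝔞), 𝔞) = ∑_𝔞 (ϑ * μ_K)(𝔞) / N𝔞`. -/
def average {K : Type*} [Field K] [NumberField K] (f : NzIdeal K → ℝ) : ℝ :=
  ∑' a : NzIdeal K, conv f moebius a / idealNorm a

/-- The average of `θ(𝔞₁, …, 𝔞ₙ₊₁)` over its last variable, a function of `𝔞₁, …, 𝔞ₙ`. -/
def averageLast {K : Type*} [Field K] [NumberField K] {n : ℕ}
    (θ : (Fin (n + 1) → NzIdeal K) → ℝ) (a : Fin n → NzIdeal K) : ℝ :=
  average fun x => θ (Fin.snoc a x)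

/-- The full iterated average `A(θ(𝔞₁, …, 𝔞ₙ), 𝔞ₙ, …, 𝔞₁)`: one averages over `𝔞ₙ` first,
then over `𝔞ₙ₋₁`, and so on down to `𝔞₁`. -/
def iteratedAverage {K : Type*} [Field K] [NumberField K] :
    (n : ℕ) → ((Fin n → NzIdeal K) → ℝ) → ℝ
  | 0, θ => θ Fin.elim0
  | n + 1, θ => iteratedAverage n (averageLast θ)

open Classical in
/-- `J_𝔭(𝔞₁, …, 𝔞ₙ) = {i : 𝔭 ∣ 𝔞ᵢ}`. -/
def divIndices {K : Type*} [Field K] [NumberField K] {n : ℕ}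
    (p : HeightOneSpectrum (𝓞 K)) (a : Fin n → NzIdeal K) : Finset (Fin n) :=
  Finset.univ.filter fun i => p.asIdeal ∣ (a i : Ideal (𝓞 K))

/-- The class `Θ'ₙ(C)`. The partial products of the factors, which lie in `[0, 1]`, are
decreasing, so the infinite product always converges. -/
def ThetaPrime (K : Type*) [Field K] [NumberField K] (n : ℕ) (C : ℝ) :
    Set ((Fin n → NzIdeal K) → ℝ) :=
  {θ | ∃ f : HeightOneSpectrum (𝓞 K) → Finset (Fin n) → ℝ,
    (∀ p J, 0 ≤ f p J ∧ f p J ≤ 1) ∧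
    (∀ p, 1 - C / (Ideal.absNorm p.asIdeal : ℝ) ^ 2 ≤ f p ∅) ∧
    (∀ p J, J.card = 1 → 1 - C / (Ideal.absNorm p.asIdeal : ℝ) ≤ f p J) ∧
    ∀ a, θ a = ∏' p, f p (divIndices p a)}

/-- `[1, B]` can be partitioned into at most `R` intervals, on the interior of each of which
`g` is continuously differentiable and monotonic. The intervals of the partition have the
consecutive endpoints `x 0 = 1 ≤ x 1 ≤ … ≤ x m = B`, with `m ≤ R`. -/
def PiecewiseMonotoneC1 (g : ℝ → ℝ) (B : ℝ) (R : ℕ) : Prop :=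
  ∃ m : ℕ, m ≤ R ∧ ∃ x : Fin (m + 1) → ℝ, Monotone x ∧ x 0 = 1 ∧ x (Fin.last m) = B ∧
    ∀ i : Fin m,
      ContDiffOn ℝ 1 g (Ioo (x i.castSucc) (x i.succ)) ∧
      (MonotoneOn g (Ioo (x i.castSucc) (x i.succ)) ∨
        AntitoneOn g (Ioo (x i.castSucc) (x i.succ)))

/-- For a function `W` of `n` variables and `l ≤ n`, the function of `t₁, …, t_l` given by
`∫_{t_{l+1}, …, t_n ≥ 1} W(t₁, …, t_n) dt_{l+1} ⋯ dt_n`. -/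
def tailIntegral {n : ℕ} (W : (Fin n → ℝ) → ℝ) (l : ℕ) (t : Fin l → ℝ) : ℝ :=
  ∫ u in {u : Fin (n - l) → ℝ | ∀ i, 1 ≤ u i},
    W fun i => if h : (i : ℕ) < l then t ⟨i, h⟩ else u ⟨(i : ℕ) - l, by omega⟩

/-- Growth condition of type (b) on `V(t₁, …, t_{r+1}; B)`. -/
def GrowthB {r : ℕ} (V : (Fin (r + 1) → ℝ) → ℝ → ℝ) : Prop :=
  ∃ (k : Fin (r + 1) → ℝ) (a c : ℝ), k 0 ≠ 0 ∧ k (Fin.last r) ≠ 0 ∧ 0 < a ∧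
    ∀ t B, (∀ i, 1 ≤ t i) → 3 ≤ B →
      V t B ≤ c * (B / (∏ i, t i) * (B / ∏ i, (t i) ^ (k i)) ^ (-a)) ∧
      (B < ∏ i, (t i) ^ (k i) → V t B = 0)

/-- Growth condition of type (c) on `V(t₁, …, t_{r+1}; B)`. -/
def GrowthC {r : ℕ} (V : (Fin (r + 1) → ℝ) → ℝ → ℝ) : Prop :=
  ∃ (k : Fin (r + 1) → ℝ) (a b c : ℝ), k 0 ≠ 0 ∧ k (Fin.last r) ≠ 0 ∧ 0 < a ∧ 0 < b ∧
    ∀ t B, (∀ i, 1 ≤ t i) → 3 ≤ B →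
      V t B ≤ c * (B / (∏ i, t i) *
        min ((B / ∏ i, (t i) ^ (k i)) ^ (-a)) ((B / ∏ i, (t i) ^ (k i)) ^ b))

end IdealSums

end

/-! Möbius inversion on subsets writes each local factor of `θ` as `θ_𝔭(J) = ∑_{I ⊆ J} h_𝔭(I)`.
Multiplying out the Euler product turns `θ` into a combination `∑_ν c_ν · 1[d_i(ν) ∣ 𝔞_i for all i]`
with `d_i(ν)` squarefree (`exists_expansion`). The conditions defining `Θ'` give `h_𝔭({i}) =
O(1/N𝔭)`. Hence for `σ > 1/2` the sum `∑ |c_ν| ∏ N d_i^{-σ}` is dominated by an Euler product with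
factors `1 + O(N𝔭^{-2σ})`, uniformly in `θ` (`exists_expansion_summable`). The average of `1[d ∣ 𝔞]`
is `1/N d`, so `θ₀ = ∑ c_ν / ∏ N d_i` (`iteratedAverage_eq_tsum`).

It then suffices to treat sums of `V(q_1 N𝔟_1, …, q_{r+1} N𝔟_{r+1}; B)` with main term `κ^{r+1} V_0
/ ∏ q_i`, where `κ = ρ_K h_K`, and error `O(B (log B)^{r-1} ∏ q_i^{-σ})` uniformly in `q_i ≥ 1`
(`exists_abs_boxSum_sub_le`). The sums are replaced by integrals one variable at a time, starting
with the last. For one variable, ideals are counted as `κ t + O(t^σ)`, and a layer-cake argument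
gives error `O(M q^{-σ})` for a piecewise monotone function bounded by `M x^{-α}`, `α > σ`
(`CountingBound.piecewise_monotone`).

Both growth conditions say that `V` decays exponentially in the logarithmic distance to a
hypersurface, and this is what saves a logarithm. Once the last variable is integrated, `k_{r+1} ≠
0` has already saved it (`exists_stage_lower`). When the last sum itself is replaced, the decay is
kept in the error term and `k_1 ≠ 0` makes the sum over `𝔞_1` bounded (`exists_stage_top`).

The ideal count comes from the geometry of numbers: lattice points in a dilated cone are counted up
to a neighbourhood of its boundary, whose volume is `O(√ε)` for width `ε`
(`exists_volume_collar_normLeOne_le`). The resulting error for the theorem is `O(B (log B)^{r-1})`;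
the factor `log log B` is only inserted at the end. -/

noncomputable section

namespace IdealSums

/-! ### Lattice points and volume, up to a neighbourhood of the boundary -/

section LatticeCounting

open scoped Pointwise

/-- The points within distance `D` of a point on the other side of the boundary of `s`. -/
def collar {E : Type*} [NormedAddCommGroup E] (s : Set E) (D : ℝ) : Set E :=
  {x | ∃ y, ‖x - y‖ ≤ D ∧ ¬(x ∈ s ↔ y ∈ s)}

lemma collar_bounded {E : Type*} [NormedAddCommGroup E] {s : Set E} (hs : Bornology.IsBounded s) (D : ℝ) :
    Bornology.IsBounded (collar s D) := by
  obtain ⟨r, hr⟩ := hs.exists_norm_le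
  refine isBounded_iff_forall_norm_le.2 ⟨r + |D|, fun x hx ↦ ?_⟩
  obtain ⟨y, hxy, h⟩ := hx
  by_cases hx : x ∈ s
  · have := hr x hx
    have := abs_nonneg D
    linarith
  · have hy : y ∈ s := by tauto
    have h1 := hr y hy
    have h2 := norm_add_le (x - y) y
    have h3 := le_abs_self D
    rw [sub_add_cancel] at h2
    linarith

variable {E : Type*} [NormedAddCommGroup E] [NormedSpace ℝ E]

/-- Dilating the domain amounts to fixing it and narrowing the collar, so only small collars of one
fixed set have to be measured. -/
lemma collar_smul (s : Set E) (D : ℝ) {c : ℝ} (hc : 0 < c) :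
    collar (c • s) D = c • collar s (D / c) := by
  ext x
  rw [Set.mem_smul_set_iff_inv_smul_mem₀ hc.ne']
  constructor
  · rintro ⟨y, hxy, h⟩
    refine ⟨c⁻¹ • y, ?_, ?_⟩
    · rw [← smul_sub, norm_smul, norm_inv, Real.norm_of_nonneg hc.le, div_eq_inv_mul]
      gcongr
    · rwa [Set.mem_smul_set_iff_inv_smul_mem₀ hc.ne', Set.mem_smul_set_iff_inv_smul_mem₀ hc.ne'] at h
  · rintro ⟨y, hxy, h⟩
    refine ⟨c • y, ?_, ?_⟩
    · have : x - c • y = c • (c⁻¹ • x - y) := by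
        rw [smul_sub, smul_inv_smul₀ hc.ne']
      rw [this, norm_smul, Real.norm_of_nonneg hc.le]
      rwa [le_div_iff₀' hc] at hxy
    · rwa [Set.mem_smul_set_iff_inv_smul_mem₀ hc.ne', Set.smul_mem_smul_set_iff₀ hc.ne']

variable [FiniteDimensional ℝ E] [MeasurableSpace E] [BorelSpace E]

open Module Submodule in
/-- Counting lattice points in a bounded set, with an error bounded by the volume of a collar of
its boundary. -/
theorem exists_card_inter_sub_le (L : Submodule ℤ E) [DiscreteTopology L] [IsZLattice ℝ L]
    (μ : Measure E) [μ.IsAddHaarMeasure] :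
    ∃ D : ℝ, 0 < D ∧ ∀ s : Set E, Bornology.IsBounded s →
      |Nat.card (s ∩ L : Set E) * ZLattice.covolume L μ - μ.real s| ≤ μ.real (collar s D) := by
  classical
  let b := (Free.chooseBasis ℤ L).ofZLatticeBasis ℝ L
  let P := ZSpan.fundamentalDomain b
  have hspan : span ℤ (Set.range b) = L := (Free.chooseBasis ℤ L).ofZLatticeBasis_span ℝ
  have hP : IsAddFundamentalDomain L P μ := ZLattice.isAddFundamentalDomain _ μ
  obtain ⟨D, hD0, hD⟩ : ∃ D : ℝ, 0 < D ∧ ∀ x ∈ P, ‖x‖ ≤ D :=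
    (ZSpan.fundamentalDomain_isBounded b).exists_pos_norm_le
  refine ⟨D, hD0, fun s hs ↦ ?_⟩
  have hfin : (s ∩ L : Set E).Finite := by
    rw [← hspan]; exact ZSpan.setFinite_inter b hs
  have hA : μ (collar s D) ≠ ⊤ := (collar_bounded hs D).measure_lt_top.ne
  have hS : μ s ≠ ⊤ := hs.measure_lt_top.ne
  let T : Finset L := hfin.toFinset.subtype (· ∈ L)
  have hTmem : ∀ v : L, v ∈ T ↔ (v : E) ∈ s := by
    intro v; simp [T]
  have hTcard : T.card = Nat.card (s ∩ L : Set E) := by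
    rw [Nat.card_coe_set_eq, Set.ncard_eq_toFinset_card _ hfin, Finset.card_subtype,
      Finset.filter_true_of_mem]
    intro x hx
    simpa using (hfin.mem_toFinset.1 hx).2
  -- The cells attached to the lattice points of `s` have total measure (number of points) ×
  -- covolume. Each point of a cell is within `D` of its lattice point, so `U` and `s` differ only
  -- inside the collar.
  let U : Set E := ⋃ v ∈ T, v +ᵥ P
  have hPm : MeasurableSet P := ZSpan.fundamentalDomain_measurableSet b
  have hU : μ U = T.card * μ P := by
    rw [measure_biUnion_finset₀]
    · have : ∀ v ∈ T, μ (v +ᵥ P) = μ P := fun v _ ↦ by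
        have : (v +ᵥ P) = (v : E) +ᵥ P := rfl
        rw [this, measure_vadd]
      rw [Finset.sum_congr rfl this, Finset.sum_const, nsmul_eq_mul]
    · intro v _ w _ hvw
      exact hP.aedisjoint hvw
    · intro v _
      have : (v +ᵥ P) = (v : E) +ᵥ P := rfl
      rw [this]
      exact (hPm.const_vadd _).nullMeasurableSet
  have h1 : U ⊆ s ∪ collar s D := by
    intro x hx
    simp only [U, mem_iUnion] at hx
    obtain ⟨v, hv, y, hy, rfl⟩ := hx
    by_cases h : (v +ᵥ y : E) ∈ s
    · exact Or.inl h
    · refine Or.inr ⟨v, ?_, ?_⟩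
      · have : (v +ᵥ y : E) - v = y := by
          change (v : E) + y - v = y
          abel
        change ‖(v +ᵥ y : E) - v‖ ≤ D
        rw [this]; exact hD y hy
      · rw [hTmem] at hv
        exact fun h' ↦ h (h'.2 hv)
  have h2 : s ⊆ U ∪ collar s D := by
    intro x hx
    let v : L := ⟨ZSpan.floor b x, hspan.le (ZSpan.floor b x).2⟩
    have hvx : x - v = ZSpan.fract b x := rfl
    by_cases hv : (v : E) ∈ s
    · refine Or.inl (mem_biUnion ((hTmem v).2 hv) ⟨ZSpan.fract b x,
        ZSpan.fract_mem_fundamentalDomain b x, ?_⟩)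
      change (v : E) + ZSpan.fract b x = x
      rw [← hvx, add_sub_cancel]
    · refine Or.inr ⟨v, ?_, fun h' ↦ hv (h'.1 hx)⟩
      rw [hvx]; exact hD _ (ZSpan.fract_mem_fundamentalDomain b x)
  have hPtop : μ P ≠ ⊤ := (ZSpan.fundamentalDomain_isBounded b).measure_lt_top.ne
  have hUr : μ.real U = Nat.card (s ∩ L : Set E) * ZLattice.covolume L μ := by
    rw [ZLattice.covolume_eq_measure_fundamentalDomain L μ hP, measureReal_def, hU, hTcard,
      ENNReal.toReal_mul, ENNReal.toReal_natCast, measureReal_def]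
  have hUtop : μ U ≠ ⊤ := by rw [hU]; exact ENNReal.mul_ne_top (ENNReal.natCast_ne_top _) hPtop
  rw [← hUr, abs_sub_le_iff]
  constructor
  · have : μ.real U ≤ μ.real s + μ.real (collar s D) :=
      (measureReal_mono h1 (measure_union_lt_top hS.lt_top hA.lt_top).ne).trans
        (measureReal_union_le _ _)
    linarith
  · have : μ.real s ≤ μ.real U + μ.real (collar s D) :=
      (measureReal_mono h2 (measure_union_lt_top hUtop.lt_top hA.lt_top).ne).trans
        (measureReal_union_le _ _)
    linarith

end LatticeCounting

/-! ### Volume of a thin neighbourhood of the boundary of `normLeOne K` -/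

section CollarVolume

open NumberField.mixedEmbedding NumberField.mixedEmbedding.fundamentalCone
  NumberField.InfinitePlace NumberField.Units NumberField.Units.dirichletUnitTheorem
open scoped ENNReal

variable (K : Type*) [Field K] [NumberField K]

-- The Jacobian of `expMapBasis` leaves a density depending on the coordinate `w₀` alone; every
-- other coordinate contributes just the length of its interval.
open Classical in
lemma setLIntegral_pi_exp (T : InfinitePlace K → Set ℝ) (n : ℕ) :
    ∫⁻ x : realSpace K in Set.univ.pi T, .ofReal (Real.exp (x w₀ * n)) =
      (∏ w : {w // w ∈ (Finset.univ : Finset (InfinitePlace K)).erase w₀}, volume (T w)) *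
        ∫⁻ t in T w₀, .ofReal (Real.exp (t * n)) := by
  rw [volume_pi, Measure.restrict_pi_pi, lintegral_eq_lmarginal_univ 0,
    lmarginal_erase' _ (by fun_prop) (Finset.mem_univ w₀)]
  simp_rw [Function.update_self, lmarginal, lintegral_const, Measure.pi_univ,
    Measure.restrict_apply_univ]
  rw [mul_comm]

open Classical in
/-- The points of the mixed space with one small coordinate. -/
lemma exists_volume_small_coordinate_le (R : ℝ) :
    ∃ c : ℝ≥0∞, c ≠ ⊤ ∧ ∀ (v : InfinitePlace K) (τ : ℝ),
      volume {x : mixedSpace K | (∀ w, normAtPlace w x ≤ R) ∧ normAtPlace v x ≤ τ} ≤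
        c * ENNReal.ofReal τ := by
  let m := Fintype.card (InfinitePlace K)
  refine ⟨2 ^ nrRealPlaces K * .ofReal (2 * Real.pi) ^ nrComplexPlaces K *
    (ENNReal.ofReal R ^ nrComplexPlaces K * ENNReal.ofReal R ^ (m - 1)), by finiteness,
    fun v τ ↦ ?_⟩
  let S : Set (realSpace K) := Set.univ.pi fun w ↦ Icc 0 (if w = v then min R τ else R)
  have hS : MeasurableSet S := MeasurableSet.univ_pi fun _ ↦ measurableSet_Icc
  have hSnn : ∀ x ∈ S, ∀ w, 0 ≤ x w := fun x hx w ↦ (hx w (mem_univ w)).1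
  have hSR : ∀ x ∈ S, ∀ w, x w ≤ R := fun x hx w ↦ by
    have := (hx w (mem_univ w)).2
    split_ifs at this
    · exact this.trans (min_le_left _ _)
    · exact this
  have hset : {x : mixedSpace K | (∀ w, normAtPlace w x ≤ R) ∧ normAtPlace v x ≤ τ} =
      normAtAllPlaces ⁻¹' S := by
    ext x
    simp only [S, mem_ofPred_eq, mem_preimage, mem_univ_pi, mem_Icc, normAtPlace_nonneg, true_and]
    constructor
    · rintro ⟨h1, h2⟩ w
      split_ifs with h
      · subst h; exact le_min (h1 _) h2
      · exact h1 w
    · intro h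
      refine ⟨fun w ↦ ?_, ?_⟩
      · have := h w
        split_ifs at this
        · exact this.trans (min_le_left _ _)
        · exact this
      · have := h v
        rw [if_pos rfl] at this
        exact this.trans (min_le_right _ _)
  have himg : normAtAllPlaces '' (normAtAllPlaces ⁻¹' S : Set (mixedSpace K)) = S :=
    normAtAllPlaces_image_preimage_of_nonneg hSnn
  have hvol : volume S ≤ ENNReal.ofReal R ^ (m - 1) * ENNReal.ofReal τ := by
    rw [volume_pi_pi, ← Finset.prod_erase_mul _ _ (Finset.mem_univ v)]
    refine mul_le_mul' ?_ ?_
    · rw [Finset.prod_congr rfl (g := fun _ ↦ ENNReal.ofReal R)]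
      · rw [Finset.prod_const, Finset.card_erase_of_mem (Finset.mem_univ _), Finset.card_univ]
      · intro w hw
        rw [if_neg (Finset.ne_of_mem_erase hw), Real.volume_Icc, sub_zero]
    · rw [if_pos rfl, Real.volume_Icc, sub_zero]
      exact ENNReal.ofReal_le_ofReal (min_le_right _ _)
  rw [hset, volume_eq_two_pow_mul_two_pi_pow_mul_integral (by rw [himg])
    (hS.preimage (continuous_normAtAllPlaces K).measurable), himg, mul_assoc _ (_ * _ ^ (m - 1))]
  gcongr
  -- Each complex place contributes a polar density, at most `R` on this region.
  calc ∫⁻ x in S, ∏ w : {w // IsComplex w}, ENNReal.ofReal (x w.1)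
      ≤ ∫⁻ x in S, ENNReal.ofReal R ^ nrComplexPlaces K := by
        refine setLIntegral_mono measurable_const fun x hx ↦ ?_
        rw [nrComplexPlaces, ← Finset.card_univ, ← Finset.prod_const]
        exact Finset.prod_le_prod' fun w _ ↦ ENNReal.ofReal_le_ofReal (hSR x hx w)
    _ ≤ _ := by
        rw [setLIntegral_const, mul_assoc]
        gcongr

open Classical in
/-- The points of the mixed space one of whose logarithmic coordinates lies in a short interval. -/
lemma exists_volume_slab_le :
    ∃ c : ℝ≥0∞, c ≠ ⊤ ∧ ∀ (v : InfinitePlace K) (a η : ℝ),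
      volume {x : mixedSpace K | ∃ y : realSpace K, expMapBasis y = normAtAllPlaces x ∧
        y w₀ ≤ 1 ∧ (∀ w, w ≠ w₀ → y w ∈ Icc (-1) 2) ∧ y v ∈ Icc (a - η) (a + η)} ≤
        c * ENNReal.ofReal η := by
  let d := Module.finrank ℚ K
  have hd : (0 : ℝ) < d := Nat.cast_pos.2 Module.finrank_pos
  let m := Fintype.card (InfinitePlace K)
  let c₁ : ℝ≥0∞ := 2 ^ nrRealPlaces K * .ofReal (2 * Real.pi) ^ nrComplexPlaces K *
    ((2 : ℝ≥0∞)⁻¹ ^ nrComplexPlaces K * ENNReal.ofReal (regulator K) * (Module.finrank ℚ K))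
  -- The first summand bounds the density on `(-∞, 1]`, for a short interval in the coordinate `w₀`;
  -- the second is the whole mass of `(-∞, 1]`, for a short interval in another coordinate.
  let c₂ : ℝ≥0∞ := ENNReal.ofReal (Real.exp d) + ENNReal.ofReal (Real.exp d / d)
  have hc₁ : c₁ ≠ ⊤ := by
    refine ENNReal.mul_ne_top (by finiteness) (ENNReal.mul_ne_top ?_ (by finiteness))
    refine ENNReal.mul_ne_top (ENNReal.pow_ne_top (by simp)) (by finiteness)
  refine ⟨c₁ * (3 ^ m * c₂ * 2), by finiteness, fun v a η ↦ ?_⟩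
  let T : InfinitePlace K → Set ℝ := fun w ↦
    (if w = w₀ then Iic 1 else Icc (-1) 2) ∩ (if w = v then Icc (a - η) (a + η) else univ)
  have hT : ∀ w, MeasurableSet (T w) := by
    intro w
    refine MeasurableSet.inter ?_ ?_ <;> split_ifs <;> measurability
  let S : Set (realSpace K) := Set.univ.pi T
  have hS : MeasurableSet S := MeasurableSet.univ_pi hT
  have hset : {x : mixedSpace K | ∃ y : realSpace K, expMapBasis y = normAtAllPlaces x ∧
        y w₀ ≤ 1 ∧ (∀ w, w ≠ w₀ → y w ∈ Icc (-1) 2) ∧ y v ∈ Icc (a - η) (a + η)} ⊆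
      normAtAllPlaces ⁻¹' (expMapBasis '' S) := by
    rintro x ⟨y, hy, h1, h2, h3⟩
    refine ⟨y, fun w _ ↦ ⟨?_, ?_⟩, hy⟩
    · split_ifs with h
      · exact h ▸ h1
      · exact h2 w h
    · split_ifs with h
      · exact h ▸ h3
      · trivial
  have hmeas : MeasurableSet (expMapBasis '' S) :=
    hS.image_of_continuousOn_injOn (continuous_expMapBasis K).continuousOn
      (injective_expMapBasis K).injOn
  refine (measure_mono hset).trans ?_
  rw [volume_eq_two_pow_mul_two_pi_pow_mul_integral
    (by rw [normAtAllPlaces_image_preimage_expMapBasis])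
    (hmeas.preimage (continuous_normAtAllPlaces K).measurable),
    normAtAllPlaces_image_preimage_expMapBasis, setLIntegral_expMapBasis_image hS (by fun_prop)]
  -- The polar density at the complex places cancels against the same product in the Jacobian of
  -- `expMapBasis`.
  simp_rw [ENNReal.inv_mul_cancel_right
    (Finset.prod_ne_zero_iff.mpr fun _ _ ↦ ENNReal.ofReal_ne_zero_iff.mpr (expMapBasis_pos _ _))
    (ENNReal.prod_ne_top fun _ _ ↦ ENNReal.ofReal_ne_top)]
  rw [← mul_assoc, mul_assoc c₁]
  refine mul_le_mul' le_rfl ?_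
  rw [setLIntegral_pi_exp]
  have hI : volume (Icc (a - η) (a + η)) = 2 * ENNReal.ofReal η := by
    rw [Real.volume_Icc, show a + η - (a - η) = 2 * η by ring, ENNReal.ofReal_mul zero_le_two]
    simp
  have h3 : ∀ w, w ≠ w₀ → volume (T w) ≤ 3 := by
    intro w hw
    refine (measure_mono (t := Icc (-1) 2) ?_).trans ?_
    · simp only [T, if_neg hw]; exact inter_subset_left
    · rw [Real.volume_Icc]; norm_num
  have hone : (1 : ℝ≥0∞) ≤ 3 := by norm_num
  have hcard : ((Finset.univ : Finset (InfinitePlace K)).erase w₀).card ≤ m :=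
    Finset.card_le_card (Finset.erase_subset _ _)
  rw [Finset.prod_coe_sort ((Finset.univ : Finset (InfinitePlace K)).erase w₀)
    (fun w ↦ volume (T w))]
  by_cases hv : v = w₀
  · subst hv
    have h4 : ∫⁻ t in T w₀, ENNReal.ofReal (Real.exp (t * d)) ≤ c₂ * (2 * ENNReal.ofReal η) := by
      calc _ ≤ ∫⁻ t in T w₀, ENNReal.ofReal (Real.exp d) := by
            refine setLIntegral_mono measurable_const fun t ht ↦ ?_
            refine ENNReal.ofReal_le_ofReal (Real.exp_le_exp.2 ?_)
            have : t ≤ 1 := by simpa [T] using ht.1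
            nlinarith
        _ ≤ _ := by
            rw [setLIntegral_const]
            refine mul_le_mul' le_self_add ?_
            rw [← hI]
            refine measure_mono ?_
            simp only [T, if_true]; exact inter_subset_right
    calc _ ≤ 3 ^ m * (c₂ * (2 * ENNReal.ofReal η)) := by
          refine mul_le_mul' ?_ h4
          exact (Finset.prod_le_pow_card _ _ 3 fun w hw ↦ h3 w (Finset.ne_of_mem_erase hw)).trans
            (pow_le_pow_right' hone hcard)
      _ = _ := by ring
  · have h4 : ∫⁻ t in T w₀, ENNReal.ofReal (Real.exp (t * d)) ≤ c₂ := by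
      calc _ ≤ ∫⁻ t in Iic 1, ENNReal.ofReal (Real.exp (t * d)) := by
            refine lintegral_mono_set ?_
            simp only [T, if_true]; exact inter_subset_left
        _ = ENNReal.ofReal (Real.exp d / d) := by
            simp_rw [mul_comm _ (d : ℝ)]
            rw [← ofReal_integral_eq_lintegral_ofReal (integrableOn_exp_mul_Iic hd _)
              (Filter.Eventually.of_forall fun _ ↦ Real.exp_nonneg _),
              integral_exp_mul_Iic hd, mul_one]
        _ ≤ _ := le_add_self
    have h5 : volume (T v) ≤ 2 * ENNReal.ofReal η := by
      rw [← hI]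
      refine measure_mono ?_
      simp only [T, if_true]; exact inter_subset_right
    have hv' : v ∈ (Finset.univ : Finset (InfinitePlace K)).erase w₀ := by simp [hv]
    calc _ ≤ (3 ^ m * (2 * ENNReal.ofReal η)) * c₂ := by
          refine mul_le_mul' ?_ h4
          rw [← Finset.prod_erase_mul _ _ hv']
          refine mul_le_mul' ?_ h5
          refine (Finset.prod_le_pow_card _ _ 3 fun w hw ↦
            h3 w (Finset.ne_of_mem_erase (Finset.mem_of_mem_erase hw))).trans
            (pow_le_pow_right' hone ((Finset.card_le_card (Finset.erase_subset _ _)).trans hcard))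
      _ = _ := by ring

open Classical in
lemma normAtPlace_le_norm (w : InfinitePlace K) (x : mixedSpace K) : normAtPlace w x ≤ ‖x‖ := by
  rw [norm_eq_sup'_normAtPlace]
  exact Finset.le_sup' (fun w ↦ normAtPlace w x) (Finset.mem_univ w)

open Classical in
lemma abs_normAtPlace_sub_le (w : InfinitePlace K) (x y : mixedSpace K) :
    |normAtPlace w x - normAtPlace w y| ≤ ‖x - y‖ := by
  have h1 := normAtPlace_add_le w (x - y) y
  have h2 := normAtPlace_add_le w (y - x) x
  have h3 := normAtPlace_le_norm K w (x - y)
  have h4 := normAtPlace_le_norm K w (y - x)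
  rw [sub_add_cancel] at h1 h2
  rw [norm_sub_rev] at h4
  rw [abs_sub_le_iff]
  constructor <;> linarith

lemma mem_normLeOne_iff_mem_paramSet {x : mixedSpace K} {p : realSpace K}
    (h : expMapBasis p = normAtAllPlaces x) : x ∈ normLeOne K ↔ p ∈ paramSet K := by
  rw [normLeOne_eq_preimage, mem_preimage, ← h, (injective_expMapBasis K).mem_set_image]

/-- Follows from `log x ≤ x - 1`. This trade-off between the size of the coordinates and their
displacement is the source of the `√ε` below. -/
lemma abs_log_sub_log_le {u v δ : ℝ} (hδ : 0 < δ) (hu : δ ≤ u) (hv : δ ≤ v)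
    (huv : |u - v| ≤ δ ^ 2) : |Real.log u - Real.log v| ≤ δ := by
  have key : ∀ a b : ℝ, δ ≤ a → δ ≤ b → |a - b| ≤ δ ^ 2 → Real.log a - Real.log b ≤ δ := by
    intro a b ha hb hab
    have ha' : 0 < a := hδ.trans_le ha
    have hb' : 0 < b := hδ.trans_le hb
    rw [← Real.log_div ha'.ne' hb'.ne']
    refine (Real.log_le_sub_one_of_pos (by positivity)).trans ?_
    rw [div_sub_one hb'.ne', div_le_iff₀ hb']
    have := le_abs_self (a - b)
    nlinarith
  rw [abs_sub_le_iff]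
  exact ⟨key u v hu hv huv, key v u hv hu (by rwa [abs_sub_comm])⟩

/-- Two parameters that are close but on different sides of the boundary of `paramSet K`. -/
lemma paramSet_boundary {p p' : realSpace K} {η : ℝ} (hη : η ≤ 1)
    (hpp : ∀ w, |p w - p' w| ≤ η) (h : ¬(p ∈ paramSet K ↔ p' ∈ paramSet K)) :
    p w₀ ≤ 1 ∧ (∀ w, w ≠ w₀ → p w ∈ Icc (-1) 2) ∧
      ∃ v, p v ∈ Icc (0 - η) (0 + η) ∨ p v ∈ Icc (1 - η) (1 + η) := by
  classical
  have hmem : ∀ q : realSpace K, q ∈ paramSet K ↔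
      q w₀ ≤ 0 ∧ ∀ w, w ≠ w₀ → q w ∈ Ico (0 : ℝ) 1 := by
    intro q
    simp only [paramSet, mem_univ_pi]
    constructor
    · intro h
      refine ⟨by simpa using h w₀, fun w hw ↦ by simpa [hw] using h w⟩
    · rintro ⟨h1, h2⟩ w
      by_cases hw : w = w₀
      · subst hw; simpa using h1
      · rw [if_neg hw]; exact h2 w hw
  have hle := fun w ↦ abs_sub_le_iff.1 (hpp w)
  have hor : p ∈ paramSet K ∨ p' ∈ paramSet K := by tauto
  refine ⟨?_, fun w hw ↦ ?_, ?_⟩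
  · rcases hor with h' | h' <;> have h2 := ((hmem _).1 h').1 <;>
      have h3 := hle w₀ <;> linarith
  · rcases hor with h' | h' <;> have h2 := ((hmem _).1 h').2 w hw <;>
      have h3 := hle w <;> constructor <;> linarith [h2.1, h2.2]
  -- If every coordinate of `p` is farther than `η` from both `0` and `1`, a displacement of at most
  -- `η` changes none of the inequalities defining the box.
  · by_contra! hcon
    apply h
    rw [hmem, hmem]
    have h0 : ∀ v, (p v ≤ 0 ↔ p' v ≤ 0) ∧ (0 ≤ p v ↔ 0 ≤ p' v) ∧ (p v < 1 ↔ p' v < 1) := by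
      intro v
      obtain ⟨h1, h2⟩ := hcon v
      have h3 := hle v
      simp only [mem_Icc, not_and, not_le] at h1 h2
      have h4 : p v < 0 - η ∨ 0 + η < p v := by
        by_cases hh : 0 - η ≤ p v
        · exact Or.inr (h1 hh)
        · exact Or.inl (not_le.1 hh)
      have h5 : p v < 1 - η ∨ 1 + η < p v := by
        by_cases hh : 1 - η ≤ p v
        · exact Or.inr (h2 hh)
        · exact Or.inl (not_le.1 hh)
      have hη0 : 0 ≤ η := (abs_nonneg _).trans (hpp v)
      refine ⟨⟨fun _ ↦ ?_, fun _ ↦ ?_⟩, ⟨fun _ ↦ ?_, fun _ ↦ ?_⟩, fun _ ↦ ?_, fun _ ↦ ?_⟩ <;>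
        rcases h4 with h4 | h4 <;> rcases h5 with h5 | h5 <;> linarith
    simp only [mem_Ico, (h0 _).1, (h0 _).2.1, (h0 _).2.2]

-- Take `δ = √ε`. Points with some coordinate at most `2δ` fill volume `O(δ)`. Elsewhere a
-- displacement by `ε = δ²` moves the logarithms, hence the parameters, by `O(δ)`, so crossing the
-- boundary puts the parameter in a slab of width `O(δ)` about a face of the box `paramSet K`.
open Classical in
theorem exists_volume_collar_normLeOne_le :
    ∃ C : ℝ, 0 ≤ C ∧ ∀ ε : ℝ, 0 < ε → ε ≤ 1 →
      volume.real (collar (normLeOne K) ε) ≤ C * √ε := by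
  obtain ⟨R₀, hR₀0, hR₀⟩ := (isBounded_normLeOne K).exists_pos_norm_le
  let R := R₀ + 1
  have hcR : ∀ ε : ℝ, ε ≤ 1 → ∀ x ∈ collar (normLeOne K) ε, ‖x‖ ≤ R := by
    rintro ε hε x ⟨y, hxy, h⟩
    by_cases hx : x ∈ normLeOne K
    · exact (hR₀ x hx).trans (by simp [R])
    · have hy : y ∈ normLeOne K := by tauto
      have h1 := hR₀ y hy
      have h2 := norm_add_le (x - y) y
      rw [sub_add_cancel] at h2
      simp only [R]; linarith
  obtain ⟨c₁, hc₁, h₁⟩ := exists_volume_small_coordinate_le K R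
  obtain ⟨c₂, hc₂, h₂⟩ := exists_volume_slab_le K
  let L : realSpace K →L[ℝ] realSpace K := (completeBasis K).equivFunL
  -- The `2` bounds the multiplicity of a place in `expMap.symm`, and `L` passes from logarithms to
  -- parameters; the `+ 1` keeps `A` positive.
  let A : ℝ := 2 * ‖L‖ + 1
  have hA : 0 < A := by positivity
  let m := Fintype.card (InfinitePlace K)
  let c₀ := volume (Metric.closedBall (0 : mixedSpace K) R)
  have hc₀ : c₀ ≠ ⊤ := (Metric.isBounded_closedBall).measure_lt_top.ne
  let c : ℝ≥0∞ := c₀ * ENNReal.ofReal A +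
    (m * (c₁ * 2) + m * (c₂ * ENNReal.ofReal A + c₂ * ENNReal.ofReal A))
  have hc : c ≠ ⊤ := by
    have h : c₂ * ENNReal.ofReal A ≠ ⊤ := ENNReal.mul_ne_top hc₂ ENNReal.ofReal_ne_top
    exact ENNReal.add_ne_top.2 ⟨ENNReal.mul_ne_top hc₀ ENNReal.ofReal_ne_top,
      ENNReal.add_ne_top.2 ⟨ENNReal.mul_ne_top (ENNReal.natCast_ne_top _)
        (ENNReal.mul_ne_top hc₁ ENNReal.ofNat_ne_top),
        ENNReal.mul_ne_top (ENNReal.natCast_ne_top _) (ENNReal.add_ne_top.2 ⟨h, h⟩)⟩⟩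
  suffices H : ∀ ε : ℝ, 0 < ε → ε ≤ 1 →
      volume (collar (normLeOne K) ε) ≤ c * ENNReal.ofReal √ε by
    refine ⟨c.toReal, ENNReal.toReal_nonneg, fun ε h0 h1 ↦ ?_⟩
    have := ENNReal.toReal_mono (ENNReal.mul_ne_top hc ENNReal.ofReal_ne_top) (H ε h0 h1)
    rwa [ENNReal.toReal_mul, ENNReal.toReal_ofReal (Real.sqrt_nonneg _)] at this
  intro ε hε0 hε1
  set δ := √ε with hδ
  have hδ0 : 0 < δ := Real.sqrt_pos.2 hε0
  have hδ1 : δ ≤ 1 := Real.sqrt_le_one.2 hε1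
  have hδε : δ ^ 2 = ε := Real.sq_sqrt hε0.le
  -- When `A * δ > 1` the slab argument is not available, but then the volume of a ball containing
  -- the collar is already small enough.
  rcases lt_or_ge 1 (A * δ) with hbig | hη
  · calc volume (collar (normLeOne K) ε) ≤ c₀ :=
          measure_mono fun x hx ↦ mem_closedBall_zero_iff.2 (hcR ε hε1 x hx)
      _ = c₀ * ENNReal.ofReal 1 := by simp
      _ ≤ c₀ * ENNReal.ofReal (A * δ) := by gcongr
      _ = c₀ * ENNReal.ofReal A * ENNReal.ofReal δ := by
          rw [ENNReal.ofReal_mul hA.le, mul_assoc]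
      _ ≤ _ := mul_le_mul' le_self_add le_rfl
  have hsub : collar (normLeOne K) ε ⊆
      (⋃ v ∈ (Finset.univ : Finset (InfinitePlace K)),
        {x : mixedSpace K | (∀ w, normAtPlace w x ≤ R) ∧ normAtPlace v x ≤ 2 * δ}) ∪
      ⋃ v ∈ (Finset.univ : Finset (InfinitePlace K)),
        ({x : mixedSpace K | ∃ y : realSpace K, expMapBasis y = normAtAllPlaces x ∧
          y w₀ ≤ 1 ∧ (∀ w, w ≠ w₀ → y w ∈ Icc (-1) 2) ∧ y v ∈ Icc (0 - A * δ) (0 + A * δ)} ∪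
        {x : mixedSpace K | ∃ y : realSpace K, expMapBasis y = normAtAllPlaces x ∧
          y w₀ ≤ 1 ∧ (∀ w, w ≠ w₀ → y w ∈ Icc (-1) 2) ∧ y v ∈ Icc (1 - A * δ) (1 + A * δ)}) := by
    intro x hx
    by_cases hsmall : ∃ v, normAtPlace v x ≤ 2 * δ
    · obtain ⟨v, hv⟩ := hsmall
      exact Or.inl (mem_biUnion (Finset.mem_univ v)
        ⟨fun w ↦ (normAtPlace_le_norm K w x).trans (hcR ε hε1 x hx), hv⟩)
    push Not at hsmall
    right
    obtain ⟨y, hxy, hne⟩ := hx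
    have hd : ∀ w, |normAtPlace w x - normAtPlace w y| ≤ δ ^ 2 := fun w ↦
      (abs_normAtPlace_sub_le K w x y).trans (hxy.trans hδε.ge)
    have hxδ : ∀ w, δ ≤ normAtPlace w x := fun w ↦ by linarith [hsmall w]
    have hyδ : ∀ w, δ ≤ normAtPlace w y := fun w ↦ by
      have := (abs_sub_le_iff.1 (hd w)).1
      nlinarith [hsmall w]
    let par : mixedSpace K → realSpace K := fun z ↦ L (expMap.symm (normAtAllPlaces z))
    have hpar : ∀ z : mixedSpace K, (∀ w, δ ≤ normAtPlace w z) →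
        expMapBasis (par z) = normAtAllPlaces z := by
      intro z hz
      exact expMapBasis.right_inv (mem_univ_pi.2 fun w ↦ hδ0.trans_le (hz w))
    have hdist : ∀ w, |par x w - par y w| ≤ A * δ := by
      intro w
      have e1 : par x - par y =
          L (expMap.symm (normAtAllPlaces x) - expMap.symm (normAtAllPlaces y)) :=
        (map_sub L _ _).symm
      have e2 : ‖expMap.symm (normAtAllPlaces x) - expMap.symm (normAtAllPlaces y)‖ ≤ 2 * δ := by
        rw [pi_norm_le_iff_of_nonneg (by positivity)]
        intro v
        rw [Pi.sub_apply, expMap_symm_apply, expMap_symm_apply, ← mul_sub, norm_mul,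
          Real.norm_eq_abs, Real.norm_eq_abs]
        refine mul_le_mul ?_ (abs_log_sub_log_le hδ0 (hxδ v) (hyδ v) (hd v)) (abs_nonneg _)
          zero_le_two
        rw [Nat.abs_cast]
        exact_mod_cast (show mult v ≤ 2 by unfold mult; split_ifs <;> norm_num)
      calc |par x w - par y w| ≤ ‖par x - par y‖ := norm_le_pi_norm (par x - par y) w
        _ ≤ ‖L‖ * (2 * δ) := by
            rw [e1]; exact (L.le_opNorm _).trans (by gcongr)
        _ ≤ A * δ := by simp only [A]; nlinarith
    rw [mem_normLeOne_iff_mem_paramSet K (hpar x hxδ),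
      mem_normLeOne_iff_mem_paramSet K (hpar y hyδ)] at hne
    obtain ⟨g1, g2, v, hv⟩ := paramSet_boundary K hη hdist hne
    refine mem_biUnion (Finset.mem_univ v) ?_
    rcases hv with hv | hv
    · exact Or.inl ⟨par x, hpar x hxδ, g1, g2, hv⟩
    · exact Or.inr ⟨par x, hpar x hxδ, g1, g2, hv⟩
  refine (measure_mono hsub).trans ((measure_union_le _ _).trans ?_)
  have e1 : volume (⋃ v ∈ (Finset.univ : Finset (InfinitePlace K)),
        {x : mixedSpace K | (∀ w, normAtPlace w x ≤ R) ∧ normAtPlace v x ≤ 2 * δ}) ≤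
      m * (c₁ * 2) * ENNReal.ofReal δ := by
    refine (measure_biUnion_finset_le _ _).trans
      ((Finset.sum_le_card_nsmul _ _ _ fun v _ ↦ h₁ v (2 * δ)).trans (le_of_eq ?_))
    rw [Finset.card_univ, nsmul_eq_mul, ENNReal.ofReal_mul zero_le_two, ENNReal.ofReal_ofNat]
    ring
  have e2 := fun v a ↦ h₂ v a (A * δ)
  simp_rw [ENNReal.ofReal_mul hA.le] at e2
  have e3 := (measure_biUnion_finset_le (μ := volume) (Finset.univ : Finset (InfinitePlace K))
    fun v ↦ ({x : mixedSpace K | ∃ y : realSpace K, expMapBasis y = normAtAllPlaces x ∧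
          y w₀ ≤ 1 ∧ (∀ w, w ≠ w₀ → y w ∈ Icc (-1) 2) ∧ y v ∈ Icc (0 - A * δ) (0 + A * δ)} ∪
        {x : mixedSpace K | ∃ y : realSpace K, expMapBasis y = normAtAllPlaces x ∧
          y w₀ ≤ 1 ∧ (∀ w, w ≠ w₀ → y w ∈ Icc (-1) 2) ∧ y v ∈ Icc (1 - A * δ) (1 + A * δ)})).trans
    (Finset.sum_le_card_nsmul _ _ _ fun v _ ↦ (measure_union_le _ _).trans
      (add_le_add (e2 v 0) (e2 v 1)))
  refine (add_le_add e1 e3).trans ?_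
  rw [Finset.card_univ, nsmul_eq_mul]
  simp only [c, add_mul]
  refine le_trans (le_of_eq ?_) le_add_self
  ring

end CollarVolume

/-! ### Counting ideals by norm with a power-saving error -/

section IdealCounting

open NumberField.mixedEmbedding NumberField.mixedEmbedding.fundamentalCone
  NumberField.InfinitePlace NumberField.Units Ideal Filter Asymptotics
open scoped Pointwise

variable (K : Type*) [Field K] [NumberField K]

-- Multiplication by an ideal `J` of the inverse class makes the ideals of the class principal and
-- divisible by `J`, which is what points of an ideal lattice can count.
variable {K} in
lemma card_mk_eq_card_dvd {C : ClassGroup (𝓞 K)} {J : (Ideal (𝓞 K))⁰} {s : ℝ}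
    (hJ : ClassGroup.mk0 J = C⁻¹) :
    Nat.card {I : (Ideal (𝓞 K))⁰ // absNorm (I : Ideal (𝓞 K)) ≤ s ∧ ClassGroup.mk0 I = C}
      = Nat.card {I : (Ideal (𝓞 K))⁰ // (J : Ideal (𝓞 K)) ∣ I ∧ Submodule.IsPrincipal (I : Ideal (𝓞 K)) ∧
        absNorm (I : Ideal (𝓞 K)) ≤ s * absNorm (J : Ideal (𝓞 K))} := by
  simp_rw [← nonZeroDivisors_dvd_iff_dvd_coe]
  refine Nat.card_congr ?_
  refine ((Equiv.dvd J).subtypeEquiv fun I ↦ ?_).trans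
    (Equiv.subtypeSubtypeEquivSubtypeInter (fun I : (Ideal (𝓞 K))⁰ ↦ J ∣ I) _)
  rw [← ClassGroup.mk0_eq_one_iff (SetLike.coe_mem _)]
  simp_rw [Equiv.dvd_apply, Submonoid.coe_mul, ← Submonoid.mul_def, _root_.map_mul, hJ,
    inv_mul_eq_one, Nat.cast_mul, mul_comm s, eq_comm, and_comm, and_congr_left_iff]
  exact fun _ ↦
    (mul_le_mul_iff_of_pos_left (Nat.cast_pos.mpr (absNorm_pos_of_nonZeroDivisors J))).symm

open Classical in
lemma smul_normLeOne {c : ℝ} (hc : 0 < c) :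
    c • normLeOne K = {x | x ∈ fundamentalCone K ∧
      mixedEmbedding.norm x ≤ c ^ Module.finrank ℚ K} := by
  ext x
  rw [Set.mem_smul_set_iff_inv_smul_mem₀ hc.ne', mem_normLeOne,
    smul_mem_iff_mem (inv_ne_zero hc.ne'), mem_ofPred_eq, mixedEmbedding.norm_smul, abs_inv,
    abs_of_pos hc, inv_pow, inv_mul_le_iff₀ (by positivity), mul_one]

open Classical in
/-- The number of points of norm at most `T` of an ideal lattice in the fundamental cone. -/
lemma card_idealSet_isBigO (J : (Ideal (𝓞 K))⁰) :
    (fun T : ℝ ↦ (Nat.card {a : idealSet K J // mixedEmbedding.norm (a : mixedSpace K) ≤ T} : ℝ) *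
      ZLattice.covolume (mixedEmbedding.idealLattice K (FractionalIdeal.mk0 K J)) -
      T * volume.real (normLeOne K)) =O[atTop]
    fun T : ℝ ↦ T ^ (1 - 1 / (2 * Module.finrank ℚ K : ℝ)) := by
  set d := Module.finrank ℚ K with hd
  have hd0 : 0 < d := Module.finrank_pos
  have hd0' : (0 : ℝ) < d := Nat.cast_pos.2 hd0
  obtain ⟨D, hD0, hD⟩ := exists_card_inter_sub_le
    (mixedEmbedding.idealLattice K (FractionalIdeal.mk0 K J))
    (volume : Measure (mixedSpace K))
  obtain ⟨C, hC0, hC⟩ := exists_volume_collar_normLeOne_le K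
  refine IsBigO.of_bound (C * √D) ?_
  filter_upwards [eventually_ge_atTop (D ^ d), eventually_gt_atTop 0] with T hT hT0
  -- Dilation by `c` multiplies both norm and volume by `c ^ d = T`; the collar error becomes `T √(D
  -- / c)`, of order `T ^ (1 - 1 / (2 d))`.
  set c := T ^ (1 / d : ℝ) with hc
  have hc0 : 0 < c := Real.rpow_pos_of_pos hT0 _
  have hcd : c ^ d = T := by
    rw [hc, ← Real.rpow_natCast, ← Real.rpow_mul hT0.le, one_div_mul_cancel hd0'.ne', Real.rpow_one]
  have hDc : D ≤ c := by
    refine le_of_pow_le_pow_left₀ hd0.ne' hc0.le ?_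
    rwa [hcd]
  have hcard : Nat.card {a : idealSet K J // mixedEmbedding.norm (a : mixedSpace K) ≤ T} =
      Nat.card (c • normLeOne K ∩
        mixedEmbedding.idealLattice K (FractionalIdeal.mk0 K J) : Set (mixedSpace K)) := by
    rw [smul_normLeOne K hc0, ← hd, hcd]
    refine Nat.card_congr ((Equiv.subtypeSubtypeEquivSubtypeInter _
      (mixedEmbedding.norm · ≤ T)).trans (Equiv.subtypeEquivProp ?_))
    ext x
    simp only [idealSet, mem_inter_iff, mem_ofPred_eq]
    tauto
  have hb : Bornology.IsBounded (c • normLeOne K) := (isBounded_normLeOne K).smul₀ c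
  have hvol : ∀ s : Set (mixedSpace K), volume.real (c • s) = T * volume.real s := by
    intro s
    rw [measureReal_def, Measure.addHaar_smul, ENNReal.toReal_mul, mixedEmbedding.finrank, ← hd,
      hcd, abs_of_pos hT0, ENNReal.toReal_ofReal hT0.le, measureReal_def]
  have := hD _ hb
  rw [← hcard, hvol, collar_smul _ _ hc0, hvol] at this
  rw [Real.norm_eq_abs, Real.norm_of_nonneg (Real.rpow_nonneg hT0.le _)]
  refine this.trans ?_
  calc T * volume.real (collar (normLeOne K) (D / c)) ≤ T * (C * √(D / c)) := by
        gcongr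
        exact hC _ (by positivity) ((div_le_one hc0).2 hDc)
    _ = C * √D * T ^ (1 - 1 / (2 * d : ℝ)) := by
        rw [Real.sqrt_div hD0.le, Real.rpow_sub hT0, Real.rpow_one, hc, Real.sqrt_eq_rpow,
          Real.sqrt_eq_rpow (T ^ _), ← Real.rpow_mul hT0.le]
        have : 1 / (d : ℝ) * (1 / 2) = 1 / (2 * d) := by field_simp
        rw [this]
        ring

-- The covolume of the ideal lattice is proportional to `absNorm J`, the factor by which the norm
-- bound was enlarged. Hence all ideal classes have the same main term.
open Classical in
lemma volume_normLeOne_div (J : (Ideal (𝓞 K))⁰) :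
    absNorm (J : Ideal (𝓞 K)) * volume.real (normLeOne K) = rho K * (torsionOrder K *
      ZLattice.covolume (mixedEmbedding.idealLattice K (FractionalIdeal.mk0 K J))) := by
  have h3 : (absNorm J.1 : ℝ) ≠ 0 := Nat.cast_ne_zero.mpr (absNorm_ne_zero_of_nonZeroDivisors J)
  have hw : (torsionOrder K : ℝ) ≠ 0 := Nat.cast_ne_zero.mpr (torsionOrder_ne_zero K)
  have hΔ : √|(discr K : ℝ)| ≠ 0 := by
    rw [Real.sqrt_ne_zero', abs_pos]
    exact_mod_cast discr_ne_zero K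
  rw [measureReal_def, volume_normLeOne, covolume_idealLattice, ENNReal.toReal_mul,
      ENNReal.toReal_mul, ENNReal.toReal_pow, ENNReal.toReal_pow, ENNReal.toReal_ofNat,
      ENNReal.coe_toReal, NNReal.coe_real_pi, ENNReal.toReal_ofReal (regulator_pos K).le,
      FractionalIdeal.coe_mk0, FractionalIdeal.coeIdeal_absNorm, Rat.cast_natCast, rho, mul_pow,
      inv_pow]
  field_simp

lemma card_mk_eq_isBigO (C : ClassGroup (𝓞 K)) :
    (fun s : ℝ ↦ (Nat.card {I : (Ideal (𝓞 K))⁰ //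
        absNorm (I : Ideal (𝓞 K)) ≤ s ∧ ClassGroup.mk0 I = C} : ℝ) - rho K * s) =O[atTop]
    fun s : ℝ ↦ s ^ (1 - 1 / (2 * Module.finrank ℚ K : ℝ)) := by
  classical
  obtain ⟨J, hJ⟩ := ClassGroup.mk0_surjective C⁻¹
  have hJ0 : (0 : ℝ) < absNorm J.1 := Nat.cast_pos.mpr (absNorm_pos_of_nonZeroDivisors J)
  have hw : (torsionOrder K : ℝ) ≠ 0 := Nat.cast_ne_zero.mpr (torsionOrder_ne_zero K)
  set v := ZLattice.covolume (mixedEmbedding.idealLattice K (FractionalIdeal.mk0 K J)) with hv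
  have hv0 : v ≠ 0 := ZLattice.covolume_ne_zero _ _
  have h1 := (card_idealSet_isBigO K J).comp_tendsto (tendsto_id.atTop_mul_const hJ0)
  simp only [← card_isPrincipal_dvd_norm_le, Function.comp_def, id, ← card_mk_eq_card_dvd hJ] at h1
  have h2 := h1.const_mul_left ((torsionOrder K : ℝ) * v)⁻¹
  refine (h2.congr_left fun s ↦ ?_).trans ?_
  · rw [mul_assoc s, volume_normLeOne_div, ← hv, Nat.cast_mul]
    field_simp
  · refine IsBigO.of_bound ((absNorm J.1 : ℝ) ^ (1 - 1 / (2 * Module.finrank ℚ K : ℝ))) ?_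
    filter_upwards [eventually_gt_atTop 0] with s hs
    rw [Real.mul_rpow hs.le hJ0.le, norm_mul, mul_comm,
      Real.norm_of_nonneg (Real.rpow_nonneg hJ0.le _)]

lemma finite_absNorm_le (s : ℝ) :
    Finite {I : (Ideal (𝓞 K))⁰ // (absNorm (I : Ideal (𝓞 K)) : ℝ) ≤ s} := by
  rcases lt_or_ge s 0 with hs | hs
  · have : IsEmpty {I : (Ideal (𝓞 K))⁰ // (absNorm (I : Ideal (𝓞 K)) : ℝ) ≤ s} :=
      ⟨fun I ↦ absurd (I.2.trans_lt hs) (not_lt.2 (Nat.cast_nonneg _))⟩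
    infer_instance
  · simp_rw [← Nat.le_floor_iff hs]
    exact finite_setOfPred_absNorm_le₀ ⌊s⌋₊

lemma card_norm_le_isBigO :
    (fun s : ℝ ↦ (Nat.card {I : (Ideal (𝓞 K))⁰ // absNorm (I : Ideal (𝓞 K)) ≤ s} : ℝ) -
      rho K * classNumber K * s) =O[atTop]
    fun s : ℝ ↦ s ^ (1 - 1 / (2 * Module.finrank ℚ K : ℝ)) := by
  classical
  refine (IsBigO.sum (A := fun (C : ClassGroup (𝓞 K)) (s : ℝ) ↦ _) (s := Finset.univ)
    fun C _ ↦ card_mk_eq_isBigO K C).congr_left fun s ↦ ?_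
  rw [Finset.sum_apply, Finset.sum_sub_distrib, Finset.sum_const, Finset.card_univ, nsmul_eq_mul, classNumber]
  congr 1
  · have := finite_absNorm_le K s
    have : Fintype {I : (Ideal (𝓞 K))⁰ // (absNorm (I : Ideal (𝓞 K)) : ℝ) ≤ s} :=
      Fintype.ofFinite _
    let e := fun C : ClassGroup (𝓞 K) ↦ Equiv.subtypeSubtypeEquivSubtypeInter
      (fun I : (Ideal (𝓞 K))⁰ ↦ (absNorm I.1 : ℝ) ≤ s) (fun I ↦ ClassGroup.mk0 I = C)
    simp_rw [← Nat.card_congr (e _), Nat.card_eq_fintype_card, Fintype.subtype_card]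
    rw [Fintype.card, Finset.card_eq_sum_card_fiberwise (f := fun I ↦ ClassGroup.mk0 I.1)
      (t := Finset.univ) (fun _ _ ↦ Finset.mem_univ _), Nat.cast_sum]
  · ring

/-- The number of nonzero ideals of norm at most `t`, with a power saving error term. -/
theorem exists_card_norm_le_sub_le :
    ∃ σ C : ℝ, 1 / 2 < σ ∧ σ < 1 ∧ 0 ≤ C ∧ ∀ t : ℝ, 0 < t →
      |(Nat.card {I : (Ideal (𝓞 K))⁰ // absNorm (I : Ideal (𝓞 K)) ≤ t} : ℝ) -
        rho K * classNumber K * t| ≤ C * t ^ σ := by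
  have hd0 : (1 : ℝ) ≤ Module.finrank ℚ K := by
    exact_mod_cast (Module.finrank_pos (R := ℚ) (M := K))
  set d : ℝ := ((Module.finrank ℚ K : ℕ) : ℝ) with hd
  set κ := rho K * classNumber K
  have hd4 : 1 / (4 * d) ≤ 1 / 4 := by
    apply one_div_le_one_div_of_le <;> linarith
  have hd4' : 0 < 1 / (4 * d) := by positivity
  have hd2 : 1 / (4 * d) ≤ 1 / (2 * d) := by
    apply one_div_le_one_div_of_le <;> linarith
  obtain ⟨c, hc0, hc⟩ := (card_norm_le_isBigO K).exists_pos
  obtain ⟨s₀, hs₀⟩ := eventually_atTop.1 hc.bound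
  let s₁ := max s₀ 1
  -- The exponent `1 - 1 / (2 d)` equals `1 / 2` for `d = 1`, whereas convergence of `∑ N𝔭 ^ (-2σ)`
  -- will need `σ > 1 / 2`; half of the saving is given up.
  let σ := 1 - 1 / (4 * d)
  let N : ℝ → ℕ := fun t ↦ Nat.card {I : (Ideal (𝓞 K))⁰ // absNorm (I : Ideal (𝓞 K)) ≤ t}
  have hNmono : ∀ t, t ≤ s₁ → N t ≤ N s₁ := by
    intro t ht
    have := finite_absNorm_le K s₁
    exact Nat.card_le_card_of_injective
      (fun I ↦ (⟨I.1, I.2.trans ht⟩ : {I : (Ideal (𝓞 K))⁰ // (absNorm I.1 : ℝ) ≤ s₁}))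
      fun I J h ↦ Subtype.ext (Subtype.mk.inj h)
  refine ⟨σ, c + (N s₁ + |κ| * s₁) + |κ|, by simp only [σ]; linarith, by simp only [σ]; linarith,
    by positivity, fun t ht ↦ ?_⟩
  have htσ : 0 < t ^ σ := Real.rpow_pos_of_pos ht _
  have hNs : (0 : ℝ) ≤ N s₁ + |κ| * s₁ := by positivity
  -- The bound must hold for all `t > 0`. Below `1` there are no ideals and `t ≤ t ^ σ` absorbs the
  -- main term; up to `s₁` constants suffice.
  rcases lt_or_ge t 1 with h1 | h1
  · have : IsEmpty {I : (Ideal (𝓞 K))⁰ // (absNorm (I : Ideal (𝓞 K)) : ℝ) ≤ t} := by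
      refine ⟨fun I ↦ ?_⟩
      have h2 : (1 : ℝ) ≤ absNorm (I.1 : Ideal (𝓞 K)) := by
        exact_mod_cast absNorm_pos_of_nonZeroDivisors I.1
      exact absurd (h2.trans I.2) (not_le.2 h1)
    rw [Nat.card_of_isEmpty, Nat.cast_zero, zero_sub, abs_neg, abs_mul, abs_of_pos ht]
    have h3 : t ≤ t ^ σ := by
      conv_lhs => rw [← Real.rpow_one t]
      exact Real.rpow_le_rpow_of_exponent_ge ht h1.le (by simp only [σ]; linarith)
    have : |κ| * t ≤ |κ| * t ^ σ := by gcongr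
    nlinarith
  · have h4 : 1 ≤ t ^ σ := Real.one_le_rpow h1 (by simp only [σ]; linarith)
    rcases le_or_gt t s₁ with h2 | h2
    · have e1 : (N t : ℝ) ≤ N s₁ := by exact_mod_cast hNmono t h2
      have e2 : |(N t : ℝ) - κ * t| ≤ N s₁ + |κ| * s₁ := by
        refine (abs_sub _ _).trans (add_le_add ?_ ?_)
        · rwa [Nat.abs_cast]
        · rw [abs_mul, abs_of_pos ht]; gcongr
      refine e2.trans ?_
      have : 0 ≤ |κ| := abs_nonneg _
      nlinarith
    · have := hs₀ t ((le_max_left _ _).trans h2.le)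
      rw [Real.norm_eq_abs, Real.norm_of_nonneg (Real.rpow_nonneg ht.le _)] at this
      refine this.trans ?_
      have h5 : t ^ (1 - 1 / (2 * d)) ≤ t ^ σ :=
        Real.rpow_le_rpow_of_exponent_le h1 (by simp only [σ]; linarith)
      have : 0 ≤ |κ| := abs_nonneg _
      nlinarith

end IdealCounting

/-! ### Sums over ideals of a piecewise monotone function of the norm -/

section OneVariable

variable (K : Type*) [Field K] [NumberField K]

lemma finite_idealNorm_le (B : ℝ) : {a : NzIdeal K | idealNorm a ≤ B}.Finite :=
  Set.finite_coe_iff.1 (finite_absNorm_le K B)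

/-- The nonzero ideals of norm at most `B`. -/
def idealsLE (B : ℝ) : Finset (NzIdeal K) := (finite_idealNorm_le K B).toFinset

variable {K}

@[simp] lemma mem_idealsLE {B : ℝ} {a : NzIdeal K} : a ∈ idealsLE K B ↔ idealNorm a ≤ B := by
  simp [idealsLE]

lemma one_le_idealNorm (a : NzIdeal K) : 1 ≤ idealNorm a := by
  unfold idealNorm
  exact_mod_cast Ideal.absNorm_pos_of_nonZeroDivisors a

lemma idealNorm_pos (a : NzIdeal K) : 0 < idealNorm a := one_pos.trans_le (one_le_idealNorm a)

variable (K) in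
/-- The ideals of `K` are counted by norm with main term `κ t` and error term `C t ^ σ`. -/
def CountingBound (κ C σ : ℝ) : Prop :=
  ∀ t : ℝ, 0 < t → |((idealsLE K t).card : ℝ) - κ * t| ≤ C * t ^ σ

variable (K) in
theorem exists_countingBound :
    ∃ σ C : ℝ, 1 / 2 < σ ∧ σ < 1 ∧ 0 ≤ C ∧ CountingBound K (rho K * classNumber K) C σ := by
  obtain ⟨σ, C, h1, h2, h3, h⟩ := exists_card_norm_le_sub_le K
  refine ⟨σ, C, h1, h2, h3, fun t ht ↦ ?_⟩
  convert h t ht using 4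
  rw [idealsLE, ← Set.ncard_eq_toFinset_card _ (finite_idealNorm_le K t)]
  rfl

variable {κ C σ : ℝ}

/-- Let the bound approach `t` from the left: just below `t` the set of counted ideals no longer
changes. Superlevel sets may be open at their right end, so both counts are needed. -/
lemma CountingBound.card_lt (h : CountingBound K κ C σ) {t : ℝ} (ht : 0 < t) :
    |({a : NzIdeal K | idealNorm a < t}.ncard : ℝ) - κ * t| ≤ C * t ^ σ := by
  have hfin : {a : NzIdeal K | idealNorm a < t}.Finite :=
    (finite_idealNorm_le K t).subset fun a (ha : idealNorm a < t) ↦ ha.le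
  have h1 : ∀ᶠ s in nhdsWithin t (Iio t), idealsLE K s = hfin.toFinset := by
    have h2 : ∀ᶠ s in nhdsWithin t (Iio t), ∀ a ∈ hfin.toFinset, idealNorm a ≤ s := by
      rw [Finset.eventually_all]
      intro a ha
      have ha' : idealNorm a < t := by simpa using ha
      filter_upwards [Ioo_mem_nhdsLT ha'] with s hs using hs.1.le
    filter_upwards [h2, self_mem_nhdsWithin] with s hs hst
    ext a
    rw [mem_idealsLE]
    exact ⟨fun h ↦ hfin.mem_toFinset.2 (h.trans_lt hst), hs a⟩
  have h3 : ∀ᶠ s in nhdsWithin t (Iio t),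
      |(hfin.toFinset.card : ℝ) - κ * s| ≤ C * s ^ σ := by
    filter_upwards [h1, Ioo_mem_nhdsLT ht] with s hs hs0
    rw [← hs]
    exact h s hs0.1
  rw [Set.ncard_eq_toFinset_card _ hfin]
  refine le_of_tendsto_of_tendsto ?_ ?_ h3
  · exact ((continuous_const.sub (continuous_const.mul continuous_id)).abs.tendsto t).mono_left
      nhdsWithin_le_nhds
  · exact ((Real.continuousAt_rpow_const t σ (Or.inl ht.ne')).tendsto.const_mul C).mono_left
      nhdsWithin_le_nhds

/-- A set of positive numbers containing with each element all smaller positive numbers. -/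
lemma eq_Ioo_or_Ioc_of_lower {D : Set ℝ} {β : ℝ} (hD : ∀ x ∈ D, 0 < x ∧ x ≤ β)
    (hlow : ∀ x ∈ D, ∀ y, 0 < y → y ≤ x → y ∈ D) (hne : D.Nonempty) :
    ∃ s, 0 < s ∧ s ≤ β ∧ (D = Ioo 0 s ∨ D = Ioc 0 s) := by
  have hb : BddAbove D := ⟨β, fun x hx ↦ (hD x hx).2⟩
  obtain ⟨x₀, hx₀⟩ := hne
  refine ⟨sSup D, (hD x₀ hx₀).1.trans_le (le_csSup hb hx₀),
    csSup_le ⟨x₀, hx₀⟩ fun x hx ↦ (hD x hx).2, ?_⟩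
  have hlt : ∀ y, 0 < y → y < sSup D → y ∈ D := by
    intro y hy hys
    obtain ⟨x, hx, hyx⟩ := exists_lt_of_lt_csSup ⟨x₀, hx₀⟩ hys
    exact hlow x hx y hy hyx.le
  by_cases hs : sSup D ∈ D
  · right
    ext y
    refine ⟨fun hy ↦ ⟨(hD y hy).1, le_csSup hb hy⟩, fun hy ↦ ?_⟩
    rcases hy.2.lt_or_eq with h | h
    · exact hlt y hy.1 h
    · rwa [h]
  · left
    ext y
    refine ⟨fun hy ↦ ⟨(hD y hy).1, lt_of_le_of_ne (le_csSup hb hy) fun h ↦ hs (h ▸ hy)⟩,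
      fun hy ↦ hlt y hy.1 hy.2⟩

lemma CountingBound.lower (h : CountingBound K κ C σ) (hC : 0 ≤ C) (hσ : 0 ≤ σ) {D : Set ℝ}
    {β q : ℝ} (hq : 0 < q) (hβ : 0 ≤ β) (hD : ∀ x ∈ D, 0 < x ∧ x ≤ β)
    (hlow : ∀ x ∈ D, ∀ y, 0 < y → y ≤ x → y ∈ D) :
    |({b : NzIdeal K | q * idealNorm b ∈ D}.ncard : ℝ) - κ / q * volume.real D| ≤
      C * (β / q) ^ σ ∧ MeasurableSet D := by
  rcases D.eq_empty_or_nonempty with rfl | hne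
  · simp only [mem_empty_iff_false, ofPred_false, ncard_empty, Nat.cast_zero, measureReal_empty,
      mul_zero, sub_zero, abs_zero, MeasurableSet.empty, and_true]
    positivity
  obtain ⟨s, hs0, hsβ, hs⟩ := eq_Ioo_or_Ioc_of_lower hD hlow hne
  have hsq : 0 < s / q := by positivity
  have hmono : C * (s / q) ^ σ ≤ C * (β / q) ^ σ := by gcongr
  rcases hs with rfl | rfl
  · refine ⟨?_, measurableSet_Ioo⟩
    refine le_trans (le_of_eq ?_) ((h.card_lt hsq).trans hmono)
    have e : {b : NzIdeal K | q * idealNorm b ∈ Ioo 0 s} = {b | idealNorm b < s / q} := by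
      ext b
      have := idealNorm_pos b
      simp only [mem_Ioo, mem_ofPred_eq, lt_div_iff₀' hq, and_iff_right_iff_imp]
      intro; positivity
    rw [e, Real.volume_real_Ioo_of_le hs0.le, sub_zero]
    congr 2; ring
  · refine ⟨?_, measurableSet_Ioc⟩
    refine le_trans (le_of_eq ?_) ((h _ hsq).trans hmono)
    have e : {b : NzIdeal K | q * idealNorm b ∈ Ioc 0 s} = idealsLE K (s / q) := by
      ext b
      have := idealNorm_pos b
      simp only [mem_Ioc, mem_ofPred_eq, Finset.mem_coe, mem_idealsLE, le_div_iff₀' hq,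
        and_iff_right_iff_imp]
      intro; positivity
    rw [e, Set.ncard_coe_finset, Real.volume_real_Ioc_of_le hs0.le, sub_zero]
    congr 2; ring

/-- An interval of positive reals is the difference of two sets closed downwards among the positive
reals; this doubles the error. -/
lemma CountingBound.ordConnected (h : CountingBound K κ C σ) (hC : 0 ≤ C) (hσ : 0 ≤ σ)
    {J : Set ℝ} {β q : ℝ} (hq : 0 < q) (hJ : ∀ x ∈ J, 0 < x ∧ x ≤ β) (hβ : 0 ≤ β)
    (hoc : J.OrdConnected) :
    |({b : NzIdeal K | q * idealNorm b ∈ J}.ncard : ℝ) - κ / q * volume.real J| ≤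
      2 * C * (β / q) ^ σ := by
  rcases J.eq_empty_or_nonempty with rfl | ⟨x₀, hx₀⟩
  · simp only [mem_empty_iff_false, ofPred_false, ncard_empty, Nat.cast_zero, measureReal_empty,
      mul_zero, sub_zero, abs_zero]
    positivity
  let D₁ : Set ℝ := {x | 0 < x ∧ ∃ y ∈ J, x ≤ y}
  let D₂ : Set ℝ := {x | 0 < x ∧ ∀ y ∈ J, x < y}
  have hJD : J = D₁ \ D₂ := by
    ext x
    constructor
    · exact fun hx ↦ ⟨⟨(hJ x hx).1, x, hx, le_rfl⟩, fun h ↦ lt_irrefl _ (h.2 x hx)⟩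
    · rintro ⟨⟨hx0, y, hy, hxy⟩, h2⟩
      simp only [D₂, mem_ofPred_eq, not_and, not_forall, not_lt] at h2
      obtain ⟨z, hz, hzx⟩ := h2 hx0
      exact hoc.out hz hy ⟨hzx, hxy⟩
  have hsub : D₂ ⊆ D₁ := fun x hx ↦ ⟨hx.1, x₀, hx₀, (hx.2 x₀ hx₀).le⟩
  have hβ₁ : ∀ x ∈ D₁, 0 < x ∧ x ≤ β := fun x ⟨h0, y, hy, hxy⟩ ↦ ⟨h0, hxy.trans (hJ y hy).2⟩
  obtain ⟨h1, m1⟩ := h.lower hC hσ (D := D₁) hq hβ hβ₁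
    fun x ⟨_, z, hz, hxz⟩ y hy hyx ↦ ⟨hy, z, hz, hyx.trans hxz⟩
  obtain ⟨h2, m2⟩ := h.lower hC hσ (D := D₂) hq hβ (fun x hx ↦ hβ₁ x (hsub hx))
    fun x ⟨_, hx⟩ y hy hyx ↦ ⟨hy, fun z hz ↦ hyx.trans_lt (hx z hz)⟩
  have hfin : ∀ D : Set ℝ, (∀ x ∈ D, 0 < x ∧ x ≤ β) → {b : NzIdeal K | q * idealNorm b ∈ D}.Finite := by
    intro D hD
    refine (finite_idealNorm_le K (β / q)).subset fun b hb ↦ ?_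
    rw [mem_ofPred_eq, le_div_iff₀' hq]
    exact (hD _ hb).2
  have e1 : volume.real J = volume.real D₁ - volume.real D₂ := by
    rw [hJD, measureReal_sdiff hsub m2 ?_]
    refine ((measure_mono (t := Icc 0 β) fun x hx ↦ ?_).trans_lt measure_Icc_lt_top).ne
    exact ⟨(hβ₁ x hx).1.le, (hβ₁ x hx).2⟩
  have e2 : ({b : NzIdeal K | q * idealNorm b ∈ J}.ncard : ℝ) =
      {b : NzIdeal K | q * idealNorm b ∈ D₁}.ncard -
        {b : NzIdeal K | q * idealNorm b ∈ D₂}.ncard := by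
    have : {b : NzIdeal K | q * idealNorm b ∈ J} =
        {b : NzIdeal K | q * idealNorm b ∈ D₁} \ {b : NzIdeal K | q * idealNorm b ∈ D₂} := by
      rw [hJD]; rfl
    rw [eq_sub_iff_add_eq, this]
    exact_mod_cast Set.ncard_sdiff_add_ncard_of_subset
      (s := {b : NzIdeal K | q * idealNorm b ∈ D₂}) (t := {b : NzIdeal K | q * idealNorm b ∈ D₁})
      (fun b hb ↦ hsub hb) (hfin _ hβ₁)
  rw [e1, e2]
  calc _ = |(({b : NzIdeal K | q * idealNorm b ∈ D₁}.ncard : ℝ) - κ / q * volume.real D₁) -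
        ({b : NzIdeal K | q * idealNorm b ∈ D₂}.ncard - κ / q * volume.real D₂)| := by
        congr 1; ring
    _ ≤ _ := (abs_sub _ _).trans (add_le_add h1 h2)
    _ = _ := by ring

lemma integral_Ioc_indicator_le {M y : ℝ} (hy : 0 ≤ y) (hyM : y ≤ M) :
    ∫ s in Ioc 0 M, (Iic y).indicator (fun _ ↦ (1 : ℝ)) s = y := by
  rw [setIntegral_indicator measurableSet_Iic, setIntegral_const, Ioc_inter_Iic,
    min_eq_right hyM, Real.volume_real_Ioc_of_le hy]
  simp

/-- Comparison of a sum over ideals with an integral, for a function that is monotone on an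
interval and vanishes outside of it. -/
lemma CountingBound.monotone_piece (h : CountingBound K κ C σ) (hC : 0 ≤ C) (hσ : 0 ≤ σ)
    {I : Set ℝ} {B q M α : ℝ} (hq : 0 < q) (hI : I ⊆ Icc 1 B) (hoc : I.OrdConnected)
    {f : ℝ → ℝ} (hf : MonotoneOn f I ∨ AntitoneOn f I) (hσα : σ < α)
    (hf0 : ∀ x ∈ I, 0 ≤ f x) (hfM : ∀ x ∈ I, f x ≤ M * x ^ (-α)) (hM : 0 ≤ M)
    (S : Finset (NzIdeal K)) (hS : ∀ b, q * idealNorm b ≤ B → b ∈ S) :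
    IntegrableOn f I ∧
    |∑ b ∈ S, I.indicator f (q * idealNorm b) - κ / q * ∫ x in I, f x| ≤
      2 * C / (1 - σ / α) * M * q ^ (-σ) := by
  have hα : 0 < α := hσ.trans_lt hσα
  have hIm : MeasurableSet I := hoc.measurableSet
  have hIfin : volume I < ⊤ := (measure_mono hI).trans_lt measure_Icc_lt_top
  have hfM' : ∀ x ∈ I, f x ≤ M := fun x hx ↦ (hfM x hx).trans <| by
    have := Real.rpow_le_one_of_one_le_of_nonpos (hI hx).1 (neg_nonpos.2 hα.le)
    nlinarith
  have haem : AEMeasurable f (volume.restrict I) := by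
    rcases hf with hf | hf
    · exact aemeasurable_restrict_of_monotoneOn hIm hf
    · exact aemeasurable_restrict_of_antitoneOn hIm hf
  have hint : IntegrableOn f I := by
    refine ⟨haem.aestronglyMeasurable, ?_⟩
    refine HasFiniteIntegral.restrict_of_bounded (C := M) hIfin ?_
    refine (ae_restrict_iff' hIm).2 (Filter.Eventually.of_forall fun x hx ↦ ?_)
    rw [Real.norm_of_nonneg (hf0 x hx)]
    exact hfM' x hx
  refine ⟨hint, ?_⟩
  set H : ℝ → ℝ := I.indicator f with hH
  have hHint : Integrable H := (integrable_indicator_iff hIm).2 hint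
  have hH0 : ∀ x, 0 ≤ H x := fun x ↦ indicator_nonneg hf0 x
  have hHM : ∀ x, H x ≤ M := fun x ↦ indicator_le' (fun x hx ↦ hfM' x hx) (fun _ _ ↦ hM) x
  -- Layer cake: both the sum and the integral of `H` are integrals over the level `s` of the size
  -- of `A s`. Monotonicity makes `A s` an interval, so ideals in it can be counted.
  let A : ℝ → Set ℝ := fun s ↦ {x | s ≤ H x}
  have hAI : ∀ s, 0 < s → ∀ x ∈ A s, x ∈ I ∧ s ≤ f x := by
    intro s hs x hx
    have hxI : x ∈ I := by
      by_contra hxI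
      have : s ≤ 0 := by simpa [A, hH, hxI] using hx
      linarith
    exact ⟨hxI, by simpa [A, hH, hxI] using hx⟩
  have hAoc : ∀ s, 0 < s → (A s).OrdConnected := by
    intro s hs
    refine ⟨fun x hx y hy z hz ↦ ?_⟩
    obtain ⟨hx1, hx2⟩ := hAI s hs x hx
    obtain ⟨hy1, hy2⟩ := hAI s hs y hy
    have hzI := hoc.out hx1 hy1 hz
    simp only [A, mem_ofPred_eq, hH, indicator_of_mem hzI]
    rcases hf with hf | hf
    · exact hx2.trans (hf hx1 hzI hz.1)
    · exact hy2.trans (hf hzI hy1 hz.2)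
  -- The decay `M x ^ (-α)` bounds the right end of the level set, and with it the counting error at
  -- level `s`.
  have hAβ : ∀ s, 0 < s → ∀ x ∈ A s, 0 < x ∧ x ≤ (M / s) ^ (1 / α) := by
    intro s hs x hx
    obtain ⟨hx1, hx2⟩ := hAI s hs x hx
    have hx0 : 0 < x := one_pos.trans_le (hI hx1).1
    refine ⟨hx0, ?_⟩
    have h1 := hx2.trans (hfM x hx1)
    rw [Real.rpow_neg hx0.le, ← div_eq_mul_inv, le_div_iff₀ (by positivity)] at h1
    have h2 : x ^ α ≤ M / s := by rwa [le_div_iff₀' hs]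
    calc x = (x ^ α) ^ (1 / α) := by
          rw [← Real.rpow_mul hx0.le, mul_one_div_cancel hα.ne', Real.rpow_one]
      _ ≤ _ := by gcongr
  have hcount : ∀ s, 0 < s →
      ∑ b ∈ S, (Iic (H (q * idealNorm b))).indicator (fun _ ↦ (1 : ℝ)) s =
        ({b : NzIdeal K | q * idealNorm b ∈ A s}.ncard : ℝ) := by
    classical
    intro s hs
    have : {b : NzIdeal K | q * idealNorm b ∈ A s} =
        ((S.filter fun b ↦ s ≤ H (q * idealNorm b) : Finset _) : Set (NzIdeal K)) := by
      ext b
      simp only [A, mem_ofPred_eq, Finset.coe_filter, iff_and_self]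
      intro hb
      exact hS b (hI (hAI s hs _ hb).1).2
    rw [this, Set.ncard_coe_finset, Finset.card_filter, Nat.cast_sum]
    refine Finset.sum_congr rfl fun b _ ↦ ?_
    simp [indicator_apply]
  have hsum : ∑ b ∈ S, H (q * idealNorm b) = ∫ s in Ioc 0 M,
      ∑ b ∈ S, (Iic (H (q * idealNorm b))).indicator (fun _ ↦ (1 : ℝ)) s := by
    rw [integral_finsetSum]
    · exact Finset.sum_congr rfl fun b _ ↦ (integral_Ioc_indicator_le (hH0 _) (hHM _)).symm
    · intro b _
      exact (integrable_const _).indicator measurableSet_Iic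
  have hvol : ∫ x in I, f x = ∫ s in Ioc 0 M, volume.real (A s) := by
    rw [← integral_indicator hIm]
    exact hHint.integral_eq_integral_Ioc_meas_le (Filter.Eventually.of_forall hH0)
      (Filter.Eventually.of_forall hHM)
  have hAint : IntegrableOn (fun s ↦ volume.real (A s)) (Ioc 0 M) := by
    have hfin : ∀ s, 0 < s → volume (A s) < ⊤ := fun s hs ↦
      (measure_mono fun x hx ↦ (hAI s hs x hx).1).trans_lt hIfin
    have hanti : AntitoneOn (fun s ↦ volume.real (A s)) (Ioc 0 M) := by
      intro s hs t ht hst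
      exact measureReal_mono (fun x hx ↦ hst.trans hx) (hfin s hs.1).ne
    refine ⟨(aemeasurable_restrict_of_antitoneOn measurableSet_Ioc hanti).aestronglyMeasurable, ?_⟩
    refine HasFiniteIntegral.restrict_of_bounded (C := volume.real I) measure_Ioc_lt_top ?_
    refine (ae_restrict_iff' measurableSet_Ioc).2 (Filter.Eventually.of_forall fun s hs ↦ ?_)
    rw [Real.norm_of_nonneg measureReal_nonneg]
    exact measureReal_mono (fun x hx ↦ (hAI s hs.1 x hx).1) hIfin.ne
  -- The counting error grows like `s ^ (-(σ / α))` as `s → 0`. It is integrable exactly because `σ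
  -- < α`, with the factor `1 / (1 - σ / α)`.
  have hσα' : -1 < -(σ / α) := by
    rw [neg_lt_neg_iff, div_lt_one hα]; exact hσα
  have hbound : ∀ s ∈ Ioc 0 M,
      ‖(∑ b ∈ S, (Iic (H (q * idealNorm b))).indicator (fun _ ↦ (1 : ℝ)) s) -
        κ / q * volume.real (A s)‖ ≤ 2 * C * M ^ (σ / α) * q ^ (-σ) * s ^ (-(σ / α)) := by
    intro s hs
    have hMs : 0 ≤ M / s := div_nonneg hM hs.1.le
    rw [hcount s hs.1, Real.norm_eq_abs]
    refine (h.ordConnected hC hσ hq (hAβ s hs.1) (by positivity) (hAoc s hs.1)).trans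
      (le_of_eq ?_)
    rw [Real.div_rpow (by positivity) hq.le, ← Real.rpow_mul hMs, Real.div_rpow hM hs.1.le,
      Real.rpow_neg hq.le, Real.rpow_neg hs.1.le, one_div_mul_eq_div]
    ring
  have hbint : IntegrableOn (fun s ↦ 2 * C * M ^ (σ / α) * q ^ (-σ) * s ^ (-(σ / α))) (Ioc 0 M) :=
    ((intervalIntegrable_iff_integrableOn_Ioc_of_le hM).1
      (intervalIntegral.intervalIntegrable_rpow' hσα')).const_mul _
  have hSint : IntegrableOn (fun s ↦
      ∑ b ∈ S, (Iic (H (q * idealNorm b))).indicator (fun _ ↦ (1 : ℝ)) s) (Ioc 0 M) :=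
    integrable_finsetSum _ fun b _ ↦ (integrable_const _).indicator measurableSet_Iic
  rw [hsum, hvol, ← integral_const_mul, ← integral_sub hSint (hAint.const_mul _)]
  refine (norm_integral_le_of_norm_le hbint
    ((ae_restrict_iff' measurableSet_Ioc).2 (Filter.Eventually.of_forall hbound))).trans
    (le_of_eq ?_)
  rw [integral_const_mul, ← intervalIntegral.integral_of_le hM, integral_rpow (Or.inl hσα'),
    Real.zero_rpow (by linarith), sub_zero]
  have h1 : M ^ (σ / α) * M ^ (-(σ / α) + 1) = M := by
    rw [← Real.rpow_add' hM (by norm_num)]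
    simp
  have h2 : -(σ / α) + 1 = 1 - σ / α := by ring
  calc _ = 2 * C / (-(σ / α) + 1) * (M ^ (σ / α) * M ^ (-(σ / α) + 1)) * q ^ (-σ) := by ring
    _ = _ := by rw [h1, h2]

/-- Comparison of a sum over ideals with an integral, for a piecewise monotone function. -/
theorem CountingBound.piecewise_monotone (h : CountingBound K κ C σ) (hC : 0 ≤ C) (hσ : 0 ≤ σ)
    {B q M α : ℝ} (hq : 0 < q) {f : ℝ → ℝ} {R : ℕ} (hf : PiecewiseMonotoneC1 f B R)
    (hσα : σ < α) (hf0 : ∀ x ∈ Icc 1 B, 0 ≤ f x) (hfM : ∀ x ∈ Icc 1 B, f x ≤ M * x ^ (-α))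
    (hM : 0 ≤ M) (S : Finset (NzIdeal K)) (hS : ∀ b, q * idealNorm b ≤ B → b ∈ S) :
    IntegrableOn f (Icc 1 B) ∧
    |∑ b ∈ S, (Icc 1 B).indicator f (q * idealNorm b) - κ / q * ∫ x in Icc 1 B, f x| ≤
      (2 * R + 1) * (2 * C / (1 - σ / α) * M * q ^ (-σ)) := by
  obtain ⟨m, hmR, x, hx, hx0, hxm, hpiece⟩ := hf
  set E := 2 * C / (1 - σ / α) * M * q ^ (-σ) with hE
  let P : Set ℝ → ℝ → Prop := fun I c ↦ IntegrableOn f I ∧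
    |∑ b ∈ S, I.indicator f (q * idealNorm b) - κ / q * ∫ x in I, f x| ≤ c
  have hα : 0 < α := hσ.trans_lt hσα
  have hE0 : 0 ≤ E := by
    have : 0 < 1 - σ / α := by rw [sub_pos, div_lt_one hα]; exact hσα
    positivity
  have piece : ∀ I : Set ℝ, I ⊆ Icc 1 B → I.OrdConnected → (MonotoneOn f I ∨ AntitoneOn f I) →
      P I E := fun I hI hoc hm ↦ h.monotone_piece hC hσ hq hI hoc hm hσα
        (fun x hx ↦ hf0 x (hI hx)) (fun x hx ↦ hfM x (hI hx)) hM S hS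
  have union : ∀ I J : Set ℝ, ∀ c d, MeasurableSet J → Disjoint I J → P I c → P J d →
      P (I ∪ J) (c + d) := by
    rintro I J c d hJ hd ⟨h1, h2⟩ ⟨h3, h4⟩
    refine ⟨h1.union h3, ?_⟩
    rw [setIntegral_union hd hJ h1 h3]
    simp_rw [indicator_union_of_disjoint hd, Finset.sum_add_distrib]
    calc _ = |(∑ b ∈ S, I.indicator f (q * idealNorm b) - κ / q * ∫ x in I, f x) +
          (∑ b ∈ S, J.indicator f (q * idealNorm b) - κ / q * ∫ x in J, f x)| := by
          congr 1; ring
      _ ≤ _ := (abs_add_le _ _).trans (add_le_add h2 h4)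
  have single : ∀ a ∈ Icc 1 B, P {a} E := fun a ha ↦
    piece _ (singleton_subset_iff.2 ha) ordConnected_singleton
      (Or.inl (subsingleton_singleton.monotoneOn f))
  have hxI : ∀ i, x i ∈ Icc 1 B := fun i ↦ ⟨hx0 ▸ hx (Fin.zero_le i), hxm ▸ hx (Fin.le_last i)⟩
  -- The hypothesis concerns open intervals only, so left endpoints are pieces of their own: two
  -- errors per interval. The last point `B` adds the `+ 1` in `2 * R + 1`.
  have key : ∀ j : Fin (m + 1), P (Ico 1 (x j)) (2 * (j : ℕ) * E) := by
    intro j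
    induction j using Fin.induction with
    | zero =>
      rw [hx0, Ico_self]
      simp [P]
    | succ i ih =>
      have hle : x i.castSucc ≤ x i.succ := hx (Fin.castSucc_lt_succ).le
      have hP : P (Ico (x i.castSucc) (x i.succ)) (E + E) := by
        rcases hle.lt_or_eq with hlt | heq
        · rw [← Ioo_union_left hlt, union_comm]
          refine union _ _ _ _ measurableSet_Ioo ?_ (single _ (hxI _)) (piece _ ?_ ordConnected_Ioo
            (hpiece i).2)
          · simp
          · exact fun y hy ↦ ⟨(hxI _).1.trans hy.1.le, hy.2.le.trans (hxI _).2⟩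
        · rw [heq, Ico_self]
          simp only [P, integrableOn_empty, indicator_empty, Finset.sum_const_zero,
            setIntegral_empty, mul_zero, sub_zero, abs_zero, true_and]
          positivity
      have := union _ _ _ _ measurableSet_Ico ?_ ih hP
      · rw [Ico_union_Ico_eq_Ico (hxI _).1 hle] at this
        convert this using 1
        rw [Fin.val_castSucc, Fin.val_succ]
        push_cast
        ring
      · exact Ico_disjoint_Ico_same
  have h1B : 1 ≤ B := (hxI 0).1.trans (hxI 0).2
  have hfinal := union _ _ _ _ (measurableSet_singleton B) (by simp [hxm]) (key (Fin.last m))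
    (single B ⟨h1B, le_rfl⟩)
  rw [hxm, Ico_union_right h1B, Fin.val_last] at hfinal
  refine ⟨hfinal.1, hfinal.2.trans ?_⟩
  have : (m : ℝ) ≤ R := by exact_mod_cast hmR
  nlinarith

end OneVariable

/-! ### Upper bounds for sums over ideals -/

section SumBounds

lemma integrable_exp_neg_mul_abs {γ : ℝ} (hγ : 0 < γ) :
    Integrable fun u : ℝ ↦ Real.exp (-γ * |u|) := by
  rw [← integrableOn_univ, ← Iic_union_Ioi (a := (0 : ℝ)), integrableOn_union]
  constructor
  · refine (integrableOn_exp_mul_Iic hγ 0).congr_fun (fun u hu ↦ ?_) measurableSet_Iic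
    rw [abs_of_nonpos hu]
    simp
  · refine (integrableOn_exp_mul_Ioi (neg_lt_zero.2 hγ) 0).congr_fun (fun u hu ↦ ?_)
      measurableSet_Ioi
    rw [abs_of_pos hu]

lemma continuousOn_exp_log_div (γ y k : ℝ) {T : ℝ} :
    ContinuousOn (fun t ↦ Real.exp (-γ * |y - k * Real.log t|) / t) (Icc 1 T) := by
  have h : ∀ t ∈ Icc 1 T, t ≠ 0 := fun t ht ↦ (one_pos.trans_le ht.1).ne'
  have : ContinuousOn Real.log (Icc 1 T) := Real.continuousOn_log.mono fun t ht ↦ h t ht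
  exact ContinuousOn.div (by fun_prop) continuousOn_id h

/-- The substitution `u = y - k log t` turns this into part of a convergent integral over `ℝ`. The
bound is uniform in `y` and `T`, so no logarithm is lost. -/
lemma exists_integral_exp_log_div_le {γ k : ℝ} (hγ : 0 < γ) (hk : k ≠ 0) :
    ∃ c : ℝ, 0 ≤ c ∧ ∀ y T : ℝ, 1 ≤ T →
      ∫ t in Icc 1 T, Real.exp (-γ * |y - k * Real.log t|) / t ≤ c := by
  set I := ∫ u : ℝ, Real.exp (-γ * |u|) with hI
  have hI0 : 0 ≤ I := integral_nonneg fun u ↦ (Real.exp_pos _).le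
  refine ⟨I / |k|, by positivity, fun y T hT ↦ ?_⟩
  rw [integral_Icc_eq_integral_Ioc, ← intervalIntegral.integral_of_le hT,
    le_div_iff₀' (abs_pos.2 hk)]
  have h0 : ∀ t ∈ uIcc 1 T, t ≠ 0 := fun t ht ↦ by
    rw [uIcc_of_le hT] at ht
    exact (one_pos.trans_le ht.1).ne'
  have hsub : (∫ t in (1 : ℝ)..T, ((fun u ↦ Real.exp (-γ * |u|)) ∘ fun t ↦ y - k * Real.log t) t *
      (-(k * t⁻¹))) = ∫ u in (y - k * Real.log 1)..(y - k * Real.log T), Real.exp (-γ * |u|) := by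
    refine intervalIntegral.integral_comp_mul_deriv (fun t ht ↦ ?_) ?_ (by fun_prop)
    · exact ((Real.hasDerivAt_log (h0 t ht)).const_mul k).const_sub y
    · exact (continuousOn_const.mul (continuousOn_inv₀.mono h0)).neg
  have hle : |∫ u in (y - k * Real.log 1)..(y - k * Real.log T), Real.exp (-γ * |u|)| ≤ I := by
    rw [intervalIntegral.abs_integral_eq_abs_integral_uIoc,
      abs_of_nonneg (integral_nonneg fun u ↦ (Real.exp_pos _).le)]
    exact setIntegral_le_integral (integrable_exp_neg_mul_abs hγ)
      (Filter.Eventually.of_forall fun u ↦ (Real.exp_pos _).le)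
  rw [← hsub] at hle
  refine le_trans (le_of_eq ?_) hle
  have e : ∀ t : ℝ, ((fun u ↦ Real.exp (-γ * |u|)) ∘ fun t ↦ y - k * Real.log t) t * (-(k * t⁻¹)) =
      -k * (Real.exp (-γ * |y - k * Real.log t|) / t) := fun t ↦ by
    simp only [Function.comp]; ring
  simp_rw [e]
  have hnn : 0 ≤ ∫ t in (1 : ℝ)..T, Real.exp (-γ * |y - k * Real.log t|) / t := by
    refine intervalIntegral.integral_nonneg hT fun t ht ↦ ?_
    have : 0 < t := one_pos.trans_le ht.1
    positivity
  rw [intervalIntegral.integral_const_mul, abs_mul, abs_neg, abs_of_nonneg hnn]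

variable {K : Type*} [Field K] [NumberField K] {κ C σ : ℝ}

lemma CountingBound.exists_card_le (h : CountingBound K κ C σ) (hC : 0 ≤ C) (hσ : σ ≤ 1) :
    ∃ A : ℝ, 0 ≤ A ∧ ∀ t : ℝ, 1 ≤ t → ((idealsLE K t).card : ℝ) ≤ A * t := by
  refine ⟨|κ| + C, by positivity, fun t ht ↦ ?_⟩
  have h1 := (abs_sub_le_iff.1 (h t (by linarith))).1
  have h2 : t ^ σ ≤ t := by
    conv_rhs => rw [← Real.rpow_one t]
    exact Real.rpow_le_rpow_of_exponent_le ht hσ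
  have h3 : C * t ^ σ ≤ C * t := by gcongr
  have h4 : κ * t ≤ |κ| * t := by gcongr; exact le_abs_self κ
  linarith

/-- A sum over ideals is bounded by an integral if the summand varies slowly. -/
lemma sum_idealsLE_le_integral {A : ℝ}
    (hcard : ∀ t : ℝ, 1 ≤ t → ((idealsLE K t).card : ℝ) ≤ A * t) {f : ℝ → ℝ} {B D : ℝ}
    (hf0 : ∀ x, 1 ≤ x → 0 ≤ f x) (hf : ∀ x t, 1 ≤ x → x ≤ t → t ≤ 2 * x → f x ≤ D * f t)
    (hD : 0 ≤ D) (hint : IntegrableOn f (Icc 1 (2 * B))) :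
    ∑ b ∈ idealsLE K B, f (idealNorm b) ≤ 2 * D * A * ∫ t in Icc 1 (2 * B), f t := by
  have hcont : ContinuousOn (fun t : ℝ ↦ t⁻¹) (Icc 1 (2 * B)) :=
    continuousOn_inv₀.mono fun t ht ↦ (one_pos.trans_le ht.1).ne'
  have hint' : IntegrableOn (fun t ↦ f t * t⁻¹) (Icc 1 (2 * B)) :=
    hint.mul_continuousOn hcont isCompact_Icc
  -- Each value is spread over `[x, 2x]` with weight `1 / t`. After exchanging sum and integral, a
  -- given `t` meets at most `A t` ideals, which cancels the weight.
  have hterm : ∀ b ∈ idealsLE K B, f (idealNorm b) ≤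
      2 * D * ∫ t in Icc 1 (2 * B), (Icc (idealNorm b) (2 * idealNorm b)).indicator
        (fun t ↦ f t * t⁻¹) t := by
    intro b hb
    set x := idealNorm b with hx
    have hx1 : 1 ≤ x := one_le_idealNorm b
    have hxB : x ≤ B := mem_idealsLE.1 hb
    have hsub : Icc x (2 * x) ⊆ Icc 1 (2 * B) := Icc_subset_Icc hx1 (by linarith)
    rw [setIntegral_indicator measurableSet_Icc, inter_eq_right.2 hsub]
    have h1 : ∫ t in Icc x (2 * x), f x / (2 * x) ≤ ∫ t in Icc x (2 * x), D * (f t * t⁻¹) := by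
      refine setIntegral_mono_on (integrableOn_const (by simp))
        ((hint'.mono_set hsub).const_mul D) measurableSet_Icc fun t ht ↦ ?_
      have ht0 : 0 < t := by linarith [ht.1]
      have := hf x t hx1 ht.1 ht.2
      have h3 : 0 ≤ f x := hf0 x hx1
      calc f x / (2 * x) ≤ f x / t := div_le_div_of_nonneg_left h3 ht0 ht.2
        _ ≤ (D * f t) / t := by gcongr
        _ = _ := by rw [div_eq_mul_inv, mul_assoc]
    rw [setIntegral_const, integral_const_mul, Real.volume_real_Icc_of_le (by linarith),
      smul_eq_mul] at h1
    have h2 : (2 * x - x) * (f x / (2 * x)) = f x / 2 := by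
      have : x ≠ 0 := by linarith
      field_simp; ring
    rw [h2] at h1
    linarith
  refine (Finset.sum_le_sum hterm).trans ?_
  rw [← Finset.mul_sum, ← integral_finsetSum _ fun b _ ↦ hint'.indicator measurableSet_Icc,
    mul_assoc (2 * D), ← integral_const_mul A]
  refine mul_le_mul_of_nonneg_left ?_ (mul_nonneg zero_le_two hD)
  refine setIntegral_mono_on (integrable_finsetSum _ fun b _ ↦ hint'.indicator measurableSet_Icc)
    (hint.const_mul A) measurableSet_Icc fun t ht ↦ ?_
  have ht0 : 0 < t := one_pos.trans_le ht.1
  have hft := hf0 t ht.1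
  calc ∑ b ∈ idealsLE K B, (Icc (idealNorm b) (2 * idealNorm b)).indicator (fun t ↦ f t * t⁻¹) t
      ≤ ∑ b ∈ idealsLE K B, if b ∈ idealsLE K t then f t * t⁻¹ else 0 := by
        refine Finset.sum_le_sum fun b _ ↦ ?_
        rw [indicator_apply]
        split_ifs with h1 h2 h2
        · exact le_rfl
        · exact absurd (mem_idealsLE.2 h1.1) h2
        · positivity
        · exact le_rfl
    _ ≤ ∑ b ∈ idealsLE K t, f t * t⁻¹ := by
        classical
        rw [← Finset.sum_filter]
        refine Finset.sum_le_sum_of_subset_of_nonneg (fun b hb ↦ (Finset.mem_filter.1 hb).2)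
          fun _ _ _ ↦ mul_nonneg hft (inv_nonneg.2 ht0.le)
    _ = (idealsLE K t).card * (f t * t⁻¹) := by rw [Finset.sum_const, nsmul_eq_mul]
    _ ≤ A * t * (f t * t⁻¹) := by
        gcongr
        exact hcard t ht.1
    _ = A * f t := by field_simp

lemma integral_Icc_inv {T : ℝ} (hT : 1 ≤ T) : ∫ t in Icc 1 T, t⁻¹ = Real.log T := by
  rw [integral_Icc_eq_integral_Ioc, ← intervalIntegral.integral_of_le hT,
    integral_inv_of_pos one_pos (by linarith), div_one]

lemma integrableOn_Icc_inv (T : ℝ) : IntegrableOn (fun t : ℝ ↦ t⁻¹) (Icc 1 T) :=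
  (continuousOn_inv₀.mono fun _ ht ↦ (one_pos.trans_le ht.1).ne').integrableOn_compact
    isCompact_Icc

lemma CountingBound.exists_sum_inv_le (h : CountingBound K κ C σ) (hC : 0 ≤ C) (hσ : σ ≤ 1) :
    ∃ A : ℝ, 0 ≤ A ∧ ∀ B : ℝ, 3 ≤ B →
      ∑ b ∈ idealsLE K B, (idealNorm b)⁻¹ ≤ A * Real.log B := by
  obtain ⟨A, hA, hcard⟩ := h.exists_card_le hC hσ
  -- Here `D = 2` gives `4 * A`, and `log (2 * B) ≤ 2 * log B` doubles it.
  refine ⟨8 * A, by positivity, fun B hB ↦ ?_⟩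
  refine (sum_idealsLE_le_integral hcard (f := fun t ↦ t⁻¹) (B := B) (D := 2)
    (fun x hx ↦ by positivity) (fun x t hx hxt htx ↦ ?_) zero_le_two
    (integrableOn_Icc_inv _)).trans ?_
  · have hx0 : 0 < x := by linarith
    have ht0 : 0 < t := by linarith
    rw [← div_eq_mul_inv, inv_eq_one_div, div_le_div_iff₀ hx0 ht0]
    linarith
  · rw [integral_Icc_inv (by linarith), Real.log_mul two_ne_zero (by linarith)]
    have : Real.log 2 ≤ Real.log B := Real.log_le_log two_pos (by linarith)
    nlinarith

lemma CountingBound.exists_sum_exp_log_div_le (h : CountingBound K κ C σ) (hC : 0 ≤ C)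
    (hσ : σ ≤ 1) {γ k : ℝ} (hγ : 0 < γ) (hk : k ≠ 0) :
    ∃ A : ℝ, 0 ≤ A ∧ ∀ B y : ℝ, 3 ≤ B →
      ∑ b ∈ idealsLE K B, Real.exp (-γ * |y - k * Real.log (idealNorm b)|) / idealNorm b ≤ A := by
  obtain ⟨A, hA, hcard⟩ := h.exists_card_le hC hσ
  obtain ⟨c, hc, hint⟩ := exists_integral_exp_log_div_le hγ hk
  -- Moving from `x` to some `t ≤ 2 * x` changes the exponent by at most `γ * |k| * log 2` and the
  -- denominator by a factor at most `2`.
  let D := 2 * Real.exp (γ * |k| * Real.log 2)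
  refine ⟨2 * D * A * c, by positivity, fun B y hB ↦ ?_⟩
  refine (sum_idealsLE_le_integral hcard
    (f := fun t ↦ Real.exp (-γ * |y - k * Real.log t|) / t) (B := B) (D := D)
    (fun x hx ↦ by positivity) (fun x t hx hxt htx ↦ ?_) (by positivity)
    ((continuousOn_exp_log_div γ y k).integrableOn_compact isCompact_Icc)).trans ?_
  · have hx0 : 0 < x := by linarith
    have ht0 : 0 < t := by linarith
    have h1 : |k * Real.log t - k * Real.log x| ≤ |k| * Real.log 2 := by
      rw [← mul_sub, abs_mul]
      gcongr
      rw [← Real.log_div ht0.ne' hx0.ne', abs_of_nonneg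
        (Real.log_nonneg ((one_le_div hx0).2 hxt))]
      exact Real.log_le_log (by positivity) ((div_le_iff₀ hx0).2 htx)
    have h2 : |y - k * Real.log t| - |y - k * Real.log x| ≤ |k| * Real.log 2 := by
      refine (abs_sub_abs_le_abs_sub _ _).trans ?_
      rw [show y - k * Real.log t - (y - k * Real.log x) =
        -(k * Real.log t - k * Real.log x) by ring, abs_neg]
      exact h1
    have h3 : Real.exp (-γ * |y - k * Real.log x|) ≤
        Real.exp (γ * |k| * Real.log 2) * Real.exp (-γ * |y - k * Real.log t|) := by
      rw [← Real.exp_add, Real.exp_le_exp]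
      nlinarith
    calc _ ≤ Real.exp (γ * |k| * Real.log 2) * Real.exp (-γ * |y - k * Real.log t|) / x := by
          gcongr
      _ ≤ Real.exp (γ * |k| * Real.log 2) * Real.exp (-γ * |y - k * Real.log t|) * (2 / t) := by
          rw [div_eq_mul_inv]
          gcongr
          rw [inv_eq_one_div, div_le_div_iff₀ hx0 ht0]
          linarith
      _ = _ := by simp only [D]; ring
  · gcongr
    exact hint y _ (by linarith)

end SumBounds

/-! ### A common form of the two growth conditions -/

section Growth

lemma min_rpow_le_exp {a b u : ℝ} (hu : 0 < u) :
    min (u ^ (-a)) (u ^ b) ≤ Real.exp (-(min a b) * |Real.log u|) := by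
  rcases le_total 1 u with h | h
  · refine (min_le_left _ _).trans ?_
    have hl := Real.log_nonneg h
    rw [Real.rpow_def_of_pos hu, Real.exp_le_exp, abs_of_nonneg hl]
    nlinarith [min_le_left a b]
  · refine (min_le_right _ _).trans ?_
    have hl := Real.log_nonpos hu.le h
    rw [Real.rpow_def_of_pos hu, Real.exp_le_exp, abs_of_nonpos hl]
    nlinarith [min_le_right a b]

/-- Both growth conditions imply a bound decaying away from the hypersurface
`B = t₁ ^ k₁ ⋯ tₙ ^ kₙ`. -/
lemma exists_growth_bound {r : ℕ} {V : (Fin (r + 1) → ℝ) → ℝ → ℝ}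
    (hV : GrowthB V ∨ GrowthC V) :
    ∃ (k : Fin (r + 1) → ℝ) (γ c : ℝ), k 0 ≠ 0 ∧ k (Fin.last r) ≠ 0 ∧ 0 < γ ∧ 0 ≤ c ∧
      ∀ t B, (∀ i, 1 ≤ t i) → 3 ≤ B →
        V t B ≤ c * (B / ∏ i, t i) *
          Real.exp (-γ * |Real.log B - ∑ i, k i * Real.log (t i)|) := by
  have hC : ∃ (k : Fin (r + 1) → ℝ) (a b c : ℝ), k 0 ≠ 0 ∧ k (Fin.last r) ≠ 0 ∧ 0 < a ∧ 0 < b ∧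
      0 ≤ c ∧ ∀ t B, (∀ i, 1 ≤ t i) → 3 ≤ B →
      V t B ≤ c * (B / (∏ i, t i) *
        min ((B / ∏ i, (t i) ^ (k i)) ^ (-a)) ((B / ∏ i, (t i) ^ (k i)) ^ b)) := by
    rcases hV with ⟨k, a, c, h1, h2, ha, h⟩ | ⟨k, a, b, c, h1, h2, ha, hb, h⟩
    -- Under (b) the function vanishes wherever the second term of the minimum would be the smaller
    -- one, so any positive `b` serves.
    · refine ⟨k, a, 1, |c|, h1, h2, ha, one_pos, abs_nonneg c, fun t B ht hB ↦ ?_⟩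
      have hP : 0 < ∏ i, t i := Finset.prod_pos fun i _ ↦ one_pos.trans_le (ht i)
      have hQ : 0 < ∏ i, (t i) ^ (k i) :=
        Finset.prod_pos fun i _ ↦ Real.rpow_pos_of_pos (one_pos.trans_le (ht i)) _
      have hB0 : 0 < B := by linarith
      obtain ⟨h3, h4⟩ := h t B ht hB
      rcases lt_or_ge B (∏ i, (t i) ^ (k i)) with hlt | hge
      · rw [h4 hlt]; positivity
      · have hu : 1 ≤ B / ∏ i, (t i) ^ (k i) := (one_le_div hQ).2 hge
        rw [min_eq_left ((Real.rpow_le_one_of_one_le_of_nonpos hu (by linarith)).trans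
          (Real.one_le_rpow hu zero_le_one))]
        refine h3.trans ?_
        gcongr
        exact le_abs_self c
    · refine ⟨k, a, b, |c|, h1, h2, ha, hb, abs_nonneg c, fun t B ht hB ↦ (h t B ht hB).trans ?_⟩
      have hP : 0 < ∏ i, t i := Finset.prod_pos fun i _ ↦ one_pos.trans_le (ht i)
      have hQ : 0 < ∏ i, (t i) ^ (k i) :=
        Finset.prod_pos fun i _ ↦ Real.rpow_pos_of_pos (one_pos.trans_le (ht i)) _
      have hB0 : 0 < B := by linarith
      gcongr
      exact le_abs_self c
  obtain ⟨k, a, b, c, h1, h2, ha, hb, hc, h⟩ := hC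
  refine ⟨k, min a b, c, h1, h2, lt_min ha hb, hc, fun t B ht hB ↦ (h t B ht hB).trans ?_⟩
  have ht0 : ∀ i, 0 < t i := fun i ↦ one_pos.trans_le (ht i)
  have hP : 0 < ∏ i, t i := Finset.prod_pos fun i _ ↦ ht0 i
  have hQ : 0 < ∏ i, (t i) ^ (k i) := Finset.prod_pos fun i _ ↦ Real.rpow_pos_of_pos (ht0 i) _
  have hB0 : 0 < B := by linarith
  have hlog : Real.log (B / ∏ i, (t i) ^ (k i)) = Real.log B - ∑ i, k i * Real.log (t i) := by
    rw [Real.log_div hB0.ne' hQ.ne', Real.log_prod fun i _ ↦ (Real.rpow_pos_of_pos (ht0 i) _).ne']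
    congr 1
    exact Finset.sum_congr rfl fun i _ ↦ Real.log_rpow (ht0 i) _
  rw [← mul_assoc, ← hlog]
  gcongr
  exact min_rpow_le_exp (by positivity)

end Growth

/-! ### Replacing sums by integrals one variable at a time -/

section Tower

/-- A function `W (r + 1)` of `r + 1` variables that decays away from a hypersurface and vanishes
outside of `[1, B] ^ (r + 1)`, with its successive integrals `W r, …, W 0` over the last variable,
all piecewise monotone in their last variable. -/
structure Tower (r : ℕ) (k : Fin (r + 1) → ℝ) (γ c₀ : ℝ) (R : ℕ) (B : ℝ)
    (W : (m : ℕ) → (Fin m → ℝ) → ℝ) : Prop where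
  nonneg : ∀ m ≤ r + 1, ∀ t : Fin m → ℝ, (∀ i, 1 ≤ t i) → 0 ≤ W m t
  supp : ∀ m ≤ r + 1, ∀ t : Fin m → ℝ, (∀ i, 1 ≤ t i) → (∃ i, B < t i) → W m t = 0
  step : ∀ m ≤ r, ∀ t : Fin m → ℝ, (∀ i, 1 ≤ t i) →
    W m t = ∫ x in Icc 1 B, W (m + 1) (Fin.snoc t x)
  mono : ∀ m ≤ r, ∀ t : Fin m → ℝ, (∀ i, 1 ≤ t i) →
    PiecewiseMonotoneC1 (fun x ↦ W (m + 1) (Fin.snoc t x)) B R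
  growth : ∀ t : Fin (r + 1) → ℝ, (∀ i, 1 ≤ t i) →
    W (r + 1) t ≤ c₀ * (B / ∏ i, t i) * Real.exp (-γ * |Real.log B - ∑ i, k i * Real.log (t i)|)

lemma one_le_snoc {m : ℕ} {t : Fin m → ℝ} (ht : ∀ i, 1 ≤ t i) {x : ℝ} (hx : 1 ≤ x)
    (i : Fin (m + 1)) : 1 ≤ (Fin.snoc t x : Fin (m + 1) → ℝ) i := by
  induction i using Fin.lastCases with
  | last => simpa using hx
  | cast i => simpa using ht i

lemma one_le_log {B : ℝ} (hB : 3 ≤ B) : 1 ≤ Real.log B := by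
  rw [Real.le_log_iff_exp_le (by linarith)]
  linarith [Real.exp_one_lt_three]

namespace Tower

variable {r : ℕ} {k : Fin (r + 1) → ℝ} {γ c₀ : ℝ} {R : ℕ}

lemma growth_snoc {B : ℝ} {W : (m : ℕ) → (Fin m → ℝ) → ℝ} (h : Tower r k γ c₀ R B W)
    {t : Fin r → ℝ} (ht : ∀ i, 1 ≤ t i) {x : ℝ} (hx : 1 ≤ x) :
    W (r + 1) (Fin.snoc t x) ≤ c₀ * (B / ∏ i, t i) *
      (Real.exp (-γ * |(Real.log B - ∑ i : Fin r, k i.castSucc * Real.log (t i)) -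
        k (Fin.last r) * Real.log x|) / x) := by
  refine (h.growth _ (one_le_snoc ht hx)).trans (le_of_eq ?_)
  rw [Fin.prod_univ_castSucc, Fin.sum_univ_castSucc]
  simp only [Fin.snoc_castSucc, Fin.snoc_last]
  rw [sub_sub, ← div_div]
  ring

/-- Since `k (Fin.last r) ≠ 0`, the exponential decay makes the integral over the last variable cost
a constant instead of a factor `log B`. -/
lemma exists_bound_top (hγ : 0 < γ) (hk : k (Fin.last r) ≠ 0) (hc₀ : 0 ≤ c₀) :
    ∃ c : ℝ, 0 ≤ c ∧ ∀ (B : ℝ) (W : (m : ℕ) → (Fin m → ℝ) → ℝ), 3 ≤ B → Tower r k γ c₀ R B W →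
      ∀ t : Fin r → ℝ, (∀ i, 1 ≤ t i) → W r t ≤ c * (B / ∏ i, t i) := by
  obtain ⟨c, hc, hint⟩ := exists_integral_exp_log_div_le hγ hk
  refine ⟨c₀ * c, by positivity, fun B W hB h t ht ↦ ?_⟩
  have hP : 0 < ∏ i, t i := Finset.prod_pos fun i _ ↦ one_pos.trans_le (ht i)
  have hB0 : 0 < B := by linarith
  set y := Real.log B - ∑ i : Fin r, k i.castSucc * Real.log (t i) with hy
  rw [h.step r le_rfl t ht]
  calc ∫ x in Icc 1 B, W (r + 1) (Fin.snoc t x)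
      ≤ ∫ x in Icc 1 B, c₀ * (B / ∏ i, t i) *
          (Real.exp (-γ * |y - k (Fin.last r) * Real.log x|) / x) := by
        refine integral_mono_of_nonneg ?_ ?_ ?_
        · refine (ae_restrict_iff' measurableSet_Icc).2 (Filter.Eventually.of_forall fun x hx ↦ ?_)
          exact h.nonneg _ le_rfl _ (one_le_snoc ht hx.1)
        · exact ((continuousOn_exp_log_div _ _ _).integrableOn_compact isCompact_Icc).const_mul _
        · refine (ae_restrict_iff' measurableSet_Icc).2 (Filter.Eventually.of_forall fun x hx ↦ ?_)
          exact h.growth_snoc ht hx.1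
    _ ≤ c₀ * (B / ∏ i, t i) * c := by
        rw [integral_const_mul]
        gcongr
        exact hint y B (by linarith)
    _ = _ := by ring

/-- Below the top, each further integration of `1 / x` over `[1, B]` costs one factor `log B`. -/
lemma bound_lower {c : ℝ} {B : ℝ} {W : (m : ℕ) → (Fin m → ℝ) → ℝ} (hB : 3 ≤ B)
    (h : Tower r k γ c₀ R B W)
    (htop : ∀ t : Fin r → ℝ, (∀ i, 1 ≤ t i) → W r t ≤ c * (B / ∏ i, t i)) :
    ∀ (m j : ℕ), m + j = r → ∀ t : Fin m → ℝ, (∀ i, 1 ≤ t i) →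
      W m t ≤ c * (B / ∏ i, t i) * Real.log B ^ j := by
  intro m j
  induction j generalizing m with
  | zero =>
    rintro rfl t ht
    simpa using htop t ht
  | succ j ih =>
    intro hm t ht
    have hP : 0 < ∏ i, t i := Finset.prod_pos fun i _ ↦ one_pos.trans_le (ht i)
    have hB0 : 0 < B := by linarith
    rw [h.step m (by omega) t ht]
    calc ∫ x in Icc 1 B, W (m + 1) (Fin.snoc t x)
        ≤ ∫ x in Icc 1 B, c * (B / ∏ i, t i) * Real.log B ^ j * x⁻¹ := by
          refine integral_mono_of_nonneg ?_ ?_ ?_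
          · refine (ae_restrict_iff' measurableSet_Icc).2
              (Filter.Eventually.of_forall fun x hx ↦ ?_)
            exact h.nonneg _ (by omega) _ (one_le_snoc ht hx.1)
          · exact (integrableOn_Icc_inv B).const_mul _
          · refine (ae_restrict_iff' measurableSet_Icc).2
              (Filter.Eventually.of_forall fun x hx ↦ ?_)
            refine (ih (m + 1) (by omega) _ (one_le_snoc ht hx.1)).trans (le_of_eq ?_)
            rw [Fin.prod_univ_castSucc]
            simp only [Fin.snoc_castSucc, Fin.snoc_last]
            rw [← div_div]
            ring
      _ = _ := by
          rw [integral_const_mul, integral_Icc_inv (by linarith), pow_succ]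
          ring

end Tower

variable {K : Type*} [Field K] [NumberField K]

/-- The sum of `F (q₁ N𝔟₁, …, qₘ N𝔟ₘ)` over all ideals of norm at most `B`. -/
def boxSum (K : Type*) [Field K] [NumberField K] (B : ℝ) {m : ℕ} (q : Fin m → ℝ)
    (F : (Fin m → ℝ) → ℝ) : ℝ :=
  ∑ b : Fin m → idealsLE K B, F fun i ↦ q i * idealNorm (b i).1

lemma sum_fin_succ {α : Type*} [Fintype α] {m : ℕ} (f : (Fin (m + 1) → α) → ℝ) :
    ∑ b : Fin (m + 1) → α, f b = ∑ b : Fin m → α, ∑ x : α, f (Fin.snoc b x) := by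
  rw [← (Fin.snocEquiv fun _ ↦ α).sum_comp, Fintype.sum_prod_type_right]
  rfl

lemma boxSum_succ (B : ℝ) {m : ℕ} (q : Fin (m + 1) → ℝ) (F : (Fin (m + 1) → ℝ) → ℝ) :
    boxSum K B q F = ∑ b : Fin m → idealsLE K B, ∑ x ∈ idealsLE K B,
      F (Fin.snoc (fun i ↦ q i.castSucc * idealNorm (b i).1) (q (Fin.last m) * idealNorm x)) := by
  rw [boxSum, sum_fin_succ]
  refine Finset.sum_congr rfl fun b _ ↦ ?_
  rw [← Finset.sum_coe_sort (idealsLE K B)]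
  refine Finset.sum_congr rfl fun x _ ↦ ?_
  congr 1
  ext i
  induction i using Fin.lastCases with
  | last => simp
  | cast i => simp

lemma sum_prod_inv (B : ℝ) {m : ℕ} (q : Fin m → ℝ) :
    ∑ b : Fin m → idealsLE K B, (∏ i, q i * idealNorm (b i).1)⁻¹ =
      (∏ i, (q i)⁻¹) * (∑ b ∈ idealsLE K B, (idealNorm b)⁻¹) ^ m := by
  have h := Fintype.prod_sum fun (i : Fin m) (x : idealsLE K B) ↦ (q i * idealNorm x.1)⁻¹
  simp_rw [← Finset.prod_inv_distrib]
  rw [← h]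
  simp_rw [mul_inv, ← Finset.mul_sum, Finset.prod_mul_distrib]
  rw [Finset.sum_coe_sort (idealsLE K B) fun b ↦ (idealNorm b)⁻¹, Finset.prod_const,
    Finset.card_univ, Fintype.card_fin]

lemma one_le_mul_idealNorm {m : ℕ} {q : Fin m → ℝ} (hq : ∀ i, 1 ≤ q i) (b : Fin m → NzIdeal K)
    (i : Fin m) : 1 ≤ q i * idealNorm (b i) :=
  one_le_mul_of_one_le_of_one_le (hq i) (one_le_idealNorm _)

variable {r : ℕ} {k : Fin (r + 1) → ℝ} {γ c₀ : ℝ} {R : ℕ} {κ C σ : ℝ}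

/-- The one-variable comparison in the last variable with the others fixed, then summed over the
others. The scale `q (Fin.last m)` enters the error only through its power `-σ`, which later makes
the sum over divisors converge. -/
lemma Tower.abs_boxSum_sub_le (hcount : CountingBound K κ C σ) (hC : 0 ≤ C) (hσ : 0 ≤ σ)
    {α : ℝ} (hσα : σ < α) {B : ℝ} {W : (m : ℕ) → (Fin m → ℝ) → ℝ}
    (h : Tower r k γ c₀ R B W) {m : ℕ} (hm : m ≤ r) {q : Fin (m + 1) → ℝ} (hq : ∀ i, 1 ≤ q i)
    (M : (Fin m → ℝ) → ℝ) (hM0 : ∀ t : Fin m → ℝ, (∀ i, 1 ≤ t i) → 0 ≤ M t)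
    (hM : ∀ t : Fin m → ℝ, (∀ i, 1 ≤ t i) → ∀ x ∈ Icc 1 B,
      W (m + 1) (Fin.snoc t x) ≤ M t * x ^ (-α)) :
    |boxSum K B q (W (m + 1)) -
        κ / q (Fin.last m) * boxSum K B (fun i : Fin m ↦ q i.castSucc) (W m)| ≤
      (2 * R + 1) * (2 * C / (1 - σ / α)) * q (Fin.last m) ^ (-σ) *
        boxSum K B (fun i : Fin m ↦ q i.castSucc) M := by
  have hq0 : 0 < q (Fin.last m) := one_pos.trans_le (hq _)
  rw [boxSum_succ, boxSum, boxSum, Finset.mul_sum, ← Finset.sum_sub_distrib, Finset.mul_sum]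
  refine (Finset.abs_sum_le_sum_abs _ _).trans (Finset.sum_le_sum fun b _ ↦ ?_)
  set t : Fin m → ℝ := fun i ↦ q i.castSucc * idealNorm (b i).1
  have ht : ∀ i, 1 ≤ t i := fun i ↦
    one_le_mul_idealNorm (fun i : Fin m ↦ hq i.castSucc) (fun i ↦ (b i).1) i
  have hsub : ∀ a : NzIdeal K, q (Fin.last m) * idealNorm a ≤ B → a ∈ idealsLE K B := by
    intro a ha
    refine mem_idealsLE.2 (le_trans ?_ ha)
    exact le_mul_of_one_le_left (idealNorm_pos _).le (hq _)
  have key := (hcount.piecewise_monotone hC hσ hq0 (h.mono m hm t ht) hσα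
    (fun x hx ↦ h.nonneg _ (by omega) _ (one_le_snoc ht hx.1)) (hM t ht) (hM0 t ht)
    (idealsLE K B) hsub).2
  rw [← h.step m hm t ht] at key
  have hind : ∀ a ∈ idealsLE K B,
      (Icc 1 B).indicator (fun x ↦ W (m + 1) (Fin.snoc t x)) (q (Fin.last m) * idealNorm a) =
        W (m + 1) (Fin.snoc t (q (Fin.last m) * idealNorm a)) := by
    intro a _
    have h1 : 1 ≤ q (Fin.last m) * idealNorm a :=
      one_le_mul_of_one_le_of_one_le (hq _) (one_le_idealNorm _)
    by_cases hle : q (Fin.last m) * idealNorm a ≤ B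
    · rw [indicator_of_mem (mem_Icc.2 ⟨h1, hle⟩)]
    · rw [indicator_of_notMem fun hx ↦ hle hx.2]
      refine (h.supp _ (by omega) _ (one_le_snoc ht h1) ⟨Fin.last m, ?_⟩).symm
      simpa using hle
  rw [Finset.sum_congr rfl hind] at key
  refine key.trans (le_of_eq ?_)
  ring

lemma prod_inv_le_prod_rpow {m : ℕ} {q : Fin m → ℝ} (hq : ∀ i, 1 ≤ q i) (hσ1 : σ ≤ 1) :
    ∏ i, (q i)⁻¹ ≤ ∏ i, q i ^ (-σ) := by
  refine Finset.prod_le_prod (fun i _ ↦ inv_nonneg.2 (zero_le_one.trans (hq i))) fun i _ ↦ ?_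
  rw [← Real.rpow_neg_one]
  exact Real.rpow_le_rpow_of_exponent_le (hq i) (by linarith)

/-- With the last variable already integrated, decay `1 / x` suffices: the size of `W (m + 1)`
contributes `r - m - 1` logarithms and the sum over the remaining `m` ideals contributes `m`, in
total `r - 1`. -/
lemma exists_stage_lower (hcount : CountingBound K κ C σ) (hC : 0 ≤ C) (hσ : 0 ≤ σ) (hσ1 : σ < 1)
    (hγ : 0 < γ) (hk : k (Fin.last r) ≠ 0) (hc₀ : 0 ≤ c₀) {m : ℕ} (hm : m < r) :
    ∃ A : ℝ, 0 ≤ A ∧ ∀ (B : ℝ) (W : (m : ℕ) → (Fin m → ℝ) → ℝ), 3 ≤ B → Tower r k γ c₀ R B W →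
      ∀ q : Fin (m + 1) → ℝ, (∀ i, 1 ≤ q i) →
        |boxSum K B q (W (m + 1)) -
          κ / q (Fin.last m) * boxSum K B (fun i : Fin m ↦ q i.castSucc) (W m)| ≤
        A * (B * Real.log B ^ (r - 1)) * ∏ i, q i ^ (-σ) := by
  obtain ⟨c, hc, htop⟩ := Tower.exists_bound_top (R := R) hγ hk hc₀
  obtain ⟨A, hA, hsum⟩ := hcount.exists_sum_inv_le hC hσ1.le
  obtain ⟨j, hj⟩ : ∃ j, m + 1 + j = r := ⟨r - (m + 1), by omega⟩
  have hσ' : 0 < 1 - σ := by linarith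
  refine ⟨(2 * R + 1) * (2 * C / (1 - σ)) * (c * A ^ m), by positivity, fun B W hB h q hq ↦ ?_⟩
  have hB0 : 0 < B := by linarith
  have hL : 0 ≤ Real.log B := zero_le_one.trans (one_le_log hB)
  have hqp : ∀ i, 0 < q i := fun i ↦ one_pos.trans_le (hq i)
  refine (h.abs_boxSum_sub_le hcount hC hσ hσ1 hm.le hq
    (fun t ↦ c * B * Real.log B ^ j * (∏ i, t i)⁻¹) ?_ ?_).trans ?_
  · intro t ht
    have hP : 0 < ∏ i, t i := Finset.prod_pos fun i _ ↦ one_pos.trans_le (ht i)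
    positivity
  · intro t ht x hx
    refine (h.bound_lower hB (htop B W hB h) (m + 1) j hj _ (one_le_snoc ht hx.1)).trans
      (le_of_eq ?_)
    rw [Fin.prod_univ_castSucc, Real.rpow_neg_one]
    simp only [Fin.snoc_castSucc, Fin.snoc_last]
    rw [← div_div]
    ring
  · have hb : boxSum K B (fun i : Fin m ↦ q i.castSucc)
        (fun t ↦ c * B * Real.log B ^ j * (∏ i, t i)⁻¹) ≤
        c * B * Real.log B ^ j * ((∏ i : Fin m, q i.castSucc ^ (-σ)) * (A * Real.log B) ^ m) := by
      rw [boxSum, ← Finset.mul_sum, sum_prod_inv]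
      have h0 : 0 ≤ ∑ b ∈ idealsLE K B, (idealNorm b)⁻¹ :=
        Finset.sum_nonneg fun b _ ↦ inv_nonneg.2 (idealNorm_pos b).le
      have h1 := prod_inv_le_prod_rpow (σ := σ) (fun i : Fin m ↦ hq i.castSucc) hσ1.le
      have h2 : (∑ b ∈ idealsLE K B, (idealNorm b)⁻¹) ^ m ≤ (A * Real.log B) ^ m :=
        pow_le_pow_left₀ h0 (hsum B hB) m
      have h3 : 0 ≤ ∏ i : Fin m, q i.castSucc ^ (-σ) :=
        Finset.prod_nonneg fun i _ ↦ Real.rpow_nonneg (hqp _).le _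
      gcongr
    have hr : r - 1 = j + m := by omega
    rw [Fin.prod_univ_castSucc, hr, pow_add]
    have h4 : 0 ≤ q (Fin.last m) ^ (-σ) := Real.rpow_nonneg (hqp _).le _
    rw [div_one]
    calc _ ≤ (2 * R + 1) * (2 * C / (1 - σ)) * q (Fin.last m) ^ (-σ) * (c * B * Real.log B ^ j *
          ((∏ i : Fin m, q i.castSucc ^ (-σ)) * (A * Real.log B) ^ m)) := by gcongr
      _ = _ := by rw [mul_pow]; ring

lemma sum_fin_succ_cons {α : Type*} [Fintype α] {m : ℕ} (f : (Fin (m + 1) → α) → ℝ) :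
    ∑ b : Fin (m + 1) → α, f b = ∑ b : Fin m → α, ∑ x : α, f (Fin.cons x b) := by
  rw [← (Fin.consEquiv fun _ ↦ α).sum_comp, Fintype.sum_prod_type_right]
  rfl

/-- As `k 0 ≠ 0`, the sum over the first ideal is bounded by the exponential decay; the other `n`
sums cost a logarithm each. -/
lemma exists_boxSum_exp_le (hcount : CountingBound K κ C σ) (hC : 0 ≤ C) (hσ1 : σ ≤ 1)
    (hγ : 0 < γ) {n : ℕ} {k : Fin (n + 1) → ℝ} (hk : k 0 ≠ 0) :
    ∃ A : ℝ, 0 ≤ A ∧ ∀ (B : ℝ), 3 ≤ B → ∀ q : Fin (n + 1) → ℝ, (∀ i, 1 ≤ q i) →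
      boxSum K B q (fun t ↦ (∏ i, t i)⁻¹ *
        Real.exp (-γ * |Real.log B - ∑ i, k i * Real.log (t i)|)) ≤
      A * Real.log B ^ n * ∏ i, (q i)⁻¹ := by
  obtain ⟨A, hA, hsum⟩ := hcount.exists_sum_inv_le hC hσ1
  obtain ⟨A', hA', hsum'⟩ := hcount.exists_sum_exp_log_div_le hC hσ1 hγ hk
  refine ⟨A ^ n * A', by positivity, fun B hB q hq ↦ ?_⟩
  have hqp : ∀ i, 0 < q i := fun i ↦ one_pos.trans_le (hq i)
  rw [boxSum, sum_fin_succ_cons]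
  calc _ ≤ ∑ b : Fin n → idealsLE K B,
        (∏ i : Fin n, q i.succ * idealNorm (b i).1)⁻¹ * ((q 0)⁻¹ * A') := by
        refine Finset.sum_le_sum fun b _ ↦ ?_
        set y : ℝ := Real.log B - k 0 * Real.log (q 0) -
          ∑ i : Fin n, k i.succ * Real.log (q i.succ * idealNorm (b i).1) with hy
        have hP : 0 < ∏ i : Fin n, q i.succ * idealNorm (b i).1 :=
          Finset.prod_pos fun i _ ↦ mul_pos (hqp _) (idealNorm_pos _)
        have hterm : ∀ x : idealsLE K B, (∏ i, q i * idealNorm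
              ((Fin.cons x b : Fin (n + 1) → idealsLE K B) i).1)⁻¹ *
            Real.exp (-γ * |Real.log B - ∑ i, k i * Real.log (q i * idealNorm
              ((Fin.cons x b : Fin (n + 1) → idealsLE K B) i).1)|) =
            (∏ i : Fin n, q i.succ * idealNorm (b i).1)⁻¹ * ((q 0)⁻¹ *
              (Real.exp (-γ * |y - k 0 * Real.log (idealNorm x.1)|) / idealNorm x.1)) := by
          intro x
          rw [Fin.prod_univ_succ, Fin.sum_univ_succ]
          simp only [Fin.cons_zero, Fin.cons_succ]
          rw [Real.log_mul (hqp 0).ne' (idealNorm_pos x.1).ne', mul_inv, mul_inv, hy]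
          ring_nf
        rw [Finset.sum_congr rfl fun x _ ↦ hterm x, ← Finset.mul_sum, ← Finset.mul_sum,
          Finset.sum_coe_sort (idealsLE K B) fun x ↦
            Real.exp (-γ * |y - k 0 * Real.log (idealNorm x)|) / idealNorm x]
        have := hsum' B y hB
        have := hqp 0
        gcongr
    _ = (∏ i : Fin n, (q i.succ)⁻¹) * (∑ b ∈ idealsLE K B, (idealNorm b)⁻¹) ^ n *
          ((q 0)⁻¹ * A') := by
        rw [← Finset.sum_mul, sum_prod_inv]
    _ ≤ (∏ i : Fin n, (q i.succ)⁻¹) * (A * Real.log B) ^ n * ((q 0)⁻¹ * A') := by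
        have h0 : 0 ≤ ∑ b ∈ idealsLE K B, (idealNorm b)⁻¹ :=
          Finset.sum_nonneg fun b _ ↦ inv_nonneg.2 (idealNorm_pos b).le
        have h1 : 0 ≤ ∏ i : Fin n, (q i.succ)⁻¹ :=
          Finset.prod_nonneg fun i _ ↦ (inv_pos.2 (hqp _)).le
        have := hsum B hB
        have := hqp 0
        gcongr
    _ = _ := by
        rw [Fin.prod_univ_succ, mul_pow]
        ring

/-- The exponential decay is made independent of `x` by lowering its rate to `γ'` and giving up `x ^
δ`. The decay in `z` can then still be used when summing over another variable. -/
lemma exp_log_div_le {δ γ' κ' z x : ℝ} (hγ' : γ' ≤ γ) (hγ0 : 0 ≤ γ') (hδ : γ' * |κ'| ≤ δ)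
    (hx : 1 ≤ x) :
    Real.exp (-γ * |z - κ' * Real.log x|) / x ≤ Real.exp (-γ' * |z|) * x ^ (-(1 - δ)) := by
  have hx0 : 0 < x := by linarith
  have hL : 0 ≤ Real.log x := Real.log_nonneg hx
  have e : x ^ (-(1 - δ)) = Real.exp (δ * Real.log x) / x := by
    rw [neg_sub, Real.rpow_sub_one hx0.ne', Real.rpow_def_of_pos hx0, mul_comm]
  rw [e, ← mul_div_assoc, ← Real.exp_add]
  gcongr
  have h1 : |z| ≤ |z - κ' * Real.log x| + |κ'| * Real.log x := by
    have := abs_add_le (z - κ' * Real.log x) (κ' * Real.log x)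
    rwa [sub_add_cancel, abs_mul κ', abs_of_nonneg hL] at this
  have h2 : γ' * |z - κ' * Real.log x| ≤ γ * |z - κ' * Real.log x| := by gcongr
  have h3 : γ' * |z| ≤ γ' * (|z - κ' * Real.log x| + |κ'| * Real.log x) := by gcongr
  have h4 : γ' * |κ'| * Real.log x ≤ δ * Real.log x := by gcongr
  linarith

/-- Nothing has been integrated yet, so dropping the exponential factor would leave `r` logarithms.
It is carried into the error term, where the sum over the first ideal uses it; `r ≥ 1` makes the
first variable different from the last. -/
lemma exists_stage_top (hcount : CountingBound K κ C σ) (hC : 0 ≤ C) (hσ : 0 ≤ σ) (hσ1 : σ < 1)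
    (hγ : 0 < γ) (hr : 1 ≤ r) (hk0 : k 0 ≠ 0) (hk : k (Fin.last r) ≠ 0) (hc₀ : 0 ≤ c₀) :
    ∃ A : ℝ, 0 ≤ A ∧ ∀ (B : ℝ) (W : (m : ℕ) → (Fin m → ℝ) → ℝ), 3 ≤ B → Tower r k γ c₀ R B W →
      ∀ q : Fin (r + 1) → ℝ, (∀ i, 1 ≤ q i) →
        |boxSum K B q (W (r + 1)) -
          κ / q (Fin.last r) * boxSum K B (fun i : Fin r ↦ q i.castSucc) (W r)| ≤
        A * (B * Real.log B ^ (r - 1)) * ∏ i, q i ^ (-σ) := by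
  obtain ⟨n, rfl⟩ : ∃ n, r = n + 1 := ⟨r - 1, by omega⟩
  -- Half of the gap, so that the remaining decay exponent `1 - δ` still exceeds `σ`.
  set δ := (1 - σ) / 2 with hδ
  have hδ0 : 0 < δ := by rw [hδ]; linarith
  have hkp : 0 < |k (Fin.last (n + 1))| := abs_pos.2 hk
  set γ' := min γ (δ / |k (Fin.last (n + 1))|) with hγ'
  have hγ'0 : 0 < γ' := lt_min hγ (by positivity)
  have hγk : γ' * |k (Fin.last (n + 1))| ≤ δ := by
    rw [← le_div_iff₀ hkp]; exact min_le_right _ _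
  obtain ⟨A, hA, hsum⟩ := exists_boxSum_exp_le hcount hC hσ1.le hγ'0
    (k := fun i : Fin (n + 1) ↦ k i.castSucc) hk0
  have hσα : σ < 1 - δ := by rw [hδ]; linarith
  have hσ' : 0 < 1 - σ / (1 - δ) := by
    rw [sub_pos, div_lt_one (by linarith)]; exact hσα
  refine ⟨(2 * R + 1) * (2 * C / (1 - σ / (1 - δ))) * (c₀ * A), by positivity,
    fun B W hB h q hq ↦ ?_⟩
  have hB0 : 0 < B := by linarith
  have hL : 0 ≤ Real.log B := zero_le_one.trans (one_le_log hB)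
  have hqp : ∀ i, 0 < q i := fun i ↦ one_pos.trans_le (hq i)
  refine (h.abs_boxSum_sub_le hcount hC hσ hσα le_rfl hq
    (fun t ↦ c₀ * B * ((∏ i, t i)⁻¹ * Real.exp (-γ' * |Real.log B -
      ∑ i : Fin (n + 1), k i.castSucc * Real.log (t i)|))) ?_ ?_).trans ?_
  · intro t ht
    have hP : 0 < ∏ i, t i := Finset.prod_pos fun i _ ↦ one_pos.trans_le (ht i)
    positivity
  · intro t ht x hx
    have hP : 0 < ∏ i, t i := Finset.prod_pos fun i _ ↦ one_pos.trans_le (ht i)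
    refine (h.growth_snoc ht hx.1).trans ?_
    calc _ ≤ c₀ * (B / ∏ i, t i) * (Real.exp (-γ' * |Real.log B -
        ∑ i : Fin (n + 1), k i.castSucc * Real.log (t i)|) * x ^ (-(1 - δ))) := by
          gcongr
          exact exp_log_div_le (min_le_left _ _) hγ'0.le hγk hx.1
      _ = _ := by rw [div_eq_mul_inv]; ring
  · have hb : boxSum K B (fun i : Fin (n + 1) ↦ q i.castSucc)
        (fun t ↦ c₀ * B * ((∏ i, t i)⁻¹ * Real.exp (-γ' * |Real.log B -
          ∑ i : Fin (n + 1), k i.castSucc * Real.log (t i)|))) ≤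
        c₀ * B * (A * Real.log B ^ n * ∏ i : Fin (n + 1), q i.castSucc ^ (-σ)) := by
      have h1 := hsum B hB _ fun i : Fin (n + 1) ↦ hq i.castSucc
      have h2 := prod_inv_le_prod_rpow (σ := σ) (fun i : Fin (n + 1) ↦ hq i.castSucc) hσ1.le
      rw [boxSum] at h1
      rw [boxSum, ← Finset.mul_sum]
      gcongr
      refine h1.trans ?_
      gcongr
    rw [Fin.prod_univ_castSucc (n := n + 1)]
    have h4 : 0 ≤ q (Fin.last (n + 1)) ^ (-σ) := Real.rpow_nonneg (hqp _).le _
    calc _ ≤ _ := mul_le_mul_of_nonneg_left hb (by positivity)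
      _ = _ := by rw [Nat.add_sub_cancel]; ring

/-- The sum of the top function of a tower over all ideals is approximated by its integral. -/
theorem exists_abs_boxSum_sub_le (hcount : CountingBound K κ C σ) (hκ : 0 ≤ κ) (hC : 0 ≤ C)
    (hσ : 0 ≤ σ) (hσ1 : σ < 1) (hγ : 0 < γ) (hr : 1 ≤ r) (hk0 : k 0 ≠ 0)
    (hk : k (Fin.last r) ≠ 0) (hc₀ : 0 ≤ c₀) (R : ℕ) :
    ∀ m ≤ r + 1, ∃ A : ℝ, 0 ≤ A ∧
      ∀ (B : ℝ) (W : (m : ℕ) → (Fin m → ℝ) → ℝ), 3 ≤ B → Tower r k γ c₀ R B W →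
        ∀ q : Fin m → ℝ, (∀ i, 1 ≤ q i) →
          |boxSum K B q (W m) - κ ^ m * (∏ i, (q i)⁻¹) * W 0 Fin.elim0| ≤
            A * (B * Real.log B ^ (r - 1)) * ∏ i, q i ^ (-σ) := by
  intro m
  induction m with
  | zero =>
    refine fun _ ↦ ⟨0, le_rfl, fun B W _ _ q _ ↦ ?_⟩
    rw [boxSum, Fintype.sum_unique]
    simp only [Finset.univ_eq_empty, Finset.prod_empty, pow_zero, one_mul]
    rw [Subsingleton.elim (fun i : Fin 0 ↦ _) (Fin.elim0 : Fin 0 → ℝ)]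
    simp
  | succ m ih =>
    intro hm
    obtain ⟨A, hA, hbound⟩ := ih (by omega)
    obtain ⟨A', hA', hstage⟩ : ∃ A : ℝ, 0 ≤ A ∧
        ∀ (B : ℝ) (W : (m : ℕ) → (Fin m → ℝ) → ℝ), 3 ≤ B → Tower r k γ c₀ R B W →
        ∀ q : Fin (m + 1) → ℝ, (∀ i, 1 ≤ q i) →
          |boxSum K B q (W (m + 1)) -
            κ / q (Fin.last m) * boxSum K B (fun i : Fin m ↦ q i.castSucc) (W m)| ≤
          A * (B * Real.log B ^ (r - 1)) * ∏ i, q i ^ (-σ) := by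
      rcases (show m ≤ r by omega).lt_or_eq with hlt | rfl
      · exact exists_stage_lower hcount hC hσ hσ1 hγ hk hc₀ hlt
      · exact exists_stage_top hcount hC hσ hσ1 hγ hr hk0 hk hc₀
    refine ⟨A' + κ * A, by positivity, fun B W hB h q hq ↦ ?_⟩
    have hqp : ∀ i, 0 < q i := fun i ↦ one_pos.trans_le (hq i)
    have hB0 : 0 < B := by linarith
    have hL : 0 ≤ Real.log B := zero_le_one.trans (one_le_log hB)
    have h1 := hstage B W hB h q hq
    have h2 := hbound B W hB h (fun i ↦ q i.castSucc) fun i ↦ hq _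
    have h3 : 0 ≤ ∏ i : Fin m, q i.castSucc ^ (-σ) :=
      Finset.prod_nonneg fun i _ ↦ Real.rpow_nonneg (hqp _).le _
    have hlast : (q (Fin.last m))⁻¹ ≤ q (Fin.last m) ^ (-σ) := by
      rw [← Real.rpow_neg_one]
      exact Real.rpow_le_rpow_of_exponent_le (hq _) (by linarith)
    have hlast0 := hqp (Fin.last m)
    -- Error of replacing the last sum, plus `κ / q (Fin.last m)` times the error for the remaining
    -- variables. The factor `(q (Fin.last m))⁻¹` is then weakened to the power `-σ`.
    have hsplit : boxSum K B q (W (m + 1)) - κ ^ (m + 1) * (∏ i, (q i)⁻¹) * W 0 Fin.elim0 =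
        (boxSum K B q (W (m + 1)) -
          κ / q (Fin.last m) * boxSum K B (fun i : Fin m ↦ q i.castSucc) (W m)) +
        κ * (q (Fin.last m))⁻¹ * (boxSum K B (fun i : Fin m ↦ q i.castSucc) (W m) -
          κ ^ m * (∏ i : Fin m, (q i.castSucc)⁻¹) * W 0 Fin.elim0) := by
      rw [Fin.prod_univ_castSucc]
      ring
    rw [hsplit]
    refine (abs_add_le _ _).trans ?_
    rw [abs_mul, abs_of_nonneg (show 0 ≤ κ * (q (Fin.last m))⁻¹ by positivity), add_mul, add_mul]
    refine add_le_add h1 ?_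
    calc _ ≤ κ * (q (Fin.last m)) ^ (-σ) *
          (A * (B * Real.log B ^ (r - 1)) * ∏ i : Fin m, q i.castSucc ^ (-σ)) := by gcongr
      _ = _ := by
        rw [Fin.prod_univ_castSucc]
        ring

end Tower

/-! ### The integrals `tailIntegral` form a tower -/

section TailIntegral

/-- The point with first coordinates `t` and remaining coordinates `u`. -/
def glue {n l j : ℕ} (h : n = l + j) (t : Fin l → ℝ) (u : Fin j → ℝ) (i : Fin n) : ℝ :=
  if hi : (i : ℕ) < l then t ⟨i, hi⟩ else u ⟨(i : ℕ) - l, by omega⟩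

variable {n l j : ℕ} {F : (Fin n → ℝ) → ℝ}

lemma tailIntegral_eq (h : n = l + j) (t : Fin l → ℝ) :
    tailIntegral F l t = ∫ u in {u : Fin j → ℝ | ∀ i, 1 ≤ u i}, F (glue h t u) := by
  obtain rfl : j = n - l := by omega
  rfl

lemma one_le_glue (h : n = l + j) {t : Fin l → ℝ} (ht : ∀ i, 1 ≤ t i) {u : Fin j → ℝ}
    (hu : ∀ i, 1 ≤ u i) (i : Fin n) : 1 ≤ glue h t u i := by
  unfold glue
  split_ifs
  exacts [ht _, hu _]

lemma glue_left (h : n = l + j) (t : Fin l → ℝ) (u : Fin j → ℝ) (i : Fin l) :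
    glue h t u ⟨i, by omega⟩ = t i := by
  simp [glue]

lemma glue_right (h : n = l + j) (t : Fin l → ℝ) (u : Fin j → ℝ) (i : Fin j) :
    glue h t u ⟨l + i, by omega⟩ = u i := by
  simp [glue]

lemma glue_cons (h : n = l + (j + 1)) (t : Fin l → ℝ) (x : ℝ) (u : Fin j → ℝ) :
    glue h t (Fin.cons x u : Fin (j + 1) → ℝ) =
      glue (show n = l + 1 + j by omega) (Fin.snoc t x : Fin (l + 1) → ℝ) u := by
  ext i
  unfold glue
  rcases lt_trichotomy (i : ℕ) l with hi | hi | hi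
  · rw [dif_pos hi, dif_pos (by omega), Fin.snoc, dif_pos (by simpa using hi)]
    rfl
  · rw [dif_neg (by omega), dif_pos (by omega), Fin.snoc, dif_neg (by simp [hi])]
    have : (⟨(i : ℕ) - l, by omega⟩ : Fin (j + 1)) = 0 := Fin.ext (by simp [hi])
    rw [this]
    rfl
  · rw [dif_neg (by omega), dif_neg (by omega)]
    have : (⟨(i : ℕ) - l, by omega⟩ : Fin (j + 1)) =
        Fin.succ ⟨(i : ℕ) - (l + 1), by omega⟩ := Fin.ext (by simp; omega)
    rw [this, Fin.cons_succ]

lemma measurable_glue (h : n = l + j) (t : Fin l → ℝ) : Measurable (glue h t) := by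
  refine measurable_pi_iff.2 fun i ↦ ?_
  unfold glue
  split_ifs
  exacts [measurable_const, measurable_pi_apply _]

lemma measurableSet_one_le (j : ℕ) : MeasurableSet {u : Fin j → ℝ | ∀ i, 1 ≤ u i} := by
  rw [ofPred_forall]
  exact MeasurableSet.iInter fun i ↦ measurableSet_le measurable_const (measurable_pi_apply i)

/-- Boundedness together with vanishing outside a cube; this is the integrability that Fubini
requires. -/
lemma integrableOn_glue (hF : Measurable ({s : Fin n → ℝ | ∀ i, 1 ≤ s i}.indicator F)) {B M : ℝ}
    (hM : ∀ s, (∀ i, 1 ≤ s i) → |F s| ≤ M) (hB : ∀ s, (∀ i, 1 ≤ s i) → (∃ i, B < s i) → F s = 0)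
    (h : n = l + j) {t : Fin l → ℝ} (ht : ∀ i, 1 ≤ t i) :
    IntegrableOn (fun u ↦ F (glue h t u)) {u : Fin j → ℝ | ∀ i, 1 ≤ u i} := by
  have hmeas := hF.comp (measurable_glue h t)
  have heq : ∀ u ∈ {u : Fin j → ℝ | ∀ i, 1 ≤ u i},
      ({s : Fin n → ℝ | ∀ i, 1 ≤ s i}.indicator F ∘ glue h t) u = F (glue h t u) := by
    intro u hu
    rw [Function.comp_apply, indicator_of_mem]
    exact one_le_glue h ht hu
  refine IntegrableOn.congr_fun ?_ heq (measurableSet_one_le j)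
  have hint : Integrable ((Icc (fun _ : Fin j ↦ (1 : ℝ)) fun _ ↦ B).indicator fun _ ↦ M) :=
    (integrable_indicator_iff measurableSet_Icc).2
      (integrableOn_const (isCompact_Icc.measure_lt_top.ne))
  refine hint.integrableOn.mono' hmeas.aestronglyMeasurable.restrict ?_
  refine (ae_restrict_iff' (measurableSet_one_le j)).2 (Filter.Eventually.of_forall fun u hu ↦ ?_)
  rw [heq u hu]
  by_cases hu' : u ∈ Icc (fun _ : Fin j ↦ (1 : ℝ)) fun _ ↦ B
  · rw [indicator_of_mem hu']
    exact hM _ (one_le_glue h ht hu)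
  · rw [indicator_of_notMem hu']
    have : ∃ i, B < u i := by
      by_contra! hcon
      exact hu' ⟨hu, hcon⟩
    obtain ⟨i, hi⟩ := this
    rw [hB _ (one_le_glue h ht hu) ⟨⟨l + i, by omega⟩, by rwa [glue_right]⟩, norm_zero]

lemma setIntegral_fin_succ {G : (Fin (j + 1) → ℝ) → ℝ}
    (hG : IntegrableOn G {u : Fin (j + 1) → ℝ | ∀ i, 1 ≤ u i}) :
    ∫ u in {u : Fin (j + 1) → ℝ | ∀ i, 1 ≤ u i}, G u =
      ∫ x in Ici (1 : ℝ), ∫ u in {u : Fin j → ℝ | ∀ i, 1 ≤ u i}, G (Fin.cons x u) := by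
  set e := MeasurableEquiv.piFinSuccAbove (fun _ : Fin (j + 1) ↦ ℝ) 0 with he
  have hmp : MeasurePreserving e := volume_preserving_piFinSuccAbove (fun _ : Fin (j + 1) ↦ ℝ) 0
  have hpre : {u : Fin (j + 1) → ℝ | ∀ i, 1 ≤ u i} =
      e ⁻¹' (Ici (1 : ℝ) ×ˢ {u : Fin j → ℝ | ∀ i, 1 ≤ u i}) := by
    ext u
    simp [he, Fin.forall_fin_succ, Fin.tail]
  have hsymm : ∀ p : ℝ × (Fin j → ℝ), e.symm p = (Fin.cons p.1 p.2 : Fin (j + 1) → ℝ) := by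
    intro p
    simp [he]
    rfl
  have hG' : IntegrableOn (fun p : ℝ × (Fin j → ℝ) ↦ G (Fin.cons p.1 p.2))
      (Ici (1 : ℝ) ×ˢ {u : Fin j → ℝ | ∀ i, 1 ≤ u i}) (volume.prod volume) := by
    rw [hpre] at hG
    rw [← Measure.volume_eq_prod, ← hmp.integrableOn_comp_preimage e.measurableEmbedding]
    refine hG.congr_fun (fun u _ ↦ ?_) (e.measurable
      (measurableSet_Ici.prod (measurableSet_one_le j)))
    simp only [Function.comp_apply]
    rw [← hsymm, e.symm_apply_apply]
  rw [← setIntegral_prod _ hG', ← Measure.volume_eq_prod, hpre,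
    ← hmp.setIntegral_preimage_emb e.measurableEmbedding]
  refine setIntegral_congr_fun (e.measurable (measurableSet_Ici.prod (measurableSet_one_le j)))
    fun u _ ↦ ?_
  rw [← hsymm, e.symm_apply_apply]

lemma tailIntegral_nonneg (hF : ∀ s, (∀ i, 1 ≤ s i) → 0 ≤ F s) (h : l ≤ n) {t : Fin l → ℝ}
    (ht : ∀ i, 1 ≤ t i) : 0 ≤ tailIntegral F l t := by
  rw [tailIntegral_eq (show n = l + (n - l) by omega)]
  exact setIntegral_nonneg (measurableSet_one_le _) fun u hu ↦ hF _ (one_le_glue _ ht hu)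

lemma tailIntegral_eq_zero {B : ℝ} (hB : ∀ s, (∀ i, 1 ≤ s i) → (∃ i, B < s i) → F s = 0)
    (h : l ≤ n) {t : Fin l → ℝ} (ht : ∀ i, 1 ≤ t i) (hBt : ∃ i, B < t i) :
    tailIntegral F l t = 0 := by
  obtain ⟨i, hi⟩ := hBt
  rw [tailIntegral_eq (show n = l + (n - l) by omega)]
  refine setIntegral_eq_zero_of_forall_eq_zero fun u hu ↦
    hB _ (one_le_glue _ ht hu) ⟨⟨i, by omega⟩, ?_⟩
  rwa [glue_left]

lemma tailIntegral_eq_integral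
    (hF : Measurable ({s : Fin n → ℝ | ∀ i, 1 ≤ s i}.indicator F)) {B M : ℝ}
    (hM : ∀ s, (∀ i, 1 ≤ s i) → |F s| ≤ M) (hB : ∀ s, (∀ i, 1 ≤ s i) → (∃ i, B < s i) → F s = 0)
    (h : l < n) {t : Fin l → ℝ} (ht : ∀ i, 1 ≤ t i) :
    tailIntegral F l t =
      ∫ x in Icc 1 B, tailIntegral F (l + 1) (Fin.snoc t x : Fin (l + 1) → ℝ) := by
  obtain ⟨j, hj⟩ : ∃ j, n = l + (j + 1) := ⟨n - l - 1, by omega⟩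
  rw [tailIntegral_eq hj, setIntegral_fin_succ (integrableOn_glue hF hM hB hj ht)]
  simp_rw [glue_cons, ← tailIntegral_eq (show n = l + 1 + j by omega)]
  refine setIntegral_eq_of_subset_of_forall_sdiff_eq_zero (s := Icc 1 B) (t := Ici 1)
    (f := fun x ↦ tailIntegral F (l + 1) (Fin.snoc t x : Fin (l + 1) → ℝ)) measurableSet_Ici
    Icc_subset_Ici_self fun x hx ↦ ?_
  have hx1 : 1 ≤ x := hx.1
  refine tailIntegral_eq_zero hB (by omega) (one_le_snoc ht hx1) ⟨Fin.last l, ?_⟩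
  simpa using not_le.1 fun hxB ↦ hx.2 ⟨hx1, hxB⟩

lemma tailIntegral_self (t : Fin n → ℝ) : tailIntegral F n t = F t := by
  rw [tailIntegral_eq (show n = n + 0 by omega)]
  have : ∀ u : Fin 0 → ℝ, glue (show n = n + 0 by omega) t u = t := by
    intro u
    ext i
    simp [glue]
  simp_rw [this]
  simp [Measure.real, Measure.volume_pi_eq_dirac (0 : Fin 0 → ℝ)]

end TailIntegral

lemma measurable_indicator_of_subtype {α : Type*} [MeasurableSpace α] {s : Set α}
    (hs : MeasurableSet s) {f : α → ℝ} (hf : Measurable fun x : s ↦ f x) :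
    Measurable (s.indicator f) :=
  measurable_of_restrict_of_restrict_compl hs
    (by
      convert hf using 1
      ext x
      exact indicator_of_mem x.2 f)
    (by
      convert (measurable_const (a := (0 : ℝ))) using 1
      ext x
      exact indicator_of_notMem x.2 f)

theorem tower_tailIntegral {r : ℕ} {V : (Fin (r + 1) → ℝ) → ℝ} {B : ℝ} {R : ℕ} (hB0 : 0 ≤ B)
    (hmeas : Measurable fun t : {t : Fin (r + 1) → ℝ // ∀ i, 1 ≤ t i} ↦ V t)
    (hnonneg : ∀ t, (∀ i, 1 ≤ t i) → 0 ≤ V t)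
    (hsupp : ∀ t, (∀ i, 1 ≤ t i) → (∃ i, B < t i) → V t = 0)
    (hmono : ∀ t : Fin r → ℝ, (∀ i, 1 ≤ t i) →
      PiecewiseMonotoneC1 (fun x ↦ V (Fin.snoc t x)) B R)
    (htail : ∀ l, l < r → ∀ t : Fin l → ℝ, (∀ i, 1 ≤ t i) →
      PiecewiseMonotoneC1 (fun x ↦ tailIntegral V (l + 1) (Fin.snoc t x)) B R)
    {k : Fin (r + 1) → ℝ} {γ c₀ : ℝ} (hγ : 0 ≤ γ) (hc₀ : 0 ≤ c₀)
    (hgrowth : ∀ t, (∀ i, 1 ≤ t i) →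
      V t ≤ c₀ * (B / ∏ i, t i) * Real.exp (-γ * |Real.log B - ∑ i, k i * Real.log (t i)|)) :
    Tower r k γ c₀ R B fun m ↦ tailIntegral V m where
  nonneg m hm t ht := tailIntegral_nonneg hnonneg hm ht
  supp m hm t ht := tailIntegral_eq_zero hsupp hm ht
  step m hm t ht := by
    -- In the growth bound the product of the variables is at least `1` and the exponential at most
    -- `1`.
    refine tailIntegral_eq_integral (M := c₀ * B)
      (measurable_indicator_of_subtype (measurableSet_one_le _) hmeas) (fun s hs ↦ ?_) hsupp
      (by omega) ht
    rw [abs_of_nonneg (hnonneg s hs)]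
    refine (hgrowth s hs).trans ?_
    have hP : 1 ≤ ∏ i, s i := Finset.one_le_prod fun i _ ↦ hs i
    have h1 : Real.exp (-γ * |Real.log B - ∑ i, k i * Real.log (s i)|) ≤ 1 := by
      rw [Real.exp_le_one_iff]
      have : 0 ≤ γ * |Real.log B - ∑ i, k i * Real.log (s i)| := by positivity
      linarith
    calc _ ≤ c₀ * (B / ∏ i, s i) * 1 := by
          have : 0 ≤ B / ∏ i, s i := by positivity
          gcongr
      _ ≤ c₀ * B * 1 := by
          gcongr
          exact div_le_self hB0 hP
      _ = _ := mul_one _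
  mono m hm t ht := by
    rcases hm.lt_or_eq with hlt | rfl
    · exact htail m hlt t ht
    · simp_rw [tailIntegral_self]
      exact hmono t ht
  growth t ht := by
    rw [tailIntegral_self]
    exact hgrowth t ht

/-! ### Möbius inversion on subsets -/

section SubsetMoebius

variable {ι : Type*} [DecidableEq ι]

/-- The Möbius transform of a function on the subsets of a set. -/
def subsetMoebius (g : Finset ι → ℝ) (J : Finset ι) : ℝ :=
  ∑ I ∈ J.powerset, (-1) ^ (J \ I).card * g I

lemma subsetMoebius_insert (g : Finset ι → ℝ) {a : ι} {J : Finset ι} (ha : a ∉ J) :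
    subsetMoebius g (insert a J) =
      subsetMoebius (fun I ↦ g (insert a I)) J - subsetMoebius g J := by
  rw [subsetMoebius, Finset.sum_powerset_insert ha, add_comm, subsetMoebius, subsetMoebius,
    sub_eq_add_neg, ← Finset.sum_neg_distrib]
  congr 1
  · refine Finset.sum_congr rfl fun I hI ↦ ?_
    rw [Finset.insert_sdiff_insert, Finset.sdiff_insert_of_notMem ha]
  · refine Finset.sum_congr rfl fun I hI ↦ ?_
    have haI : a ∉ I := fun h ↦ ha (Finset.mem_powerset.1 hI h)
    rw [Finset.insert_sdiff_of_notMem _ haI, Finset.card_insert_of_notMem (by simp [ha]), pow_succ]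
    ring

lemma sum_powerset_subsetMoebius (g : Finset ι → ℝ) (J : Finset ι) :
    ∑ I ∈ J.powerset, subsetMoebius g I = g J := by
  induction J using Finset.induction_on generalizing g with
  | empty => simp [subsetMoebius]
  | insert a J ha ih =>
    rw [Finset.sum_powerset_insert ha, Finset.sum_congr rfl fun I hI ↦
      subsetMoebius_insert g fun h ↦ ha (Finset.mem_powerset.1 hI h), Finset.sum_sub_distrib,
      add_sub_cancel, ih]

lemma abs_subsetMoebius_le {g : Finset ι → ℝ} (hg : ∀ I, |g I| ≤ 1) (J : Finset ι) :
    |subsetMoebius g J| ≤ 2 ^ J.card := by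
  refine (Finset.abs_sum_le_sum_abs _ _).trans ?_
  calc _ ≤ ∑ I ∈ J.powerset, (1 : ℝ) := by
        refine Finset.sum_le_sum fun I _ ↦ ?_
        rw [abs_mul, abs_pow, abs_neg, abs_one, one_pow, one_mul]
        exact hg I
    _ = _ := by simp

lemma subsetMoebius_empty (g : Finset ι → ℝ) : subsetMoebius g ∅ = g ∅ := by
  simp [subsetMoebius]

/-- For a local factor of `Θ'` both values lie in `[1 - C / N𝔭, 1]`, which makes this coefficient
`O(1 / N𝔭)`. -/
lemma subsetMoebius_singleton (g : Finset ι → ℝ) (i : ι) :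
    subsetMoebius g {i} = g {i} - g ∅ := by
  have := subsetMoebius_insert g (Finset.notMem_empty i)
  simpa [subsetMoebius_empty] using this

end SubsetMoebius

/-! ### Infinite products of factors in `[0, 1]` -/

section Products

variable {P : Type*} {g : P → ℝ}

/-- Finite partial products decrease along inclusion and are bounded below. The limit may be `0`,
which `HasProd` allows. -/
lemma hasProd_iInf (h0 : ∀ p, 0 ≤ g p) (h1 : ∀ p, g p ≤ 1) :
    HasProd g (⨅ s : Finset P, ∏ p ∈ s, g p) := by
  refine tendsto_atTop_ciInf (Finset.prod_anti_set_of_le_one h0 h1) ⟨0, ?_⟩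
  rintro _ ⟨s, rfl⟩
  exact Finset.prod_nonneg fun p _ ↦ h0 p

lemma abs_tprod_le_one (h0 : ∀ p, 0 ≤ g p) (h1 : ∀ p, g p ≤ 1) : |∏' p, g p| ≤ 1 := by
  have h := (hasProd_iInf h0 h1).multipliable.hasProd
  rw [abs_of_nonneg (ge_of_tendsto' h fun s ↦ Finset.prod_nonneg fun p _ ↦ h0 p)]
  exact le_of_tendsto' h fun s ↦ Finset.prod_le_one (fun p _ ↦ h0 p) fun p _ ↦ h1 p

-- The tail is written with factors `1` on `S`, not as a quotient, because the factors and the whole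
-- product may vanish.
open Classical in
lemma tprod_eq_prod_mul_tprod {e : P → ℝ} (h0 : ∀ p, 0 ≤ e p) (h1 : ∀ p, e p ≤ 1)
    {S : Finset P} (hS : ∀ p ∉ S, g p = e p) :
    ∏' p, g p = (∏ p ∈ S, g p) * ∏' p, if p ∈ S then 1 else e p := by
  have hm := (hasProd_iInf (g := fun p ↦ if p ∈ S then 1 else e p)
    (fun p ↦ by split_ifs; exacts [zero_le_one, h0 p])
    (fun p ↦ by split_ifs; exacts [le_rfl, h1 p])).multipliable.hasProd
  have hf : HasProd (fun p ↦ if p ∈ S then g p else 1) (∏ p ∈ S, if p ∈ S then g p else 1) :=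
    hasProd_prod_of_ne_finset_one fun p hp ↦ if_neg hp
  rw [Finset.prod_congr rfl fun p hp ↦ if_pos hp] at hf
  rw [← (hf.mul hm).tprod_eq]
  refine tprod_congr fun p ↦ ?_
  by_cases hp : p ∈ S
  · simp [hp]
  · simp [hp, hS p hp]

end Products

/-! ### Tuples of sets of primes and the index sets at each prime -/

section Indices

variable {P : Type*} [DecidableEq P] {n : ℕ}

/-- The indices `i` with `p ∈ ν i`. -/
def indices (ν : Fin n → Finset P) (p : P) : Finset (Fin n) :=
  Finset.univ.filter fun i ↦ p ∈ ν i

@[simp] lemma mem_indices {ν : Fin n → Finset P} {p : P} {i : Fin n} :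
    i ∈ indices ν p ↔ p ∈ ν i := by
  simp [indices]

/-- Transposing the relation `p ∈ ν i`: a tuple of subsets of `S` is the same as a set of indices
for every `p ∈ S`. This is how a finite Euler product is multiplied out. -/
lemma sum_prod_indices (S : Finset P) (u : P → Finset (Fin n) → ℝ) :
    ∑ ν ∈ Fintype.piFinset (fun _ : Fin n ↦ S.powerset), ∏ p ∈ S, u p (indices ν p) =
      ∏ p ∈ S, ∑ J, u p J := by
  rw [← Finset.prod_coe_sort S, Fintype.prod_sum]
  refine Finset.sum_nbij' (fun ν p ↦ indices ν p.1)
    (fun φ i ↦ (Finset.univ.filter fun p : S ↦ i ∈ φ p).map (Function.Embedding.subtype _))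
    (fun _ _ ↦ Finset.mem_univ _) (fun φ _ ↦ ?_) (fun ν hν ↦ ?_) (fun φ _ ↦ ?_) (fun ν _ ↦ ?_)
  · simp only [Fintype.mem_piFinset, Finset.mem_powerset]
    intro i p hp
    simp only [Finset.mem_map, Function.Embedding.subtype_apply] at hp
    obtain ⟨x, -, rfl⟩ := hp
    exact x.2
  · ext i p
    simp only [Fintype.mem_piFinset, Finset.mem_powerset] at hν
    simp only [Finset.mem_map, Finset.mem_filter, Finset.mem_univ, true_and, mem_indices,
      Function.Embedding.subtype_apply, Subtype.exists, exists_and_left, exists_prop]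
    constructor
    · rintro ⟨a, h, -, rfl⟩; exact h
    · intro h; exact ⟨p, h, hν i h, rfl⟩
  · ext p i
    simp
  · exact (Finset.prod_coe_sort S fun p ↦ u p (indices ν p)).symm

lemma prod_prod_eq_prod_pow {S : Finset P} {ν : Fin n → Finset P} (hν : ∀ i, ν i ⊆ S)
    (x : P → ℝ) : ∏ i, ∏ p ∈ ν i, x p = ∏ p ∈ S, x p ^ (indices ν p).card := by
  have : ∀ i, ∏ p ∈ ν i, x p = ∏ p ∈ S, if p ∈ ν i then x p else 1 := by
    intro i
    rw [← Finset.prod_filter, Finset.filter_mem_eq_inter, Finset.inter_eq_right.2 (hν i)]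
  simp_rw [this]
  rw [Finset.prod_comm]
  refine Finset.prod_congr rfl fun p _ ↦ ?_
  rw [← Finset.prod_filter, Finset.prod_const, indices]

end Indices

/-! ### Norms, squarefree ideals and convergent norm sums -/

variable {K : Type*} [Field K] [NumberField K]

lemma coe_ne_zero (a : NzIdeal K) : (a : Ideal (𝓞 K)) ≠ 0 := nonZeroDivisors.coe_ne_zero a

lemma dvd_iff_coe_dvd {a b : NzIdeal K} : a ∣ b ↔ (a : Ideal (𝓞 K)) ∣ b := by
  refine ⟨fun ⟨c, hc⟩ ↦ ⟨c, by rw [hc]; rfl⟩, fun ⟨c, hc⟩ ↦ ?_⟩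
  have hc0 : c ≠ 0 := by
    rintro rfl
    exact coe_ne_zero b (by simpa using hc)
  exact ⟨⟨c, mem_nonZeroDivisors_iff_ne_zero.2 hc0⟩, Subtype.ext hc⟩

lemma idealNorm_mul (a b : NzIdeal K) : idealNorm (a * b) = idealNorm a * idealNorm b := by
  simp [idealNorm]

lemma idealNorm_one : idealNorm (1 : NzIdeal K) = 1 := by
  simp [idealNorm]

lemma idealNorm_prod {ι : Type*} (s : Finset ι) (f : ι → NzIdeal K) :
    idealNorm (∏ i ∈ s, f i) = ∏ i ∈ s, idealNorm (f i) :=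
  map_prod (⟨⟨idealNorm, idealNorm_one⟩, idealNorm_mul⟩ : NzIdeal K →* ℝ) f s

/-- A nonzero prime ideal as an element of the monoid of nonzero ideals. -/
def primeIdeal (p : HeightOneSpectrum (𝓞 K)) : NzIdeal K :=
  ⟨p.asIdeal, mem_nonZeroDivisors_iff_ne_zero.2 p.ne_bot⟩

lemma primeIdeal_injective : Function.Injective (primeIdeal (K := K)) := fun _ _ h ↦
  HeightOneSpectrum.ext (congrArg Subtype.val h)

/-- The product of a finite set of prime ideals. -/
def prodPrimes (s : Finset (HeightOneSpectrum (𝓞 K))) : NzIdeal K :=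
  ∏ p ∈ s, primeIdeal p

/-- The prime divisors of a nonzero ideal. -/
def primeDivisors (a : NzIdeal K) : Finset (HeightOneSpectrum (𝓞 K)) :=
  (Ideal.finite_factors (coe_ne_zero a)).toFinset

@[simp] lemma mem_primeDivisors {a : NzIdeal K} {p : HeightOneSpectrum (𝓞 K)} :
    p ∈ primeDivisors a ↔ p.asIdeal ∣ (a : Ideal (𝓞 K)) := by
  simp [primeDivisors]

lemma prodPrimes_dvd_iff {s : Finset (HeightOneSpectrum (𝓞 K))} {a : NzIdeal K} :
    prodPrimes s ∣ a ↔ s ⊆ primeDivisors a := by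
  have hcoe : ((prodPrimes s : NzIdeal K) : Ideal (𝓞 K)) = ∏ p ∈ s, p.asIdeal := by
    rw [prodPrimes, Submonoid.coe_finsetProd]
    rfl
  rw [dvd_iff_coe_dvd, hcoe]
  refine ⟨fun h p hp ↦ mem_primeDivisors.2 ((Finset.dvd_prod_of_mem _ hp).trans h), fun h ↦ ?_⟩
  classical
  have := Finset.prod_primes_dvd (s := s.image HeightOneSpectrum.asIdeal) (a : Ideal (𝓞 K))
    (by
      intro q hq
      obtain ⟨p, -, rfl⟩ := Finset.mem_image.1 hq
      exact p.prime)
    (by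
      intro q hq
      obtain ⟨p, hp, rfl⟩ := Finset.mem_image.1 hq
      exact mem_primeDivisors.1 (h hp))
  rwa [Finset.prod_image fun p _ q _ h ↦ HeightOneSpectrum.ext h] at this

lemma exists_sum_idealNorm_rpow_le {κ C σ : ℝ} (hcount : CountingBound K κ C σ) (hC : 0 ≤ C)
    (hσ : σ ≤ 1) {s : ℝ} (hs : 1 < s) :
    ∃ A : ℝ, 0 ≤ A ∧ ∀ F : Finset (NzIdeal K), ∑ b ∈ F, idealNorm b ^ (-s) ≤ A := by
  obtain ⟨A, hA, hcard⟩ := hcount.exists_card_le hC hσ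
  have hint : ∀ B : ℝ, IntegrableOn (fun t : ℝ ↦ t ^ (-s)) (Icc 1 B) := fun B ↦
    (ContinuousOn.rpow_const continuousOn_id fun t ht ↦
      Or.inl (one_pos.trans_le ht.1).ne').integrableOn_compact isCompact_Icc
  have hs1 : 0 < s - 1 := by linarith
  refine ⟨2 * 2 ^ s * A * (1 / (s - 1)), by positivity, fun F ↦ ?_⟩
  obtain ⟨B, hB1, hB⟩ : ∃ B : ℝ, 1 ≤ B ∧ ∀ b ∈ F, idealNorm b ≤ B := by
    refine ⟨1 + ∑ b ∈ F, idealNorm b, ?_, fun b hb ↦ ?_⟩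
    · linarith [Finset.sum_nonneg fun b (_ : b ∈ F) ↦ (idealNorm_pos b).le]
    · linarith [Finset.single_le_sum (fun b _ ↦ (idealNorm_pos b).le) hb]
  refine (Finset.sum_le_sum_of_subset_of_nonneg (t := idealsLE K B)
    (fun b hb ↦ mem_idealsLE.2 (hB b hb))
    fun b _ _ ↦ Real.rpow_nonneg (idealNorm_pos b).le _).trans ?_
  refine (sum_idealsLE_le_integral hcard (f := fun t ↦ t ^ (-s)) (B := B) (D := 2 ^ s)
    (fun x hx ↦ by positivity) (fun x t hx hxt htx ↦ ?_) (by positivity) (hint _)).trans ?_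
  · have hx0 : 0 < x := by linarith
    have ht0 : 0 < t := by linarith
    rw [Real.rpow_neg hx0.le, Real.rpow_neg ht0.le, ← div_eq_mul_inv, inv_eq_one_div,
      div_le_div_iff₀ (by positivity) (by positivity), one_mul,
      ← Real.mul_rpow zero_le_two hx0.le]
    exact Real.rpow_le_rpow ht0.le htx (by linarith)
  · gcongr
    rw [integral_Icc_eq_integral_Ioc, ← intervalIntegral.integral_of_le (by linarith),
      integral_rpow (Or.inr ⟨by linarith, by
        rw [uIcc_of_le (by linarith)]; exact fun h ↦ absurd h.1 (by norm_num)⟩),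
      Real.one_rpow, show -s + 1 = -(s - 1) by ring, div_neg, neg_div', neg_sub]
    gcongr
    have : (0 : ℝ) ≤ (2 * B) ^ (-(s - 1)) := by positivity
    linarith

/-! ### Expanding `θ` into divisibility conditions -/

section Expansion

-- Insert `f p J = ∑_{I ⊆ J} h p I` at every prime dividing some `a i` and multiply out. The
-- untouched factors `f p ∅ = h p ∅` go into `c ν`, which thus does not depend on `a`, and only
-- finitely many `ν` contribute for a given `a`.
open Classical in
lemma exists_expansion {n : ℕ} {C : ℝ} {θ : (Fin n → NzIdeal K) → ℝ}
    (hθ : θ ∈ ThetaPrime K n C) :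
    ∃ (h : HeightOneSpectrum (𝓞 K) → Finset (Fin n) → ℝ)
      (c : (Fin n → Finset (HeightOneSpectrum (𝓞 K))) → ℝ),
      (∀ p, |h p ∅| ≤ 1) ∧
      (∀ p i, 0 ≤ C → |h p {i}| ≤ C / idealNorm (primeIdeal p)) ∧
      (∀ p J, |h p J| ≤ 2 ^ n) ∧
      (∀ ν S, (∀ i, ν i ⊆ S) → |c ν| ≤ ∏ p ∈ S, |h p (indices ν p)|) ∧
      ∀ a, HasSum (fun ν ↦ if ∀ i, prodPrimes (ν i) ∣ a i then c ν else 0) (θ a) := by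
  obtain ⟨f, hf01, hf0, hf1, hf⟩ := hθ
  have habs : ∀ p I, |f p I| ≤ 1 := fun p I ↦ by
    rw [abs_of_nonneg (hf01 p I).1]; exact (hf01 p I).2
  set h := fun p ↦ subsetMoebius (f p) with hh
  have hempty : ∀ p, h p ∅ = f p ∅ := fun p ↦ subsetMoebius_empty _
  -- The product of the factors outside `S`; it lies in `[0, 1]` and so costs nothing in the bound
  -- for `c ν`.
  set E : Finset (HeightOneSpectrum (𝓞 K)) → ℝ := fun S ↦ ∏' p, if p ∈ S then 1 else f p ∅ with hE
  have hE1 : ∀ S, |E S| ≤ 1 := fun S ↦ abs_tprod_le_one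
    (fun p ↦ by split_ifs; exacts [zero_le_one, (hf01 p ∅).1])
    (fun p ↦ by split_ifs; exacts [le_rfl, (hf01 p ∅).2])
  have hc : ∀ ν S, (∀ i, ν i ⊆ S) →
      ∏' p, h p (indices ν p) = (∏ p ∈ S, h p (indices ν p)) * E S := by
    intro ν S hν
    refine tprod_eq_prod_mul_tprod (fun p ↦ (hf01 p ∅).1) (fun p ↦ (hf01 p ∅).2) fun p hp ↦ ?_
    rw [← hempty]
    congr
    ext i
    simp only [mem_indices, Finset.notMem_empty, iff_false]
    exact fun hi ↦ hp (hν i hi)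
  refine ⟨h, fun ν ↦ ∏' p, h p (indices ν p), fun p ↦ ?_, fun p i hC ↦ ?_, fun p J ↦ ?_,
    fun ν S hν ↦ ?_, fun a ↦ ?_⟩
  · rw [hempty]; exact habs _ _
  · have hN := one_le_idealNorm (primeIdeal p)
    have hN0 := idealNorm_pos (primeIdeal p)
    have e : (Ideal.absNorm p.asIdeal : ℝ) = idealNorm (primeIdeal p) := rfl
    have h1 := hf1 p {i} (Finset.card_singleton i)
    have h2 := hf0 p
    rw [e] at h1 h2
    have h3 : C / idealNorm (primeIdeal p) ^ 2 ≤ C / idealNorm (primeIdeal p) := by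
      gcongr
      exact le_self_pow₀ hN two_ne_zero
    simp only [hh, subsetMoebius_singleton]
    rw [abs_le]
    constructor <;> linarith [(hf01 p {i}).2, (hf01 p ∅).2]
  · refine (abs_subsetMoebius_le (habs p) J).trans (pow_le_pow_right₀ one_le_two ?_)
    simpa using Finset.card_le_univ J
  · dsimp only
    rw [hc ν S hν, abs_mul, Finset.abs_prod]
    exact mul_le_of_le_one_right (Finset.prod_nonneg fun p _ ↦ abs_nonneg _) (hE1 S)
  · set T := Finset.univ.biUnion fun i ↦ primeDivisors (a i) with hT
    have hsub : ∀ i, primeDivisors (a i) ⊆ T := fun i ↦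
      Finset.subset_biUnion_of_mem (fun i ↦ primeDivisors (a i)) (Finset.mem_univ i)
    have hmem : ∀ p i, i ∈ divIndices p (a) ↔ p ∈ primeDivisors (a i) := by
      intro p i
      simp [divIndices]
    have hθ : θ a = ∑ ν ∈ Fintype.piFinset (fun _ : Fin n ↦ T.powerset),
        if ∀ i, prodPrimes (ν i) ∣ a i then ∏' p, h p (indices ν p) else 0 := by
      rw [hf, tprod_eq_prod_mul_tprod (S := T) (e := fun p ↦ f p ∅) (fun p ↦ (hf01 p ∅).1)
        (fun p ↦ (hf01 p ∅).2)]
      · have h1 : ∀ p ∈ T, f p (divIndices p a) =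
            ∑ J, if J ⊆ divIndices p a then h p J else 0 := by
          intro p _
          rw [← sum_powerset_subsetMoebius (f p) (divIndices p a), ← Finset.sum_filter]
          congr 1
          ext J
          simp
        rw [Finset.prod_congr rfl h1,
          ← sum_prod_indices T fun p J ↦ if J ⊆ divIndices p a then h p J else 0, Finset.sum_mul]
        refine Finset.sum_congr rfl fun ν hν ↦ ?_
        simp only [Fintype.mem_piFinset, Finset.mem_powerset] at hν
        rw [Finset.prod_ite_zero]
        have hiff : (∀ p ∈ T, indices ν p ⊆ divIndices p a) ↔
            ∀ i, prodPrimes (ν i) ∣ a i := by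
          simp_rw [prodPrimes_dvd_iff]
          constructor
          · intro H i p hp
            exact (hmem p i).1 (H p (hν i hp) (mem_indices.2 hp))
          · intro H p _ i hi
            exact (hmem p i).2 (H i (mem_indices.1 hi))
        simp_rw [hiff]
        split_ifs
        · exact (hc ν T hν).symm
        · rw [zero_mul]
      · intro p hp
        congr
        ext i
        rw [hmem]
        simp only [Finset.notMem_empty, iff_false]
        exact fun hi ↦ hp (hsub i hi)
    rw [hθ]
    refine hasSum_sum_of_ne_finset_zero fun ν hν ↦ if_neg fun H ↦ hν ?_
    simp only [Fintype.mem_piFinset, Finset.mem_powerset]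
    exact fun i ↦ (prodPrimes_dvd_iff.1 (H i)).trans (hsub i)

/-- Each Euler factor is `1 + O(N𝔭 ^ (-2σ))`: a singleton contributes `N𝔭⁻¹ N𝔭 ^ (-σ)` with `σ ≤ 1`,
and larger index sets carry at least two factors `N𝔭 ^ (-σ)`. -/
lemma sum_prod_le_of_expansion {n : ℕ} {C σ A : ℝ} (hC : 0 ≤ C) (hσ1 : σ ≤ 1) (hσ0 : 0 ≤ σ)
    (hA : ∀ F : Finset (NzIdeal K), ∑ b ∈ F, idealNorm b ^ (-(2 * σ)) ≤ A)
    {h : HeightOneSpectrum (𝓞 K) → Finset (Fin n) → ℝ}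
    (h0 : ∀ p, |h p ∅| ≤ 1)
    (h1 : ∀ p i, |h p {i}| ≤ C / idealNorm (primeIdeal p))
    (h2 : ∀ p J, |h p J| ≤ 2 ^ n) (S : Finset (HeightOneSpectrum (𝓞 K))) :
    ∏ p ∈ S, ∑ J, |h p J| * (idealNorm (primeIdeal p) ^ (-σ)) ^ J.card ≤
      Real.exp (2 ^ n * (C + 2 ^ n) * A) := by
  classical
  set x : HeightOneSpectrum (𝓞 K) → ℝ := fun p ↦ idealNorm (primeIdeal p) with hx
  have hx1 : ∀ p, 1 ≤ x p := fun p ↦ one_le_idealNorm _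
  have hx0 : ∀ p, 0 < x p := fun p ↦ idealNorm_pos _
  have hterm : ∀ p, ∑ J, |h p J| * (x p ^ (-σ)) ^ J.card ≤
      Real.exp (2 ^ n * (C + 2 ^ n) * x p ^ (-(2 * σ))) := by
    intro p
    have hy0 : 0 < x p ^ (-σ) := Real.rpow_pos_of_pos (hx0 p) _
    have hy1 : x p ^ (-σ) ≤ 1 := Real.rpow_le_one_of_one_le_of_nonpos (hx1 p) (by linarith)
    have hysq : (x p ^ (-σ)) ^ 2 = x p ^ (-(2 * σ)) := by
      rw [← Real.rpow_natCast, ← Real.rpow_mul (hx0 p).le]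
      congr 1
      push_cast
      ring
    have hJ : ∀ J ∈ Finset.univ.erase (∅ : Finset (Fin n)),
        |h p J| * (x p ^ (-σ)) ^ J.card ≤ (C + 2 ^ n) * x p ^ (-(2 * σ)) := by
      intro J hJ
      have hJ' : J.Nonempty := Finset.nonempty_iff_ne_empty.2 (Finset.ne_of_mem_erase hJ)
      rcases (Nat.one_le_iff_ne_zero.2 hJ'.card_pos.ne').eq_or_lt with hcard | hcard
      · obtain ⟨i, rfl⟩ := Finset.card_eq_one.1 hcard.symm
        have h3 : (x p)⁻¹ ≤ x p ^ (-σ) := by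
          rw [← Real.rpow_neg_one]
          exact Real.rpow_le_rpow_of_exponent_le (hx1 p) (by linarith)
        rw [Finset.card_singleton, pow_one, ← hysq]
        have := hx0 p
        calc _ ≤ C * (x p)⁻¹ * x p ^ (-σ) := by
              gcongr
              rw [← div_eq_mul_inv]
              exact h1 p i
          _ ≤ (C + 2 ^ n) * x p ^ (-σ) * x p ^ (-σ) := by
              gcongr
              linarith [show (0 : ℝ) ≤ 2 ^ n by positivity]
          _ = _ := by ring
      · rw [← hysq]
        refine mul_le_mul ((h2 p J).trans (by linarith)) (pow_le_pow_of_le_one hy0.le hy1 hcard)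
          (by positivity) (by positivity)
    rw [← Finset.add_sum_erase _ _ (Finset.mem_univ ∅)]
    have hsum := Finset.sum_le_card_nsmul _ _ _ hJ
    have hcard : ((Finset.univ.erase (∅ : Finset (Fin n))).card : ℝ) ≤ 2 ^ n := by
      have := Finset.card_le_univ (Finset.univ.erase (∅ : Finset (Fin n)))
      rw [Fintype.card_finset, Fintype.card_fin] at this
      exact_mod_cast this
    have hz : 0 ≤ (C + 2 ^ n) * x p ^ (-(2 * σ)) := by
      have := hx0 p
      positivity
    rw [nsmul_eq_mul] at hsum
    have h4 := mul_le_mul_of_nonneg_right hcard hz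
    have h5 := h0 p
    rw [Finset.card_empty, pow_zero, mul_one]
    have h6 := Real.add_one_le_exp (2 ^ n * (C + 2 ^ n) * x p ^ (-(2 * σ)))
    rw [mul_assoc] at h6 ⊢
    linarith
  calc _ ≤ ∏ p ∈ S, Real.exp (2 ^ n * (C + 2 ^ n) * x p ^ (-(2 * σ))) := by
        refine Finset.prod_le_prod (fun p _ ↦ Finset.sum_nonneg fun J _ ↦ ?_) fun p _ ↦ hterm p
        have := Real.rpow_pos_of_pos (hx0 p) (-σ)
        positivity
    _ = Real.exp (2 ^ n * (C + 2 ^ n) * ∑ p ∈ S, x p ^ (-(2 * σ))) := by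
        rw [← Real.exp_sum, Finset.mul_sum]
    _ ≤ _ := by
        gcongr
        have := hA (S.map ⟨primeIdeal, primeIdeal_injective⟩)
        rwa [Finset.sum_map] at this

-- The bound `M` is chosen before `θ`; this is what makes the final implied constant independent of
-- `θ`.
open Classical in
theorem exists_expansion_summable {κ C₀ σ : ℝ} (hcount : CountingBound K κ C₀ σ) (hC₀ : 0 ≤ C₀)
    (hσ0 : 1 / 2 < σ) (hσ1 : σ ≤ 1) (n : ℕ) {C : ℝ} (hC : 0 ≤ C) :
    ∃ M : ℝ, ∀ θ ∈ ThetaPrime K n C, ∃ c : (Fin n → Finset (HeightOneSpectrum (𝓞 K))) → ℝ,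
      (∀ a, HasSum (fun ν ↦ if ∀ i, prodPrimes (ν i) ∣ a i then c ν else 0) (θ a)) ∧
      ∀ F : Finset (Fin n → Finset (HeightOneSpectrum (𝓞 K))),
        ∑ ν ∈ F, |c ν| * ∏ i, idealNorm (prodPrimes (ν i)) ^ (-σ) ≤ M := by
  obtain ⟨A, -, hA⟩ := exists_sum_idealNorm_rpow_le hcount hC₀ hσ1 (show 1 < 2 * σ by linarith)
  refine ⟨Real.exp (2 ^ n * (C + 2 ^ n) * A), fun θ hθ ↦ ?_⟩
  obtain ⟨h, c, h0, h1, h2, hc, hsum⟩ := exists_expansion hθ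
  refine ⟨c, hsum, fun F ↦ ?_⟩
  -- Enlarging `F` to all tuples of subsets of `S` restores a finite Euler product.
  set S := F.biUnion fun ν ↦ Finset.univ.biUnion ν with hS
  have hsub : ∀ ν ∈ F, ∀ i, ν i ⊆ S := fun ν hν i ↦
    (Finset.subset_biUnion_of_mem ν (Finset.mem_univ i)).trans
      (Finset.subset_biUnion_of_mem (fun ν ↦ Finset.univ.biUnion ν) hν)
  have hterm : ∀ ν, (∀ i, ν i ⊆ S) → |c ν| * ∏ i, idealNorm (prodPrimes (ν i)) ^ (-σ) ≤
      ∏ p ∈ S, |h p (indices ν p)| * (idealNorm (primeIdeal p) ^ (-σ)) ^ (indices ν p).card := by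
    intro ν hν
    have e : ∏ i, idealNorm (prodPrimes (ν i)) ^ (-σ) =
        ∏ p ∈ S, (idealNorm (primeIdeal p) ^ (-σ)) ^ (indices ν p).card := by
      rw [← prod_prod_eq_prod_pow hν]
      refine Finset.prod_congr rfl fun i _ ↦ ?_
      rw [prodPrimes, idealNorm_prod, Real.finsetProd_rpow _ _ fun p _ ↦ (idealNorm_pos _).le]
    rw [e, Finset.prod_mul_distrib]
    refine mul_le_mul_of_nonneg_right (hc ν S hν) (Finset.prod_nonneg fun p _ ↦ ?_)
    have := idealNorm_pos (primeIdeal p)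
    positivity
  calc _ ≤ ∑ ν ∈ Fintype.piFinset (fun _ : Fin n ↦ S.powerset), ∏ p ∈ S,
        |h p (indices ν p)| * (idealNorm (primeIdeal p) ^ (-σ)) ^ (indices ν p).card := by
        refine (Finset.sum_le_sum fun ν hν ↦ hterm ν (hsub ν hν)).trans
          (Finset.sum_le_sum_of_subset_of_nonneg (fun ν hν ↦ ?_) fun ν _ _ ↦ ?_)
        · simp only [Fintype.mem_piFinset, Finset.mem_powerset]
          exact hsub ν hν
        · refine Finset.prod_nonneg fun p _ ↦ ?_
          have := idealNorm_pos (primeIdeal p)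
          positivity
    _ = ∏ p ∈ S, ∑ J, |h p J| * (idealNorm (primeIdeal p) ^ (-σ)) ^ J.card :=
        sum_prod_indices S fun p J ↦ |h p J| * (idealNorm (primeIdeal p) ^ (-σ)) ^ J.card
    _ ≤ _ := sum_prod_le_of_expansion hC hσ1 (by linarith) hA h0 (fun p i ↦ h1 p i hC) h2 S

end Expansion

variable {K : Type*} [Field K] [NumberField K]

/-! ### The Möbius function on squarefree ideals and convolution -/

section Moebius

lemma nzIdeal_mul_left_cancel {a b c : NzIdeal K} (h : a * b = a * c) : b = c :=
  Subtype.ext (mul_left_cancel₀ (coe_ne_zero a) (congrArg Subtype.val h))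

lemma isUnit_coe_iff {a : NzIdeal K} : IsUnit (a : Ideal (𝓞 K)) ↔ a = 1 := by
  rw [Ideal.isUnit_iff, ← Ideal.one_eq_top]
  exact Subtype.coe_inj (b := (1 : NzIdeal K))

lemma normalizedFactors_prodPrimes (s : Finset (HeightOneSpectrum (𝓞 K))) :
    UniqueFactorizationMonoid.normalizedFactors ((prodPrimes s : NzIdeal K) : Ideal (𝓞 K)) =
      s.val.map HeightOneSpectrum.asIdeal := by
  have hcoe : ((prodPrimes s : NzIdeal K) : Ideal (𝓞 K)) =
      (s.val.map HeightOneSpectrum.asIdeal).prod := by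
    rw [prodPrimes, Submonoid.coe_finsetProd]
    rfl
  rw [hcoe]
  refine UniqueFactorizationMonoid.normalizedFactors_prod_of_prime fun q hq ↦ ?_
  obtain ⟨p, -, rfl⟩ := Multiset.mem_map.1 hq
  exact p.prime

lemma prodPrimes_injective : Function.Injective (prodPrimes (K := K)) := by
  intro s t h
  have := normalizedFactors_prodPrimes s
  rw [h, normalizedFactors_prodPrimes] at this
  exact Finset.val_injective (Multiset.map_injective (fun _ _ ↦ HeightOneSpectrum.ext) this).symm

lemma moebius_prodPrimes (s : Finset (HeightOneSpectrum (𝓞 K))) :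
    moebius (prodPrimes s) = (-1) ^ s.card := by
  classical
  rw [moebius, if_pos, normalizedFactors_prodPrimes, Multiset.card_map, Finset.card_def]
  rw [UniqueFactorizationMonoid.squarefree_iff_nodup_normalizedFactors (coe_ne_zero _),
    normalizedFactors_prodPrimes]
  exact s.nodup.map (fun _ _ ↦ HeightOneSpectrum.ext)

lemma eq_prodPrimes_of_moebius_ne_zero {a : NzIdeal K} (ha : moebius a ≠ 0) :
    a = prodPrimes (primeDivisors a) := by
  classical
  have hsq : Squarefree (a : Ideal (𝓞 K)) := by
    by_contra h
    exact ha (if_neg h)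
  obtain ⟨e, he⟩ := prodPrimes_dvd_iff.2 (Finset.Subset.refl (primeDivisors a))
  by_cases h1 : IsUnit (e : Ideal (𝓞 K))
  · rwa [isUnit_coe_iff.1 h1, mul_one] at he
  · obtain ⟨q, hq, hqe⟩ := WfDvdMonoid.exists_irreducible_factor h1 (coe_ne_zero e)
    have hqp : Prime q := hq.prime
    obtain ⟨p, rfl⟩ : ∃ p : HeightOneSpectrum (𝓞 K), p.asIdeal = q :=
      ⟨⟨q, Ideal.isPrime_of_prime hqp, hqp.ne_zero⟩, rfl⟩
    have hae : (e : Ideal (𝓞 K)) ∣ a := dvd_iff_coe_dvd.1 ⟨prodPrimes (primeDivisors a), by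
      rw [mul_comm]; exact he⟩
    have hp : p ∈ primeDivisors a := mem_primeDivisors.2 (hqe.trans hae)
    have hp1 := mem_primeDivisors.1 (prodPrimes_dvd_iff.1 dvd_rfl hp)
    have e' : (a : Ideal (𝓞 K)) =
        ((prodPrimes (primeDivisors a) : NzIdeal K) : Ideal (𝓞 K)) * e :=
      (congrArg Subtype.val he).trans (Submonoid.coe_mul _ _ _)
    have : p.asIdeal * p.asIdeal ∣ (a : Ideal (𝓞 K)) := (mul_dvd_mul hp1 hqe).trans (dvd_of_eq e'.symm)
    exact absurd (hsq _ this) hqp.not_isUnit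

lemma primeDivisors_eq_empty_iff {a : NzIdeal K} : primeDivisors a = ∅ ↔ a = 1 := by
  constructor
  · intro h
    by_contra ha
    have h1 : ¬ IsUnit (a : Ideal (𝓞 K)) := fun hu ↦ ha (isUnit_coe_iff.1 hu)
    obtain ⟨q, hq, hqa⟩ := WfDvdMonoid.exists_irreducible_factor h1 (coe_ne_zero a)
    have hqp : Prime q := hq.prime
    have : (⟨q, Ideal.isPrime_of_prime hqp, hqp.ne_zero⟩ : HeightOneSpectrum (𝓞 K)) ∈
      primeDivisors a := mem_primeDivisors.2 hqa
    rw [h] at this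
    exact absurd this (Finset.notMem_empty _)
  · rintro rfl
    ext p
    simp only [mem_primeDivisors, Finset.notMem_empty, iff_false]
    exact fun h ↦ p.prime.not_isUnit (isUnit_of_dvd_one h)

lemma finite_mul_eq (a : NzIdeal K) : {p : NzIdeal K × NzIdeal K | p.1 * p.2 = a}.Finite := by
  refine ((idealsLE K (idealNorm a)) ×ˢ (idealsLE K (idealNorm a))).finite_toSet.subset ?_
  rintro ⟨b, c⟩ (rfl : b * c = a)
  rw [Finset.coe_product, mem_prod, Finset.mem_coe, Finset.mem_coe, mem_idealsLE, mem_idealsLE,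
    idealNorm_mul]
  exact ⟨le_mul_of_one_le_right (idealNorm_pos b).le (one_le_idealNorm c),
    le_mul_of_one_le_left (idealNorm_pos c).le (one_le_idealNorm b)⟩

lemma conv_eq_sum (f g : NzIdeal K → ℝ) (a : NzIdeal K) :
    conv f g a = ∑ p ∈ (finite_mul_eq a).toFinset, f p.1 * g p.2 :=
  finsum_mem_eq_finite_toFinset_sum _ _

-- The indicator of the multiples of `x` is a point mass at `x` convolved with the constant `1`, and
-- convolution with the Möbius function undoes the latter.
open Classical in
lemma conv_dvd_moebius (c : ℝ) (x a : NzIdeal K) :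
    conv (fun b ↦ if x ∣ b then c else 0) moebius a = if x = a then c else 0 := by
  rw [conv_eq_sum]
  by_cases hxa : x ∣ a
  · obtain ⟨y, rfl⟩ := hxa
    have key : ∑ s ∈ (primeDivisors y).powerset, c * (-1) ^ s.card =
        ∑ p ∈ (finite_mul_eq (x * y)).toFinset, (if x ∣ p.1 then c else 0) * moebius p.2 := by
      -- The nonzero terms have a squarefree second factor dividing `y`, hence come from sets of
      -- prime divisors of `y`. The value `1` in the `else` branch is a default never reached on
      -- these sets.
      refine Finset.sum_of_injOn
        (fun s ↦ (if h : prodPrimes s ∣ y then x * h.choose else 1, prodPrimes s))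
        (fun s _ t _ h ↦ prodPrimes_injective (congrArg Prod.snd h)) (fun s hs ↦ ?_)
        (fun p hp hps ↦ ?_) (fun s hs ↦ ?_)
      · have h := prodPrimes_dvd_iff.2 (Finset.mem_powerset.1 hs)
        have h' := h.choose_spec
        simp only [Finite.coe_toFinset, mem_ofPred_eq, dif_pos h]
        conv_rhs => rw [h']
        rw [mul_assoc, mul_comm h.choose]
      · have hp' : p.1 * p.2 = x * y := by simpa using hp
        by_contra hne
        have hx : x ∣ p.1 := by
          by_contra hx
          exact hne (by rw [if_neg hx, zero_mul])
        have hmu : moebius p.2 ≠ 0 := fun h0 ↦ hne (by rw [h0, mul_zero])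
        have hp2 := eq_prodPrimes_of_moebius_ne_zero hmu
        obtain ⟨z, hz⟩ := hx
        have hy : y = prodPrimes (primeDivisors p.2) * z := by
          rw [← hp2, mul_comm]
          refine nzIdeal_mul_left_cancel (a := x) ?_
          rw [← hp', hz, mul_assoc]
        have hdvd : prodPrimes (primeDivisors p.2) ∣ y := ⟨z, hy⟩
        refine hps ⟨primeDivisors p.2, Finset.mem_coe.2 (Finset.mem_powerset.2
          (prodPrimes_dvd_iff.1 hdvd)), ?_⟩
        have hzz : hdvd.choose = z :=
          nzIdeal_mul_left_cancel (hdvd.choose_spec.symm.trans hy)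
        simp only [dif_pos hdvd, hzz]
        exact Prod.ext hz.symm hp2.symm
      · have h := prodPrimes_dvd_iff.2 (Finset.mem_powerset.1 hs)
        simp only [dif_pos h, moebius_prodPrimes]
        rw [if_pos (dvd_mul_right _ _)]
    rw [← key, ← Finset.mul_sum]
    have h0 := Finset.sum_powerset_neg_one_pow_card (x := primeDivisors y)
    have h1 : ∑ s ∈ (primeDivisors y).powerset, (-1 : ℝ) ^ s.card =
        if primeDivisors y = ∅ then 1 else 0 := by exact_mod_cast congrArg (Int.cast (R := ℝ)) h0
    rw [h1]
    have hiff : primeDivisors y = ∅ ↔ x = x * y := by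
      rw [primeDivisors_eq_empty_iff]
      constructor
      · rintro rfl; rw [mul_one]
      · intro h
        exact (nzIdeal_mul_left_cancel (a := x) (by rw [mul_one]; exact h)).symm
    simp_rw [hiff]
    split_ifs <;> simp
  · rw [if_neg (fun h : x = a ↦ hxa (dvd_of_eq h))]
    refine Finset.sum_eq_zero fun p hp ↦ ?_
    have hp' : p.1 * p.2 = a := by simpa using hp
    rw [if_neg (fun h ↦ hxa (h.trans ⟨p.2, hp'.symm⟩)), zero_mul]

end Moebius

/-! ### Averages computed from the expansion -/

section Average

-- The average of the indicator of the multiples of `x` is `1 / idealNorm x`. Absolute convergence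
-- permits grouping the terms by the value of `x i`.
open Classical in
lemma average_eq_tsum {ι : Type*} {f : NzIdeal K → ℝ} {c : ι → ℝ} {x : ι → NzIdeal K}
    (hf : ∀ b, HasSum (fun i ↦ if x i ∣ b then c i else 0) (f b))
    (hc : Summable fun i ↦ c i / idealNorm (x i)) :
    average f = ∑' i, c i / idealNorm (x i) := by
  have hconv : ∀ a, HasSum (fun i ↦ if x i = a then c i else 0) (conv f moebius a) := by
    intro a
    simp_rw [← conv_dvd_moebius, conv_eq_sum]
    exact hasSum_sum fun p _ ↦ (hf p.1).mul_right _
  have hsig := (Equiv.sigmaFiberEquiv x).hasSum_iff.2 hc.hasSum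
  have hfib : ∀ a, HasSum (fun i : {i // x i = a} ↦
      ((fun i ↦ c i / idealNorm (x i)) ∘ Equiv.sigmaFiberEquiv x) ⟨a, i⟩)
      (conv f moebius a / idealNorm a) := by
    intro a
    have h1 : HasSum (fun i : {i // x i = a} ↦ c i.1) (conv f moebius a) := by
      have := hconv a
      rw [← hasSum_subtype_iff_of_support_subset (s := {i | x i = a})] at this
      · have e : (fun i : {i // x i = a} ↦ c i.1) =
            (fun i ↦ if x i = a then c i else 0) ∘ Subtype.val :=
          funext fun i ↦ (if_pos i.2).symm
        rw [e]
        exact this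
      · intro i hi
        by_contra h
        exact hi (if_neg h)
    have e : (fun i : {i // x i = a} ↦
        ((fun i ↦ c i / idealNorm (x i)) ∘ Equiv.sigmaFiberEquiv x) ⟨a, i⟩) =
        fun i ↦ c i.1 / idealNorm a := by
      refine funext fun i ↦ ?_
      obtain ⟨i, rfl⟩ := i
      rfl
    rw [e]
    exact h1.div_const (idealNorm a)
  exact (hsig.sigma hfib).tsum_eq

-- Averaging over the last variable divides each coefficient by the norm of its last divisor and
-- removes one divisibility condition, so the expansion has the same shape with one variable fewer.
open Classical in
theorem iteratedAverage_eq_tsum {ι : Type*} {n : ℕ} {θ : (Fin n → NzIdeal K) → ℝ} {c : ι → ℝ}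
    {x : ι → Fin n → NzIdeal K}
    (hθ : ∀ a, HasSum (fun j ↦ if ∀ i, x j i ∣ a i then c j else 0) (θ a))
    (hc : Summable fun j ↦ c j / ∏ i, idealNorm (x j i)) :
    iteratedAverage n θ = ∑' j, c j / ∏ i, idealNorm (x j i) := by
  induction n generalizing c with
  | zero =>
    rw [iteratedAverage, ← (hθ Fin.elim0).tsum_eq]
    simp
  | succ n ih =>
    have hlast : ∀ j, ∏ i, idealNorm (x j i) =
        (∏ i : Fin n, idealNorm (x j i.castSucc)) * idealNorm (x j (Fin.last n)) :=
      fun j ↦ Fin.prod_univ_castSucc _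
    have hdiv : ∀ j, c j / ∏ i, idealNorm (x j i) =
        c j / idealNorm (x j (Fin.last n)) / ∏ i : Fin n, idealNorm (x j i.castSucc) := by
      intro j
      rw [hlast, div_div, mul_comm]
    have hsum : ∀ a : Fin n → NzIdeal K,
        Summable fun j ↦ (if ∀ i : Fin n, x j i.castSucc ∣ a i then c j else 0) /
          idealNorm (x j (Fin.last n)) := by
      intro a
      -- For fixed `a`, divisibility bounds the missing norms by those of the `a i`, so the full
      -- summability hypothesis suffices.
      refine Summable.of_norm_bounded (hc.abs.mul_left (∏ i, idealNorm (a i))) fun j ↦ ?_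
      have h0 : 0 ≤ ∏ i, idealNorm (a i) := Finset.prod_nonneg fun i _ ↦ (idealNorm_pos _).le
      split_ifs with hdvd
      · have h1 : ∏ i : Fin n, idealNorm (x j i.castSucc) ≤ ∏ i, idealNorm (a i) := by
          refine Finset.prod_le_prod (fun i _ ↦ (idealNorm_pos _).le) fun i _ ↦ ?_
          obtain ⟨y, hy⟩ := hdvd i
          rw [hy, idealNorm_mul]
          exact le_mul_of_one_le_right (idealNorm_pos _).le (one_le_idealNorm _)
        have h2 : 0 < ∏ i : Fin n, idealNorm (x j i.castSucc) :=
          Finset.prod_pos fun i _ ↦ idealNorm_pos _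
        rw [hdiv, abs_div _ (∏ i : Fin n, idealNorm (x j i.castSucc)), abs_of_pos h2,
          Real.norm_eq_abs, mul_div_assoc', le_div_iff₀ h2, mul_comm]
        gcongr
      · rw [zero_div, norm_zero]
        positivity
    rw [iteratedAverage, tsum_congr hdiv]
    refine ih (x := fun j i ↦ x j i.castSucc) (fun a ↦ ?_) (by simpa only [hdiv] using hc)
    have havg := average_eq_tsum (f := fun y ↦ θ (Fin.snoc a y)) (x := fun j ↦ x j (Fin.last n))
      (c := fun j ↦ if ∀ i : Fin n, x j i.castSucc ∣ a i then c j else 0) (fun y ↦ ?_) (hsum a)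
    · rw [averageLast, havg]
      convert (hsum a).hasSum using 2 with j
      split_ifs <;> simp
    · convert hθ (Fin.snoc a y) using 2 with j
      have hiff : (∀ i, x j i ∣ (Fin.snoc a y : Fin (n + 1) → NzIdeal K) i) ↔
          (∀ i : Fin n, x j i.castSucc ∣ a i) ∧ x j (Fin.last n) ∣ y := by
        rw [Fin.forall_fin_succ']
        simp only [Fin.snoc_castSucc, Fin.snoc_last]
      simp only [hiff, ite_and]
      split_ifs <;> rfl

end Average

/-! ### Combining the expansion with the asymptotics -/

section Assembly

variable {K : Type*} [Field K] [NumberField K]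

lemma abs_le_of_hasSum {ι : Type*} {f : ι → ℝ} {s b : ℝ} (hf : HasSum f s)
    (hb : ∀ F : Finset ι, ∑ i ∈ F, |f i| ≤ b) : |s| ≤ b :=
  le_of_tendsto' hf.abs fun F ↦ (Finset.abs_sum_le_sum_abs _ _).trans (hb F)

-- Substitute `a i = d i * b i`. Ideals `b i` for which the product leaves the box are harmless
-- because `F` vanishes there.
open Classical in
lemma sum_dvd_eq_boxSum {B : ℝ} {n : ℕ} {F : (Fin n → ℝ) → ℝ}
    (hF : ∀ t, (∀ i, 1 ≤ t i) → (∃ i, B < t i) → F t = 0) (d : Fin n → NzIdeal K) :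
    ∑ a ∈ Fintype.piFinset (fun _ : Fin n ↦ idealsLE K B),
        (if ∀ i, d i ∣ a i then F fun i ↦ idealNorm (a i) else 0) =
      boxSum K B (fun i ↦ idealNorm (d i)) F := by
  rw [boxSum, ← Finset.sum_filter]
  symm
  have hnorm : ∀ b : Fin n → idealsLE K B, (fun i ↦ idealNorm (d i) * idealNorm (b i).1) =
      fun i ↦ idealNorm (d i * (b i).1) := fun b ↦ funext fun i ↦ (idealNorm_mul _ _).symm
  have hzero : ∀ b : Fin n → idealsLE K B,
      F (fun i ↦ idealNorm (d i) * idealNorm (b i).1) ≠ 0 →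
        ∀ i, idealNorm (d i * (b i).1) ≤ B := by
    intro b hb
    by_contra! hcon
    rw [hnorm] at hb
    exact hb (hF _ (fun i ↦ one_le_idealNorm _) hcon)
  rw [← Finset.sum_filter_of_ne fun b _ hb ↦ hzero b hb]
  refine Finset.sum_nbij (fun b i ↦ d i * (b i).1) (fun b hb ↦ ?_) (fun b _ b' _ h ↦ ?_)
    (fun a ha ↦ ?_) (fun b _ ↦ congrArg F (hnorm b))
  · simp only [Finset.mem_filter, Finset.mem_univ, true_and] at hb
    simp only [Finset.mem_filter, Fintype.mem_piFinset, mem_idealsLE]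
    exact ⟨hb, fun i ↦ dvd_mul_right _ _⟩
  · funext i
    exact Subtype.ext (nzIdeal_mul_left_cancel (congrFun h i))
  · simp only [Finset.coe_filter, Fintype.mem_piFinset, mem_idealsLE, mem_ofPred_eq] at ha
    obtain ⟨ha, hd⟩ := ha
    choose y hy using hd
    have hyB : ∀ i, idealNorm (y i) ≤ B := fun i ↦ by
      refine le_trans ?_ (ha i)
      rw [hy i, idealNorm_mul]
      exact le_mul_of_one_le_left (idealNorm_pos _).le (one_le_idealNorm _)
    refine ⟨fun i ↦ ⟨y i, mem_idealsLE.2 (hyB i)⟩, ?_, funext fun i ↦ (hy i).symm⟩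
    simp only [Finset.coe_filter, Finset.mem_univ, true_and, mem_ofPred_eq]
    exact fun i ↦ (hy i) ▸ ha i

lemma rho_nonneg : 0 ≤ rho K := by
  have := Units.regulator_pos K
  unfold rho
  positivity

end Assembly

end IdealSums

open IdealSums in
theorem mainTheorem5 (K : Type*) [Field K] [NumberField K] (r : ℕ) (hr : 1 ≤ r)
    (V : (Fin (r + 1) → ℝ) → ℝ → ℝ)
    (hV_meas : ∀ B, 3 ≤ B →
      Measurable fun t : {t : Fin (r + 1) → ℝ // ∀ i, 1 ≤ t i} => V t B)
    (hV_nonneg : ∀ t B, (∀ i, 1 ≤ t i) → 3 ≤ B → 0 ≤ V t B)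
    (hV_growth : IdealSums.GrowthB V ∨ IdealSums.GrowthC V)
    (hV_supp : ∀ t B, (∀ i, 1 ≤ t i) → 3 ≤ B → (∃ i, B < t i) → V t B = 0)
    (R : ℕ)
    (hV_mono : ∀ (t : Fin r → ℝ) (B : ℝ), (∀ i, 1 ≤ t i) → 3 ≤ B →
      IdealSums.PiecewiseMonotoneC1 (fun x => V (Fin.snoc t x) B) B R)
    (hV_tail_mono : ∀ (l : ℕ), l < r → ∀ (t : Fin l → ℝ) (B : ℝ), (∀ i, 1 ≤ t i) → 3 ≤ B →
      IdealSums.PiecewiseMonotoneC1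
        (fun x => IdealSums.tailIntegral (fun s => V s B) (l + 1) (Fin.snoc t x)) B R)
    (C : ℝ) (hC : 1 ≤ C) :
    ∃ c : ℝ, ∀ θ ∈ IdealSums.ThetaPrime K (r + 1) C, ∀ B : ℝ, 3 ≤ B →
      Summable (fun a : Fin (r + 1) → IdealSums.NzIdeal K =>
        θ a * V (fun i => IdealSums.idealNorm (a i)) B) ∧
      |(∑' a : Fin (r + 1) → IdealSums.NzIdeal K,
            θ a * V (fun i => IdealSums.idealNorm (a i)) B) -
          (IdealSums.rho K * NumberField.classNumber K) ^ (r + 1) *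
            IdealSums.iteratedAverage (r + 1) θ *
            IdealSums.tailIntegral (fun s => V s B) 0 Fin.elim0| ≤
        c * (B * Real.log B ^ (r - 1) * Real.log (Real.log B)) := by
  classical
  obtain ⟨k, γ, c₀, hk0, hk, hγ, hc₀, hgrowth⟩ := exists_growth_bound hV_growth
  obtain ⟨σ, C₀, hσ0, hσ1, hC₀, hcount⟩ := exists_countingBound K
  set κ : ℝ := rho K * NumberField.classNumber K with hκ
  have hκ0 : 0 ≤ κ := mul_nonneg rho_nonneg (Nat.cast_nonneg _)
  obtain ⟨A, hA, hbound⟩ := exists_abs_boxSum_sub_le hcount hκ0 hC₀ (by linarith) hσ1 hγ hr hk0 hk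
    hc₀ R (r + 1) le_rfl
  obtain ⟨M, hM⟩ := exists_expansion_summable hcount hC₀ hσ0 hσ1.le (r + 1)
    (zero_le_one.trans hC)
  have hlog3 : 1 < Real.log 3 := by
    rw [Real.lt_log_iff_exp_lt (by norm_num)]
    exact Real.exp_one_lt_three
  have hloglog3 : 0 < Real.log (Real.log 3) := Real.log_pos hlog3
  -- The argument bounds the error by `A * M * B * log B ^ (r - 1)`; dividing by `log (log 3) > 0`
  -- is enough to insert `log (log B)` for all `B ≥ 3`.
  refine ⟨A * M / Real.log (Real.log 3), fun θ hθ B hB ↦ ?_⟩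
  obtain ⟨c, hsum, hcM⟩ := hM θ hθ
  have hM0 : 0 ≤ M := by simpa using hcM ∅
  have hB0 : 0 < B := by linarith
  have hL : 0 ≤ Real.log B := zero_le_one.trans (one_le_log hB)
  have htower := tower_tailIntegral (V := fun s ↦ V s B) hB0.le (hV_meas B hB)
    (fun t ht ↦ hV_nonneg t B ht hB) (fun t ht ↦ hV_supp t B ht hB)
    (fun t ht ↦ hV_mono t B ht hB) (fun l hl t ht ↦ hV_tail_mono l hl t B ht hB) hγ.le hc₀
    (fun t ht ↦ hgrowth t B ht hB)
  set box := Fintype.piFinset fun _ : Fin (r + 1) ↦ idealsLE K B with hbox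
  have hzero : ∀ a ∉ box, θ a * V (fun i ↦ idealNorm (a i)) B = 0 := by
    intro a ha
    rw [hV_supp _ B (fun i ↦ one_le_idealNorm _) hB, mul_zero]
    by_contra! hcon
    exact ha (Fintype.mem_piFinset.2 fun i ↦ mem_idealsLE.2 (hcon i))
  refine ⟨(hasSum_sum_of_ne_finset_zero hzero).summable, ?_⟩
  rw [tsum_eq_sum hzero]
  set q : (Fin (r + 1) → Finset (HeightOneSpectrum (𝓞 K))) → Fin (r + 1) → ℝ :=
    fun ν i ↦ idealNorm (prodPrimes (ν i)) with hq
  have hq1 : ∀ ν i, 1 ≤ q ν i := fun ν i ↦ one_le_idealNorm _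
  -- For fixed `B` only finitely many tuples of ideals matter, so the expansion of `θ` may be summed
  -- term by term.
  have hlhs : HasSum (fun ν ↦ c ν * boxSum K B (q ν) fun s ↦ V s B)
      (∑ a ∈ box, θ a * V (fun i ↦ idealNorm (a i)) B) := by
    have e : (fun ν ↦ c ν * boxSum K B (q ν) fun s ↦ V s B) = fun ν ↦ ∑ a ∈ box,
        (if ∀ i, prodPrimes (ν i) ∣ a i then c ν else 0) * V (fun i ↦ idealNorm (a i)) B := by
      funext ν
      have h := sum_dvd_eq_boxSum (F := fun s ↦ V s B) (fun t ht ↦ hV_supp t B ht hB)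
        fun i ↦ prodPrimes (ν i)
      rw [hq, ← h, Finset.mul_sum]
      refine Finset.sum_congr rfl fun a _ ↦ ?_
      split_ifs <;> simp
    rw [e]
    exact hasSum_sum fun a _ ↦ (hsum a).mul_right _
  have hcsum : Summable fun ν ↦ c ν / ∏ i, q ν i := by
    refine Summable.of_norm_bounded
      (summable_of_sum_le (f := fun ν ↦ |c ν| * ∏ i, q ν i ^ (-σ)) (fun ν ↦ ?_) hcM) fun ν ↦ ?_
    · have : 0 ≤ ∏ i, q ν i ^ (-σ) :=
        Finset.prod_nonneg fun i _ ↦ Real.rpow_nonneg (zero_le_one.trans (hq1 ν i)) _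
      positivity
    · have h1 := prod_inv_le_prod_rpow (hq1 ν) hσ1.le
      have h2 : 0 ≤ ∏ i, q ν i := Finset.prod_nonneg fun i _ ↦ zero_le_one.trans (hq1 ν i)
      rw [Finset.prod_inv_distrib] at h1
      rw [norm_div, Real.norm_eq_abs, Real.norm_eq_abs, abs_of_nonneg h2, div_eq_mul_inv]
      gcongr
  have havg := iteratedAverage_eq_tsum hsum hcsum
  have hrhs : HasSum (fun ν ↦ κ ^ (r + 1) * (c ν / ∏ i, q ν i) *
      tailIntegral (fun s ↦ V s B) 0 Fin.elim0)
      (κ ^ (r + 1) * iteratedAverage (r + 1) θ * tailIntegral (fun s ↦ V s B) 0 Fin.elim0) := by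
    rw [havg]
    exact (hcsum.hasSum.mul_left _).mul_right _
  refine (abs_le_of_hasSum (hlhs.sub hrhs) (b := A * (B * Real.log B ^ (r - 1)) * M)
    fun F ↦ ?_).trans ?_
  · calc _ ≤ ∑ ν ∈ F, A * (B * Real.log B ^ (r - 1)) * (|c ν| * ∏ i, q ν i ^ (-σ)) := by
          refine Finset.sum_le_sum fun ν _ ↦ ?_
          have h := hbound B _ hB htower (q ν) (hq1 ν)
          have hself : tailIntegral (fun s ↦ V s B) (r + 1) = fun s ↦ V s B :=
            funext fun t ↦ tailIntegral_self t
          simp only [hself] at h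
          have e : c ν * boxSum K B (q ν) (fun s ↦ V s B) - κ ^ (r + 1) * (c ν / ∏ i, q ν i) *
              tailIntegral (fun s ↦ V s B) 0 Fin.elim0 =
              c ν * (boxSum K B (q ν) (fun s ↦ V s B) - κ ^ (r + 1) * (∏ i, (q ν i)⁻¹) *
                tailIntegral (fun s ↦ V s B) 0 Fin.elim0) := by
            rw [Finset.prod_inv_distrib]
            ring
          rw [e, abs_mul]
          refine (mul_le_mul_of_nonneg_left h (abs_nonneg _)).trans (le_of_eq ?_)
          ring
      _ ≤ _ := by
          rw [← Finset.mul_sum]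
          gcongr
          exact hcM F
  · have hll : Real.log (Real.log 3) ≤ Real.log (Real.log B) :=
      Real.log_le_log (by linarith) (Real.log_le_log (by norm_num) hB)
    calc _ = A * M / Real.log (Real.log 3) *
          (B * Real.log B ^ (r - 1) * Real.log (Real.log 3)) := by
          field_simp
      _ ≤ _ := by gcongr

end
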